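/- \textbf{Theorem (Indefinite Young integral).} Let $d\ge 1$ be an integer and let $\beta,\gamma\in(0,1)$ satisfy $\beta+d\gamma>d$. \emph{Notation.} $|E|$ is the Lebesgue measure of $E\subset\mathbb R^d$. The variation of an integrable $u:\mathbb R^d\to\mathbb R$ is $V u=\sup\int u\operatorname{div}v$ over compactly supported $C^1$ vector fields $v$ on $\mathbb R^d$ with $|v|\le 1$, and the perimeter of a measurable set $A$ is $\|A\|=V\mathbf 1_A$. $\mathcal{BV}([0,1]^d)$ is the collection of measurable subsets of $[0,1]^d$ of finite perimeter. A sequence $(B_n)$ in it $BV$-converges to $B$ if $|B_n\triangle B|\to0$ and $\sup_n\|B_n\|<\infty$. A \emph{charge} is a function $\omega:\mathcal{BV}([0,1]^d)\to\mathbb R$ with $\omega(B_1\cup B_2)=\omega(B_1)+\omega(B_2)$ whenever $|B_1\cap B_2|=0$, and $\omega(B_n)\to\omega(B)$ whenever $(B_n)$ $BV$-converges to $B$. For an integrable $g$ on $[0,1]^d$, $g\,d\mathcal L$ denotes the charge $B\mapsto\int_B g$. A \emph{dyadic cube} is a set $\prod_{i=1}^d[2^{-n}k_i,2^{-n}(k_i+1)]$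 with integers $n\ge0$ and $0\le k_i\le 2^n-1$. $\mathrm{sch}^\gamma([0,1]^d)$ is the linear space of charges $\omega$ such that $\|\omega\|_\gamma=\sup_K|\omega(K)|/|K|^\gamma<\infty$, the supremum being over dyadic cubes $K$. $BV([0,1]^d)$ is the space of integrable functions $u$ on $\mathbb R^d$ that vanish a.e. outside $[0,1]^d$ and have $Vu<\infty$, with norm $Vu$. $SCH$ is the closure, in the dual of $BV([0,1]^d)$, of the functionals $u\mapsto\int gu$, $g\in L^d([0,1]^d)$. $\mathrm{sch}([0,1]^d)$ is the space of charges $B\mapsto\alpha(\mathbf 1_B)$ with $\alpha\in SCH$, with the norm transported from $SCH$. $C^\beta([0,1]^d)$ is the linear space of functions $f:[0,1]^d\to\mathbb R$ such that $\mathrm{Lip}^\beta(f)=\sup_{x\ne y}|f(x)-f(y)|/|x-y|^\beta<\infty$. \emph{Statement.} There exists a unique bilinear map $$C^\beta([0,1]^d)\times \mathrm{sch}^\gamma([0,1]^d)\to \mathrm{sch}^\gamma([0,1]^d),\qquad (f,\omega)\mapsto f\cdot\omega,$$ such that: (A) for all $f\in C^\beta([0,1]^d)$ and $g\in L^{1/(1-\gamma)}([0,1]^d)$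 one has $g\,d\mathcal L\in\mathrm{sch}^\gamma([0,1]^d)$ and $f\cdot(g\,d\mathcal L)=fg\,d\mathcal L$; (B) if $(f_p)$ is a sequence in $C^\beta([0,1]^d)$ that converges uniformly to $f$, if $(\omega_p)$ is a sequence in $\mathrm{sch}^\gamma([0,1]^d)$ that converges to $\omega$ in $\mathrm{sch}([0,1]^d)$, and if $\sup_p\mathrm{Lip}^\beta(f_p)<\infty$ and $\sup_p\|\omega_p\|_\gamma<\infty$, then $f\in C^\beta([0,1]^d)$, $\omega\in\mathrm{sch}^\gamma([0,1]^d)$, and $f_p\cdot\omega_p\to f\cdot\omega$ in $\mathrm{sch}([0,1]^d)$. Furthermore, there is a constant $C\ge0$ depending only on $d,\beta,\gamma$ such that, for all $f\in C^\beta([0,1]^d)$ and $\omega\in\mathrm{sch}^\gamma([0,1]^d)$, $$|(f\cdot\omega)(K)|\le C\left(\|f|_K\|_\infty+|K|^{\beta/d}\,\mathrm{Lip}^\beta(f)\right)\|\omega\|_\gamma\,|K|^\gamma\quad\text{for every dyadic cube }K,$$ and in particular $$\|f\cdot\omega\|_\gamma\le C\left(\|f\|_\infty+\mathrm{Lip}^\beta(f)\right)\|\omega\|_\gamma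 .$$ -/

import Mathlib

open Set Filter Topology MeasureTheory
open scoped NNReal ENNReal symmDiff

namespace YoungCharge

/-- The ambient space `ℝ^d`, with its Euclidean norm and Lebesgue measure. -/
abbrev E (d : ℕ) : Type := EuclideanSpace ℝ (Fin d)

/-- The cube `[0, 1]^d`. -/
def cube (d : ℕ) : Set (E d) := {x | ∀ i, 0 ≤ x i ∧ x i ≤ 1}

/-- Lebesgue measure on the cube. -/
noncomputable def cubeVolume (d : ℕ) : Measure (cube d) :=
  (volume : Measure (E d)).comap Subtype.val

/-! ### Functions of bounded variation and `BV`-sets -/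

/-- The divergence of a vector field. -/
noncomputable def divergence {d : ℕ} (v : E d → E d) (x : E d) : ℝ :=
  ∑ i, fderiv ℝ v x (EuclideanSpace.single i 1) i

/-- Compactly supported vector fields of class `C¹` with `|v| ≤ 1` everywhere. -/
structure IsTestField {d : ℕ} (v : E d → E d) : Prop where
  contDiff : ContDiff ℝ 1 v
  compactSupport : HasCompactSupport v
  norm_le_one : ∀ x, ‖v x‖ ≤ 1

/-- The variation of an integrable function `u`: the supremum of `∫ u div v` over test fields
(the zero field is one of them, so truncating the integrals at `0` is harmless). -/
noncomputable def variation {d : ℕ} (u : E d → ℝ) : ℝ≥0∞ :=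
  ⨆ (v : E d → E d) (_ : IsTestField v), ENNReal.ofReal (∫ x, u x * divergence v x)

/-- The perimeter of a set: the variation of its indicator function. -/
noncomputable def perimeter {d : ℕ} (A : Set (E d)) : ℝ≥0∞ :=
  variation (A.indicator fun _ => (1 : ℝ))

/-- `BV`-sets: bounded Lebesgue measurable sets of finite perimeter. -/
structure IsBVSet {d : ℕ} (A : Set (E d)) : Prop where
  bounded : Bornology.IsBounded A
  measurable : NullMeasurableSet A volume
  perimeter_lt_top : perimeter A < ∞

/-- The collection of the `BV`-subsets of `[0, 1]^d`. -/
abbrev BVSubset (d : ℕ) : Type := {B : Set (E d) // IsBVSet B ∧ B ⊆ cube d}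

/-- `BV`-convergence of a sequence of `BV`-subsets of the cube. -/
def BVConverges {d : ℕ} (B : ℕ → BVSubset d) (B₀ : BVSubset d) : Prop :=
  Tendsto (fun n => volume ((B n : Set (E d)) ∆ (B₀ : Set (E d)))) atTop (𝓝 0) ∧
    ⨆ n, perimeter (B n : Set (E d)) < ∞

/-- Dyadic cubes in `[0, 1]^d`. -/
def IsDyadicCube {d : ℕ} (K : Set (E d)) : Prop :=
  ∃ (n : ℕ) (k : Fin d → ℕ), (∀ i, k i < 2 ^ n) ∧
    K = {x | ∀ i, (k i : ℝ) / 2 ^ n ≤ x i ∧ x i ≤ ((k i : ℝ) + 1) / 2 ^ n}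

/-! ### Charges -/

/-- Charges over `[0, 1]^d`: real functions on the `BV`-subsets of the cube that are additive on
almost disjoint sets and continuous with respect to `BV`-convergence. -/
structure IsCharge {d : ℕ} (ω : BVSubset d → ℝ) : Prop where
  additive : ∀ B₁ B₂ B : BVSubset d, volume ((B₁ : Set (E d)) ∩ B₂) = 0 →
    (B : Set (E d)) = (B₁ : Set (E d)) ∪ B₂ → ω B = ω B₁ + ω B₂
  continuous : ∀ (B : ℕ → BVSubset d) (B₀ : BVSubset d), BVConverges B B₀ →
    Tendsto (fun n => ω (B n)) atTop (𝓝 (ω B₀))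

/-- The linear space `sch^γ([0, 1]^d)` of `γ`-Hölder charges. -/
def holderCharge (d : ℕ) (γ : ℝ) : Submodule ℝ (BVSubset d → ℝ) where
  carrier := {ω | IsCharge ω ∧ ∃ κ : ℝ, 0 ≤ κ ∧ ∀ K : BVSubset d, IsDyadicCube (K : Set (E d)) →
    |ω K| ≤ κ * volume.real (K : Set (E d)) ^ γ}
  zero_mem' := by
    refine ⟨⟨fun _ _ _ _ _ => by simp, fun _ _ _ => ?_⟩, 0, le_rfl, fun K _ => by simp⟩
    exact tendsto_const_nhds
  add_mem' := by
    rintro ω η ⟨hω, κ, hκ, hK⟩ ⟨hη, l, hl, hL⟩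
    refine ⟨⟨fun B₁ B₂ B h h' => ?_, fun B B₀ h => ?_⟩, κ + l, by positivity, fun K hd => ?_⟩
    · simp only [Pi.add_apply, hω.additive B₁ B₂ B h h', hη.additive B₁ B₂ B h h']
      ring
    · exact (hω.continuous B B₀ h).add (hη.continuous B B₀ h)
    · rw [Pi.add_apply, add_mul]
      exact (abs_add_le _ _).trans (add_le_add (hK K hd) (hL K hd))
  smul_mem' := by
    rintro c ω ⟨hω, κ, hκ, hK⟩
    refine ⟨⟨fun B₁ B₂ B h h' => ?_, fun B B₀ h => ?_⟩, |c| * κ, by positivity, fun K hd => ?_⟩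
    · simp only [Pi.smul_apply, smul_eq_mul, hω.additive B₁ B₂ B h h']
      ring
    · exact (hω.continuous B B₀ h).const_mul c
    · rw [Pi.smul_apply, smul_eq_mul, abs_mul, mul_assoc]
      exact mul_le_mul_of_nonneg_left (hK K hd) (abs_nonneg c)

/-- The norm `‖ω‖_γ = sup |ω(K)| / |K|^γ` over dyadic cubes `K` (the supremum is finite for
`γ`-Hölder charges). -/
noncomputable def holderChargeNorm {d : ℕ} (γ : ℝ) (ω : BVSubset d → ℝ) : ℝ :=
  sSup {r | ∃ K : BVSubset d, IsDyadicCube (K : Set (E d)) ∧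
    r = |ω K| / volume.real (K : Set (E d)) ^ γ}

/-- The set function `g dL : B ↦ ∫_B g`, for a density `g` on the cube. -/
noncomputable def density {d : ℕ} (g : cube d → ℝ) (B : BVSubset d) : ℝ :=
  ∫ x in (Subtype.val ⁻¹' (B : Set (E d)) : Set (cube d)), g x ∂cubeVolume d

/-! ### The space `BV([0, 1]^d)` and strong charges -/

/-- `u` is an integrable function of bounded variation on `ℝ^d` that vanishes almost everywhere
outside the cube. -/
structure IsBVFun {d : ℕ} (u : E d → ℝ) : Prop where
  integrable : Integrable u volume
  eq_zero : ∀ᵐ x, x ∉ cube d → u x = 0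
  variation_lt_top : variation u < ∞

theorem continuous_divergence {d : ℕ} {v : E d → E d} (hv : IsTestField v) :
    Continuous (divergence v) := by
  unfold divergence
  have h : Continuous (fderiv ℝ v) := hv.contDiff.continuous_fderiv one_ne_zero
  fun_prop

theorem exists_bound_divergence {d : ℕ} {v : E d → E d} (hv : IsTestField v) :
    ∃ C, ∀ x, ‖divergence v x‖ ≤ C := by
  refine HasCompactSupport.exists_bound_of_continuous (f := divergence v) ?_
    (continuous_divergence hv)
  refine hv.compactSupport.fderiv (𝕜 := ℝ) |>.mono ?_
  intro x hx
  contrapose! hx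
  simp only [Function.mem_support, not_not] at hx ⊢
  simp [divergence, hx]

theorem integrable_mul_divergence {d : ℕ} {u : E d → ℝ} (hu : Integrable u volume)
    {v : E d → E d} (hv : IsTestField v) : Integrable (fun x => u x * divergence v x) volume := by
  obtain ⟨C, hC⟩ := exists_bound_divergence hv
  exact hu.mul_bdd (c := C) (continuous_divergence hv).aestronglyMeasurable (ae_of_all _ hC)

theorem IsTestField.neg {d : ℕ} {v : E d → E d} (hv : IsTestField v) :
    IsTestField (fun x => -v x) :=
  ⟨hv.contDiff.neg, hv.compactSupport.comp_left (g := fun y => -y) neg_zero,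
    fun x => by simpa using hv.norm_le_one x⟩

theorem divergence_neg {d : ℕ} (v : E d → E d) (x : E d) :
    divergence (fun y => -v y) x = -divergence v x := by
  have : fderiv ℝ (fun y => -v y) x = -fderiv ℝ v x := fderiv_fun_neg
  simp [divergence, this]

theorem variation_zero {d : ℕ} : variation (0 : E d → ℝ) = 0 := by
  simp [variation]

theorem variation_add_le {d : ℕ} {u w : E d → ℝ} (hu : Integrable u volume)
    (hw : Integrable w volume) : variation (u + w) ≤ variation u + variation w := by
  refine iSup₂_le fun v hv => ?_
  have h : ∫ x, (u + w) x * divergence v x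
      = (∫ x, u x * divergence v x) + ∫ x, w x * divergence v x := by
    rw [← integral_add (integrable_mul_divergence hu hv) (integrable_mul_divergence hw hv)]
    simp [add_mul]
  rw [h]
  exact ENNReal.ofReal_add_le.trans (add_le_add
    (le_iSup₂ (f := fun v (_ : IsTestField v) => ENNReal.ofReal (∫ x, u x * divergence v x)) v hv)
    (le_iSup₂ (f := fun v (_ : IsTestField v) => ENNReal.ofReal (∫ x, w x * divergence v x)) v hv))

theorem variation_smul_le {d : ℕ} (c : ℝ) (u : E d → ℝ) :
    variation (c • u) ≤ ENNReal.ofReal |c| * variation u := by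
  refine iSup₂_le fun v hv => ?_
  have key : ∃ w, IsTestField w ∧
      ∫ x, (c • u) x * divergence v x = |c| * ∫ x, u x * divergence w x := by
    rcases le_total 0 c with hc | hc
    · refine ⟨v, hv, ?_⟩
      rw [abs_of_nonneg hc, ← integral_const_mul]
      simp [mul_assoc]
    · refine ⟨_, hv.neg, ?_⟩
      rw [abs_of_nonpos hc, ← integral_const_mul]
      simp [mul_assoc, divergence_neg]
  obtain ⟨w, hw, h⟩ := key
  rw [h, ENNReal.ofReal_mul (abs_nonneg c)]
  gcongr
  exact le_iSup₂ (f := fun v (_ : IsTestField v) => ENNReal.ofReal (∫ x, u x * divergence v x)) w hw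

/-- The functions of `BV([0, 1]^d)`, as a linear space. -/
def bvSubmodule (d : ℕ) : Submodule ℝ (E d → ℝ) where
  carrier := {u | IsBVFun u}
  zero_mem' := ⟨integrable_zero _ _ _, by simp, by simp [variation_zero]⟩
  add_mem' := by
    rintro u w hu hw
    refine ⟨hu.integrable.add hw.integrable, ?_, (variation_add_le hu.integrable
      hw.integrable).trans_lt (ENNReal.add_lt_top.2 ⟨hu.variation_lt_top, hw.variation_lt_top⟩)⟩
    filter_upwards [hu.eq_zero, hw.eq_zero] with x h1 h2 hx
    simp [h1 hx, h2 hx]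
  smul_mem' := by
    rintro c u hu
    refine ⟨hu.integrable.smul c, ?_, (variation_smul_le c u).trans_lt
      (ENNReal.mul_lt_top ENNReal.ofReal_lt_top hu.variation_lt_top)⟩
    filter_upwards [hu.eq_zero] with x h1 hx
    simp [h1 hx]

/-- The space `BV([0, 1]^d)`. Functions are not identified almost everywhere; two functions that
agree almost everywhere are at distance `0`, so the dual space is unaffected. -/
def BVFun (d : ℕ) : Type := bvSubmodule d

noncomputable instance (d : ℕ) : AddCommGroup (BVFun d) :=
  inferInstanceAs (AddCommGroup (bvSubmodule d))

noncomputable instance (d : ℕ) : Module ℝ (BVFun d) :=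
  inferInstanceAs (Module ℝ (bvSubmodule d))

/-- The underlying function on `ℝ^d`. -/
def BVFun.toFun {d : ℕ} (u : BVFun d) : E d → ℝ := u.1

/-- The norm of `BV([0, 1]^d)` is the variation. -/
noncomputable instance (d : ℕ) : Norm (BVFun d) := ⟨fun u => (variation u.toFun).toReal⟩

theorem BVFun.core (d : ℕ) : SeminormedSpace.Core ℝ (BVFun d) where
  norm_nonneg _ := ENNReal.toReal_nonneg
  norm_triangle u w := by
    have hu : IsBVFun u.toFun := u.2
    have hw : IsBVFun w.toFun := w.2
    change (variation (u.toFun + w.toFun)).toReal ≤ (variation u.toFun).toReal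
      + (variation w.toFun).toReal
    rw [← ENNReal.toReal_add hu.variation_lt_top.ne hw.variation_lt_top.ne]
    exact ENNReal.toReal_mono (ENNReal.add_lt_top.2
      ⟨hu.variation_lt_top, hw.variation_lt_top⟩).ne
      (variation_add_le hu.integrable hw.integrable)
  norm_smul := by
    have le : ∀ (c : ℝ) (u : BVFun d), ‖c • u‖ ≤ |c| * ‖u‖ := by
      intro c u
      have hu : IsBVFun u.toFun := u.2
      change (variation (c • u.toFun)).toReal ≤ |c| * (variation u.toFun).toReal
      have h := ENNReal.toReal_mono
        (ENNReal.mul_lt_top ENNReal.ofReal_lt_top hu.variation_lt_top).ne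
        (variation_smul_le c u.toFun)
      rwa [ENNReal.toReal_mul, ENNReal.toReal_ofReal (abs_nonneg c)] at h
    intro c u
    rw [Real.norm_eq_abs]
    refine le_antisymm (le c u) ?_
    rcases eq_or_ne c 0 with rfl | hc
    · rw [abs_zero, zero_mul]
      exact ENNReal.toReal_nonneg
    · have h := le c⁻¹ (c • u)
      rw [smul_smul, inv_mul_cancel₀ hc, one_smul, abs_inv] at h
      have hc' : 0 < |c| := abs_pos.2 hc
      calc |c| * ‖u‖ ≤ |c| * (|c|⁻¹ * ‖c • u‖) := mul_le_mul_of_nonneg_left h hc'.le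
        _ = ‖c • u‖ := by field_simp

noncomputable instance (d : ℕ) : SeminormedAddCommGroup (BVFun d) :=
  SeminormedAddCommGroup.ofCore (BVFun.core d)

noncomputable instance (d : ℕ) : NormedSpace ℝ (BVFun d) where
  norm_smul_le c u := ((BVFun.core d).norm_smul c u).le

/-- The indicator function of a `BV`-subset of the cube, as an element of `BV([0, 1]^d)`. -/
noncomputable def bvIndicator {d : ℕ} (B : BVSubset d) : BVFun d :=
  ⟨(B : Set (E d)).indicator fun _ => (1 : ℝ), by
    refine ⟨?_, ae_of_all _ fun x hx => ?_, B.2.1.perimeter_lt_top⟩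
    · exact (integrableOn_const B.2.1.bounded.measure_lt_top.ne).integrable_indicator₀
        B.2.1.measurable
    · exact indicator_of_notMem (fun h => hx (B.2.2 h)) _⟩

/-- The space `SCH([0, 1]^d)` of strong charge functionals: the closure, in the dual of
`BV([0, 1]^d)` for the operator norm, of the functionals `T_g : u ↦ ∫ g u` with `g ∈ L^d`. -/
def strongChargeFunctionals (d : ℕ) : Set (StrongDual ℝ (BVFun d)) :=
  closure {α | ∃ g : cube d → ℝ, MemLp g (d : ℝ≥0∞) (cubeVolume d) ∧
    ∀ u : BVFun d, α u = ∫ x : cube d, g x * u.toFun x ∂cubeVolume d}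

/-- `ω` is the strong charge `B ↦ α(1_B)` associated with the strong charge functional `α`. -/
def IsStrongChargeOf {d : ℕ} (ω : BVSubset d → ℝ) (α : StrongDual ℝ (BVFun d)) : Prop :=
  α ∈ strongChargeFunctionals d ∧ ∀ B, ω B = α (bvIndicator B)

/-- Convergence in the space `sch([0, 1]^d)` of strong charges, whose norm is transported from the
operator norm of `SCH([0, 1]^d)` through the correspondence `α ↦ (B ↦ α(1_B))`. In particular all
the charges involved are strong. -/
def TendstoSch {d : ℕ} (ω : ℕ → BVSubset d → ℝ) (ω₀ : BVSubset d → ℝ) : Prop :=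
  ∃ (α : ℕ → StrongDual ℝ (BVFun d)) (α₀ : StrongDual ℝ (BVFun d)),
    (∀ p, IsStrongChargeOf (ω p) (α p)) ∧ IsStrongChargeOf ω₀ α₀ ∧
      Tendsto (fun p => ‖α p - α₀‖) atTop (𝓝 0)

/-! ### Hölder functions and the indefinite Young integral -/

/-- The linear space `C^β([0, 1]^d)`. The seminorm `Lip^β` is Mathlib's `nnHolderNorm β`. -/
def holderFun (d : ℕ) (β : ℝ≥0) : Submodule ℝ (cube d → ℝ) where
  carrier := {f | MemHolder β f}
  zero_mem' := memHolder_zero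
  add_mem' hf hg := hf.add hg
  smul_mem' _ _ hf := hf.smul

/-- The supremum `‖f|_K‖_∞` of `|f|` over the points of the cube that lie in `K`. -/
noncomputable def supNormOn {d : ℕ} (f : cube d → ℝ) (K : Set (E d)) : ℝ :=
  sSup {r | ∃ x : cube d, (x : E d) ∈ K ∧ r = |f x|}

/-- The two properties that characterise the indefinite Young integral among bilinear maps
`C^β × sch^γ → sch^γ`. Each part also asserts that the objects to which the map is applied belong
to its domain. -/
structure IsIndefiniteYoung {d : ℕ} {β : ℝ≥0} {γ : ℝ}
    (Y : holderFun d β →ₗ[ℝ] holderCharge d γ →ₗ[ℝ] holderCharge d γ) : Prop where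
  /-- `f · (g dL) = (f g) dL` for `g ∈ L^{1/(1-γ)}`. -/
  density_eq : ∀ (f : holderFun d β) (g : cube d → ℝ),
    MemLp g (ENNReal.ofReal (1 / (1 - γ))) (cubeVolume d) →
      ∃ hg : density g ∈ holderCharge d γ,
        (Y f ⟨density g, hg⟩ : BVSubset d → ℝ) = density fun x => (f : cube d → ℝ) x * g x
  /-- Sequential continuity. -/
  tendsto : ∀ (f : ℕ → holderFun d β) (f₀ : cube d → ℝ) (ω : ℕ → holderCharge d γ)
    (ω₀ : BVSubset d → ℝ),
    TendstoUniformly (fun p => (f p : cube d → ℝ)) f₀ atTop →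
    TendstoSch (fun p => (ω p : BVSubset d → ℝ)) ω₀ →
    BddAbove (range fun p => nnHolderNorm β (f p : cube d → ℝ)) →
    BddAbove (range fun p => holderChargeNorm γ (ω p : BVSubset d → ℝ)) →
      ∃ (hf : f₀ ∈ holderFun d β) (hω : ω₀ ∈ holderCharge d γ),
        TendstoSch (fun p => (Y (f p) (ω p) : BVSubset d → ℝ))
          (Y ⟨f₀, hf⟩ ⟨ω₀, hω⟩ : BVSubset d → ℝ)

end YoungCharge

namespace YoungCharge

/-! The integral is a limit of Riemann sums. For each generation `n`, let the step function take the
value f(corner of Q) ω(Q)/|Q| on each dyadic cell Q of generation n, and view it as a functional on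
BV (`youngStep`). Two bounds make this sequence Cauchy in the dual of BV. A step function bounded by
M has norm at most M, by the Poincaré inequality. If it also has mean zero on every cell of the
previous generation, a factor 2^(-n) is gained (`norm_stepFunctional_succ_le`), because translating
u by h changes it by at most |h| Vu in L¹ (`integral_abs_translate_sub_le`). Passing from generation
n to n + 1 produces two terms. One carries the increment of f between neighbouring corners, of order
2^(-nβ), times the mean density of ω, of order |Q|^(γ-1). The other carries the change of the mean
density of ω; it has mean zero because ω is additive, and is of order 2^(-n) |Q|^(γ-1). Both are
O(q^n) with q = 2^(-(β + dγ - d)), and q < 1 is exactly the hypothesis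
(`norm_youngStep_succ_sub_le`). The limit lies in SCH, hence induces a charge. Tested against the
indicator of a dyadic cube K, the mean-zero terms disappear and only increments of f inside K
remain, which gives the local estimate (`abs_youngCharge_cell_le`). A charge is determined by its
values on dyadic cells (`IsCharge.ext_cell`): a BV set is the BV-limit of the figures made of the
cells it fills by more than half, and the perimeters of these figures are controlled by the same L¹
translation estimate. Property (A) is then checked on cells, where f is nearly constant. Property
(B) holds because the rate of convergence is uniform on bounded families while a single Riemann sum
involves finitely many values of f and ω. For uniqueness, the Riemann sums with f = 1 approximate ω
in sch by charges with bounded densities and bounded γ-norm, so (A) and (B) prescribe the value of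
the map at every pair. -/

/-! ### Translations of functions of bounded variation -/

/-- Duality between `L¹` and smooth compactly supported functions. -/
theorem integral_abs_le_of_forall_test {d : ℕ} {w : E d → ℝ} (hw : Integrable w volume) {M : ℝ}
    (h : ∀ ψ : E d → ℝ, ContDiff ℝ 1 ψ → HasCompactSupport ψ → (∀ x, |ψ x| ≤ 1) →
      ∫ x, w x * ψ x ≤ M) : ∫ x, |w x| ≤ M := by
  refine le_of_forall_pos_le_add fun ε hε => ?_
  obtain ⟨g, hgs, hgc, hg⟩ := MemLp.exist_eLpNorm_sub_le (p := 1) ENNReal.one_ne_top le_rfl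
    (memLp_one_iff_integrable.2 hw) (show 0 < ε / 3 by positivity)
  have hgi : Integrable g volume := hgc.continuous.integrable_of_hasCompactSupport hgs
  have hwg : ∫ x, |w x - g x| ≤ ε / 3 := by
    have h1 := hw.sub hgi
    rw [eLpNorm_one_eq_lintegral_enorm] at hg
    have h2 := integral_norm_eq_lintegral_enorm h1.aestronglyMeasurable
    have h3 := ENNReal.toReal_mono ENNReal.ofReal_ne_top hg
    rw [ENNReal.toReal_ofReal (by positivity), ← h2] at h3
    simpa using h3
  set m : ℝ := volume.real (tsupport g) with hm
  have hm0 : 0 ≤ m := measureReal_nonneg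
  -- The total error δ m over the support of g must stay below ε / 3; the added 1 covers m = 0.
  set δ : ℝ := ε / 3 / (m + 1) with hδ
  have hδ0 : 0 < δ := by positivity
  have hpos : ∀ x, 0 < g x ^ 2 + δ ^ 2 := fun x => by positivity
  -- A C¹ substitute for the sign of g: it is bounded by 1 and |g| ≤ g ψ + δ.
  set ψ : E d → ℝ := fun x => g x / √(g x ^ 2 + δ ^ 2) with hψ
  have hgc1 : ContDiff ℝ 1 g := hgc.of_le (by exact_mod_cast le_top)
  have hψc : ContDiff ℝ 1 ψ := by
    refine hgc1.div (ContDiff.sqrt (by fun_prop) fun x => (hpos x).ne') fun x => ?_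
    exact (Real.sqrt_pos.2 (hpos x)).ne'
  have hψs : HasCompactSupport ψ := by
    refine hgs.mono fun x hx => ?_
    contrapose! hx
    simp only [Function.mem_support, not_not] at hx ⊢
    simp [hψ, hx]
  have hψ1 : ∀ x, |ψ x| ≤ 1 := by
    intro x
    rw [hψ, abs_div, abs_of_pos (Real.sqrt_pos.2 (hpos x)),
      div_le_one (Real.sqrt_pos.2 (hpos x))]
    refine Real.le_sqrt_of_sq_le ?_
    rw [sq_abs]
    nlinarith
  have hψi : Integrable ψ volume := hψc.continuous.integrable_of_hasCompactSupport hψs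
  have hgψ : Integrable (fun x => g x * ψ x) volume :=
    hgi.mul_bdd (c := 1) hψc.continuous.aestronglyMeasurable (ae_of_all _ hψ1)
  have hwψ : Integrable (fun x => w x * ψ x) volume :=
    hw.mul_bdd (c := 1) hψc.continuous.aestronglyMeasurable (ae_of_all _ hψ1)
  have hind : Integrable ((tsupport g).indicator fun _ => δ) volume :=
    (integrable_indicator_iff (isClosed_tsupport g).measurableSet).2
      (integrableOn_const hgs.isCompact.measure_lt_top.ne)
  have hpt : ∀ x, |g x| ≤ g x * ψ x + (tsupport g).indicator (fun _ => δ) x := by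
    intro x
    by_cases hx : x ∈ tsupport g
    · rw [indicator_of_mem hx]
      have hs := Real.sqrt_pos.2 (hpos x)
      have hsq := Real.sq_sqrt (hpos x).le
      have h1 : g x * ψ x = g x ^ 2 / √(g x ^ 2 + δ ^ 2) := by
        simp only [hψ]; ring
      rw [h1, div_add' _ _ _ hs.ne', le_div_iff₀ hs]
      have h2 : |g x| ≤ √(g x ^ 2 + δ ^ 2) := by
        refine Real.le_sqrt_of_sq_le ?_
        rw [sq_abs]; nlinarith
      have h3 : √(g x ^ 2 + δ ^ 2) ≤ |g x| + δ := by
        refine Real.sqrt_le_iff.2 ⟨by positivity, ?_⟩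
        nlinarith [sq_abs (g x), abs_nonneg (g x), mul_nonneg (abs_nonneg (g x)) hδ0.le]
      nlinarith [sq_abs (g x), abs_nonneg (g x)]
    · have : g x = 0 := image_eq_zero_of_notMem_tsupport hx
      simp [this, indicator_of_notMem hx]
  have h1 : ∫ x, |g x| ≤ (∫ x, g x * ψ x) + ε / 3 := by
    refine (integral_mono hgi.abs (hgψ.add hind) hpt).trans ?_
    have h2 : ∫ x, (tsupport g).indicator (fun _ => δ) x = m * δ := by
      rw [integral_indicator (isClosed_tsupport g).measurableSet]
      simp [hm, Measure.real]
    rw [integral_add' hgψ hind, h2]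
    have : m * δ ≤ ε / 3 := by
      rw [hδ, mul_div_assoc', div_le_iff₀ (by positivity)]
      nlinarith
    linarith
  have hwgi : Integrable (fun x => |w x - g x|) volume := (hw.sub hgi).abs
  have h2 : ∫ x, |w x| ≤ (∫ x, |w x - g x|) + ∫ x, |g x| := by
    rw [← integral_add hwgi hgi.abs]
    refine integral_mono hw.abs (hwgi.add hgi.abs) fun x => ?_
    have := abs_add_le (w x - g x) (g x)
    simpa using this
  have h3 : ∫ x, g x * ψ x ≤ (∫ x, |w x - g x|) + ∫ x, w x * ψ x := by
    rw [← integral_add hwgi hwψ]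
    refine integral_mono hgψ (hwgi.add hwψ) fun x => ?_
    have h4 : (g x - w x) * ψ x ≤ |w x - g x| := by
      refine (le_abs_self _).trans ?_
      rw [abs_mul, abs_sub_comm]
      exact mul_le_of_le_one_right (abs_nonneg _) (hψ1 x)
    have : g x * ψ x ≤ |w x - g x| + w x * ψ x := by linarith
    exact this
  have h4 := h ψ hψc hψs hψ1
  linarith

theorem integral_mul_divergence_le {d : ℕ} {u : E d → ℝ} (hu : variation u < ∞) {v : E d → E d}
    (hv : IsTestField v) : ∫ x, u x * divergence v x ≤ (variation u).toReal := by
  rw [← ENNReal.ofReal_le_iff_le_toReal hu.ne]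
  exact le_iSup₂ (f := fun v (_ : IsTestField v) => ENNReal.ofReal (∫ x, u x * divergence v x)) v hv

theorem sum_smul_single {d : ℕ} (c : E d) : ∑ i, c i • EuclideanSpace.single i (1 : ℝ) = c := by
  ext j
  simp [Finset.sum_apply, Pi.single_apply]

theorem divergence_smul_const {d : ℕ} {ψ : E d → ℝ} (hψ : Differentiable ℝ ψ) (c x : E d) :
    divergence (fun y => ψ y • c) x = fderiv ℝ ψ x c := by
  have h : fderiv ℝ (fun y => ψ y • c) x = (fderiv ℝ ψ x).smulRight c :=
    fderiv_smul_const (hψ x) c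
  unfold divergence
  conv_rhs => rw [← sum_smul_single c, map_sum]
  simp [h, mul_comm]

/-- Integration by parts against the directional derivative of a bounded function. -/
theorem integral_mul_fderiv_le {d : ℕ} {u : E d → ℝ} (hu : variation u < ∞) {ψ : E d → ℝ}
    (hψ : ContDiff ℝ 1 ψ) (hs : HasCompactSupport ψ) (h1 : ∀ x, |ψ x| ≤ 1) (c : E d) :
    ∫ x, u x * fderiv ℝ ψ x c ≤ ‖c‖ * (variation u).toReal := by
  rcases eq_or_ne c 0 with rfl | hc
  · simp
  have hc' : 0 < ‖c‖ := norm_pos_iff.2 hc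
  -- The divergence of this field is the derivative of ψ in the direction c, divided by |c|.
  have hv : IsTestField fun y => ψ y • (‖c‖⁻¹ • c) := by
    refine ⟨by fun_prop, hs.smul_right, fun x => ?_⟩
    rw [norm_smul, norm_smul, norm_inv, norm_norm, inv_mul_cancel₀ hc'.ne', mul_one]
    exact h1 x
  have h := integral_mul_divergence_le hu hv
  have h2 : ∀ x, u x * divergence (fun y => ψ y • (‖c‖⁻¹ • c)) x
      = ‖c‖⁻¹ * (u x * fderiv ℝ ψ x c) := by
    intro x
    rw [divergence_smul_const (hψ.differentiable one_ne_zero), map_smul, smul_eq_mul]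
    ring
  simp_rw [h2] at h
  rw [integral_const_mul, inv_mul_le_iff₀ hc'] at h
  exact h

/-- The `L¹` modulus of continuity of a function of bounded variation. -/
theorem integral_abs_translate_sub_le {d : ℕ} {u : E d → ℝ} (hu : Integrable u volume)
    (hv : variation u < ∞) (h : E d) :
    ∫ x, |u (x + h) - u x| ≤ ‖h‖ * (variation u).toReal := by
  refine integral_abs_le_of_forall_test ((hu.comp_add_right h).sub hu) fun ψ hψ hs h1 => ?_
  obtain ⟨C, hC⟩ : ∃ C, ∀ x, ‖fderiv ℝ ψ x‖ ≤ C :=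
    (hs.fderiv (𝕜 := ℝ)).exists_bound_of_continuous (hψ.continuous_fderiv one_ne_zero)
  have hd : Differentiable ℝ ψ := hψ.differentiable one_ne_zero
  have hfc : Continuous (fderiv ℝ ψ) := hψ.continuous_fderiv one_ne_zero
  have hint : ∀ t : ℝ, Integrable (fun x => u x * ψ (x - t • h)) volume := fun t =>
    hu.mul_bdd (c := 1) (by fun_prop) (ae_of_all _ fun x => h1 _)
  -- Moving the translation onto ψ makes the quantity to be bounded the increment over [0, 1] of a
  -- differentiable function of t, whose derivative pairs u with a directional derivative of a test
  -- function.
  have hderiv : ∀ t : ℝ, HasDerivAt (fun t : ℝ => ∫ x, u x * ψ (x - t • h))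
      (∫ x, u x * fderiv ℝ ψ (x - t • h) (-h)) t := by
    intro t
    refine (hasDerivAt_integral_of_dominated_loc_of_deriv_le (s := univ)
      (F' := fun t x => u x * fderiv ℝ ψ (x - t • h) (-h))
      (bound := fun x => |u x| * (C * ‖h‖)) univ_mem
      (Eventually.of_forall fun t => (hint t).aestronglyMeasurable) (hint t) ?_ ?_ ?_ ?_).2
    · exact hu.aestronglyMeasurable.mul (by fun_prop)
    · refine ae_of_all _ fun x t _ => ?_
      rw [norm_mul, Real.norm_eq_abs]
      gcongr
      refine (ContinuousLinearMap.le_opNorm _ _).trans ?_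
      rw [norm_neg]
      gcongr
      exact hC _
    · exact hu.abs.mul_const _
    · refine ae_of_all _ fun x t _ => ?_
      refine HasDerivAt.const_mul (u x) ?_
      have h2 : HasDerivAt (fun t : ℝ => x - t • h) (-h) t := by
        simpa using ((hasDerivAt_id t).smul_const h).const_sub x
      exact ((hd _).hasFDerivAt).comp_hasDerivAt t h2
  have hbound : ∀ t : ℝ, ∫ x, u x * fderiv ℝ ψ (x - t • h) (-h) ≤ ‖h‖ * (variation u).toReal := by
    intro t
    have h3 : ∀ x, fderiv ℝ (fun y => ψ (y - t • h)) x = fderiv ℝ ψ (x - t • h) := fun x => by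
      simp only [sub_eq_add_neg, fderiv_comp_add_right]
    have := integral_mul_fderiv_le (u := u) hv (ψ := fun y => ψ (y - t • h)) (by fun_prop)
      (hs.comp_homeomorph (Homeomorph.subRight (t • h))) (fun x => h1 _) (-h)
    simpa [h3] using this
  have hsub : ∫ x, (u (x + h) - u x) * ψ x
      = (∫ x, u x * ψ (x - (1 : ℝ) • h)) - ∫ x, u x * ψ (x - (0 : ℝ) • h) := by
    have h4 : ∫ x, u x * ψ (x - (1 : ℝ) • h) = ∫ x, u (x + h) * ψ x := by
      rw [← integral_add_right_eq_self (fun x => u x * ψ (x - (1 : ℝ) • h)) h]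
      simp
    rw [h4, ← integral_sub _ (hint 0)]
    · simp [sub_mul]
    · exact (hu.comp_add_right h).mul_bdd (c := 1) hψ.continuous.aestronglyMeasurable
        (ae_of_all _ h1)
  refine hsub.trans_le ?_
  have := image_sub_le_mul_sub_of_deriv_le (f := fun t : ℝ => ∫ x, u x * ψ (x - t • h))
    (fun t => (hderiv t).differentiableAt) (fun t => (hderiv t).deriv ▸ hbound t)
    (show (0 : ℝ) ≤ 1 by norm_num)
  simpa using this

theorem variation_congr_ae {d : ℕ} {u w : E d → ℝ} (h : u =ᵐ[volume] w) :
    variation u = variation w := by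
  unfold variation
  congr! 4 with v hv
  exact integral_congr_ae (h.mono fun x hx => by simp [hx])

/-- A function whose translates along the coordinate axes are Lipschitz in `L¹` is of bounded
variation. -/
theorem variation_le_of_translate {d : ℕ} {u : E d → ℝ} (hu : Integrable u volume) (M : Fin d → ℝ)
    {s₀ : ℝ} (hs₀ : 0 < s₀)
    (h : ∀ i, ∀ s ∈ Ioo 0 s₀, ∫ x, |u (x + s • EuclideanSpace.single i (1 : ℝ)) - u x| ≤ s * M i) :
    variation u ≤ ENNReal.ofReal (∑ i, M i) := by
  refine iSup₂_le fun v hv => ENNReal.ofReal_le_ofReal ?_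
  have hfc : Continuous (fderiv ℝ v) := hv.contDiff.continuous_fderiv one_ne_zero
  have hd : Differentiable ℝ v := hv.contDiff.differentiable one_ne_zero
  obtain ⟨C, hC⟩ : ∃ C, ∀ x, ‖fderiv ℝ v x‖ ≤ C :=
    (hv.compactSupport.fderiv (𝕜 := ℝ)).exists_bound_of_continuous hfc
  have hpart : ∀ i x, |fderiv ℝ v x (EuclideanSpace.single i 1) i| ≤ C := by
    intro i x
    refine (PiLp.norm_apply_le (fderiv ℝ v x (EuclideanSpace.single i 1)) i).trans ?_
    refine (ContinuousLinearMap.le_opNorm _ _).trans ?_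
    simpa using hC x
  have hcomp : ∀ i x, |v x i| ≤ 1 := fun i x => (PiLp.norm_apply_le (v x) i).trans (hv.norm_le_one x)
  have hint : ∀ i, Integrable
      (fun x => u x * fderiv ℝ v x (EuclideanSpace.single i 1) i) volume := fun i =>
    hu.mul_bdd (c := C) (by fun_prop) (ae_of_all _ (hpart i))
  have hexp : ∫ x, u x * divergence v x
      = ∑ i, ∫ x, u x * fderiv ℝ v x (EuclideanSpace.single i 1) i := by
    rw [← integral_finsetSum _ fun i _ => hint i]
    simp [divergence, Finset.mul_sum]
  rw [hexp]
  refine Finset.sum_le_sum fun i _ => ?_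
  set e : E d := EuclideanSpace.single i 1 with he
  have hvi : ∀ x, HasDerivAt (fun s : ℝ => v (x - s • e) i) (-(fderiv ℝ v x e i)) 0 := by
    intro x
    have h1 : HasDerivAt (fun s : ℝ => x - s • e) (-e) 0 := by
      simpa using ((hasDerivAt_id (0 : ℝ)).smul_const e).const_sub x
    have h2 : HasDerivAt (fun s : ℝ => v (x - s • e)) (fderiv ℝ v (x - (0 : ℝ) • e) (-e)) 0 :=
      ((hd _).hasFDerivAt).comp_hasDerivAt (0 : ℝ) h1
    have h3 := ((EuclideanSpace.proj (𝕜 := ℝ) i).hasFDerivAt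
      (x := v (x - (0 : ℝ) • e))).comp_hasDerivAt (0 : ℝ) h2
    refine h3.congr_deriv ?_
    simp
  have hlip : ∀ x (s : ℝ), |v x i - v (x - s • e) i| ≤ C * |s| := by
    intro x s
    have h1 : ‖v x - v (x - s • e)‖ ≤ C * ‖x - (x - s • e)‖ :=
      Convex.norm_image_sub_le_of_norm_fderiv_le (fun y _ => hd y) (fun y _ => hC y)
        convex_univ (mem_univ _) (mem_univ _)
    have h2 : ‖x - (x - s • e)‖ = |s| := by simp [he, norm_smul]
    rw [h2] at h1
    exact (PiLp.norm_apply_le (v x - v (x - s • e)) i).trans h1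
  -- The partial derivative is replaced by a difference quotient. A change of variables then moves
  -- the difference from v to u, where the hypothesis applies.
  have hlim : Tendsto (fun s : ℝ => ∫ x, u x * (s⁻¹ * (v x i - v (x - s • e) i))) (𝓝[>] 0)
      (𝓝 (∫ x, u x * fderiv ℝ v x e i)) := by
    refine tendsto_integral_filter_of_dominated_convergence (fun x => |u x| * C) ?_ ?_ ?_ ?_
    · refine Eventually.of_forall fun s => hu.aestronglyMeasurable.mul ?_
      have : Continuous v := hd.continuous
      fun_prop
    · filter_upwards [self_mem_nhdsWithin] with s (hs : 0 < s)
      refine ae_of_all _ fun x => ?_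
      rw [norm_mul, norm_mul, norm_inv, Real.norm_eq_abs, Real.norm_eq_abs, Real.norm_eq_abs]
      gcongr
      rw [inv_mul_le_iff₀ (abs_pos.2 hs.ne'), mul_comm]
      exact hlip x s
    · exact hu.abs.mul_const _
    · refine ae_of_all _ fun x => Tendsto.const_mul _ ?_
      have h1 := (hvi x).tendsto_slope.neg
      rw [neg_neg] at h1
      refine (h1.mono_left (nhdsWithin_mono _ fun s (hs : 0 < s) => hs.ne')).congr fun s => ?_
      simp [slope_def_field]
      ring
  refine le_of_tendsto hlim ?_
  filter_upwards [Ioo_mem_nhdsGT hs₀] with s hs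
  have hvc : Continuous v := hd.continuous
  have hi1 : Integrable (fun x => u x * v x i) volume :=
    hu.mul_bdd (c := 1) (by fun_prop) (ae_of_all _ (hcomp i))
  have hi2 : Integrable (fun x => u x * v (x - s • e) i) volume :=
    hu.mul_bdd (c := 1) (by fun_prop) (ae_of_all _ fun x => hcomp i _)
  have hi3 : Integrable (fun x => u (x + s • e) * v x i) volume :=
    (hu.comp_add_right _).mul_bdd (c := 1) (by fun_prop) (ae_of_all _ (hcomp i))
  have h5 : ∫ x, u x * v (x - s • e) i = ∫ x, u (x + s • e) * v x i := by
    rw [← integral_add_right_eq_self (fun x => u x * v (x - s • e) i) (s • e)]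
    simp
  have h6 : ∫ x, u x * (s⁻¹ * (v x i - v (x - s • e) i))
      = s⁻¹ * ∫ x, -((u (x + s • e) - u x) * v x i) := by
    have : ∀ x, u x * (s⁻¹ * (v x i - v (x - s • e) i))
        = s⁻¹ * (u x * v x i - u x * v (x - s • e) i) := fun x => by ring
    simp_rw [this]
    rw [integral_const_mul, integral_sub hi1 hi2, h5, ← integral_sub hi1 hi3]
    congr 2
    ext x
    ring
  rw [h6, inv_mul_le_iff₀ hs.1]
  refine (integral_mono ?_ ((hu.comp_add_right (s • e)).sub hu).abs fun x => ?_).trans (h i s hs)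
  · have := hi3.sub hi1
    refine this.neg.congr (ae_of_all _ fun x => ?_)
    simp; ring
  · refine (le_abs_self _).trans ?_
    rw [abs_neg, abs_mul]
    exact mul_le_of_le_one_right (abs_nonneg _) (hcomp i x)

/-! ### Half-open dyadic cells -/

/-- The index of the half-open dyadic cell of generation `n` that contains `x`. -/
noncomputable def dyadicIndex {d : ℕ} (n : ℕ) (x : E d) : Fin d → ℤ := fun i => ⌊(2 : ℝ) ^ n * x i⌋

/-- The half-open dyadic cell of generation `n` and index `k`. -/
def dyadicCell {d : ℕ} (n : ℕ) (k : Fin d → ℤ) : Set (E d) := dyadicIndex n ⁻¹' {k}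

/-- The indices of the cells of generation `n` inside the unit cube. -/
noncomputable def indexBox (d n : ℕ) : Finset (Fin d → ℤ) := Fintype.piFinset fun _ => Finset.Ico 0 (2 ^ n)

/-- The volume of the cells of generation `n`. -/
noncomputable def cellVol (d n : ℕ) : ℝ := ((2 : ℝ) ^ n)⁻¹ ^ d

theorem cellVol_pos (d n : ℕ) : 0 < cellVol d n := by
  unfold cellVol; positivity

theorem mem_indexBox {d n : ℕ} {k : Fin d → ℤ} :
    k ∈ indexBox d n ↔ ∀ i, 0 ≤ k i ∧ k i < 2 ^ n := by
  simp [indexBox]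

theorem mem_dyadicCell {d n : ℕ} {k : Fin d → ℤ} {x : E d} :
    x ∈ dyadicCell n k ↔ dyadicIndex n x = k := Iff.rfl

theorem dyadicIndex_apply {d : ℕ} (n : ℕ) (x : E d) (i : Fin d) :
    dyadicIndex n x i = ⌊(2 : ℝ) ^ n * x i⌋ := rfl

theorem dyadicIndex_eq_iff {d n : ℕ} {k : Fin d → ℤ} {x : E d} : dyadicIndex n x = k ↔
    ∀ i, x i ∈ Ico ((k i : ℝ) / 2 ^ n) (((k i : ℝ) + 1) / 2 ^ n) := by
  have h2 : (0 : ℝ) < 2 ^ n := by positivity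
  rw [funext_iff]
  refine forall_congr' fun i => ?_
  rw [dyadicIndex_apply, Int.floor_eq_iff, mem_Ico, div_le_iff₀ h2, lt_div_iff₀ h2,
    mul_comm (x i)]

theorem measurable_dyadicIndex {d : ℕ} (n : ℕ) : Measurable (dyadicIndex n : E d → Fin d → ℤ) := by
  refine measurable_pi_lambda _ fun i => Int.measurable_floor.comp ?_
  have : Continuous fun x : E d => (2 : ℝ) ^ n * x i := by fun_prop
  exact this.measurable

theorem measurableSet_preimage_dyadicIndex {d : ℕ} (n : ℕ) (S : Set (Fin d → ℤ)) :
    MeasurableSet (dyadicIndex n ⁻¹' S : Set (E d)) :=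
  measurable_dyadicIndex n (Set.to_countable S).measurableSet

theorem measurableSet_dyadicCell {d : ℕ} (n : ℕ) (k : Fin d → ℤ) :
    MeasurableSet (dyadicCell n k : Set (E d)) := measurableSet_preimage_dyadicIndex n _

theorem volume_box {d : ℕ} {s : Fin d → Set ℝ} (hs : ∀ i, MeasurableSet (s i)) :
    volume {x : E d | ∀ i, x i ∈ s i} = ∏ i, volume (s i) := by
  have h := (PiLp.volume_preserving_ofLp (Fin d)).measure_preimage
    (s := univ.pi s) (MeasurableSet.univ_pi hs).nullMeasurableSet
  rw [volume_pi, Measure.pi_pi] at h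
  rw [← h]
  congr 1
  ext x
  simp

theorem isClosed_cube (d : ℕ) : IsClosed (cube d) := by
  simp only [cube, Set.ofPred_forall]
  refine isClosed_iInter fun i => ?_
  have hc : Continuous fun x : E d => x i := by fun_prop
  exact (isClosed_le continuous_const hc).inter (isClosed_le hc continuous_const)

theorem measurableSet_cube (d : ℕ) : MeasurableSet (cube d) := (isClosed_cube d).measurableSet

theorem isBounded_cube (d : ℕ) : Bornology.IsBounded (cube d) := by
  refine (Metric.isBounded_closedBall (x := (0 : E d)) (r := √d)).subset fun x hx => ?_
  rw [mem_closedBall_zero_iff, EuclideanSpace.norm_eq]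
  refine Real.sqrt_le_sqrt ?_
  have : ∀ i ∈ Finset.univ, ‖x i‖ ^ 2 ≤ 1 := fun i _ => by
    have := hx i
    rw [Real.norm_eq_abs, sq_abs]
    nlinarith
  simpa using Finset.sum_le_sum this

theorem volume_cube (d : ℕ) : volume (cube d) = 1 := by
  have : cube d = {x : E d | ∀ i, x i ∈ Icc (0 : ℝ) 1} := rfl
  rw [this, volume_box fun _ => measurableSet_Icc]
  simp

theorem prod_ofReal_inv_two_pow (d n : ℕ) :
    ∏ _i : Fin d, ENNReal.ofReal (((2 : ℝ) ^ n)⁻¹) = ENNReal.ofReal (cellVol d n) := by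
  rw [Finset.prod_const, Finset.card_univ, Fintype.card_fin, cellVol,
    ENNReal.ofReal_pow (by positivity)]

theorem volume_dyadicCell {d : ℕ} (n : ℕ) (k : Fin d → ℤ) :
    volume (dyadicCell n k : Set (E d)) = ENNReal.ofReal (cellVol d n) := by
  have : (dyadicCell n k : Set (E d))
      = {x | ∀ i, x i ∈ Ico ((k i : ℝ) / 2 ^ n) (((k i : ℝ) + 1) / 2 ^ n)} := by
    ext x
    exact dyadicIndex_eq_iff
  rw [this, volume_box fun _ => measurableSet_Ico, ← prod_ofReal_inv_two_pow]
  refine Finset.prod_congr rfl fun i _ => ?_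
  rw [Real.volume_Ico]
  congr 1
  field_simp
  ring_nf

theorem volume_real_dyadicCell {d : ℕ} (n : ℕ) (k : Fin d → ℤ) :
    volume.real (dyadicCell n k : Set (E d)) = cellVol d n := by
  rw [Measure.real, volume_dyadicCell, ENNReal.toReal_ofReal (cellVol_pos d n).le]

theorem volume_dyadicCell_ne_top {d : ℕ} (n : ℕ) (k : Fin d → ℤ) :
    volume (dyadicCell n k : Set (E d)) ≠ ∞ := by
  simp [volume_dyadicCell]

theorem disjoint_dyadicCell {d : ℕ} (n : ℕ) {k l : Fin d → ℤ} (h : k ≠ l) :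
    Disjoint (dyadicCell n k : Set (E d)) (dyadicCell n l) :=
  Disjoint.preimage _ (by simpa using h)

theorem preimage_dyadicIndex_eq_iUnion {d : ℕ} (n : ℕ) (S : Finset (Fin d → ℤ)) :
    (dyadicIndex n ⁻¹' (S : Set (Fin d → ℤ)) : Set (E d)) = ⋃ k ∈ S, dyadicCell n k := by
  ext x
  simp [mem_dyadicCell]

theorem volume_preimage_dyadicIndex {d : ℕ} (n : ℕ) (S : Finset (Fin d → ℤ)) :
    volume (dyadicIndex n ⁻¹' (S : Set (Fin d → ℤ)) : Set (E d))
      = S.card * ENNReal.ofReal (cellVol d n) := by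
  rw [preimage_dyadicIndex_eq_iUnion, measure_biUnion_finset
    (fun k _ l _ h => disjoint_dyadicCell n h) fun k _ => measurableSet_dyadicCell n k]
  simp [volume_dyadicCell]

theorem volume_preimage_dyadicIndex_ne_top {d : ℕ} (n : ℕ) (S : Finset (Fin d → ℤ)) :
    volume (dyadicIndex n ⁻¹' (S : Set (Fin d → ℤ)) : Set (E d)) ≠ ∞ := by
  rw [volume_preimage_dyadicIndex]
  exact ENNReal.mul_ne_top (by simp) (by simp)

theorem card_indexBox (d n : ℕ) : (indexBox d n).card = (2 ^ n) ^ d := by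
  simp only [indexBox, Fintype.card_piFinset, Int.card_Ico, Finset.prod_const, Finset.card_univ,
    Fintype.card_fin]
  congr 1

theorem preimage_indexBox_subset_cube (d n : ℕ) :
    (dyadicIndex n ⁻¹' (indexBox d n : Set (Fin d → ℤ)) : Set (E d)) ⊆ cube d := by
  intro x hx i
  have h := mem_indexBox.1 (Finset.mem_coe.1 hx) i
  have h2 : (0 : ℝ) < 2 ^ n := by positivity
  rw [dyadicIndex_apply, Int.floor_nonneg, Int.floor_lt] at h
  refine ⟨nonneg_of_mul_nonneg_right h.1 h2, ?_⟩
  have h3 := h.2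
  push_cast at h3
  nlinarith

/-- The half-open cells in the cube already have total volume 1; they miss only upper faces of the
cube. -/
theorem volume_cube_diff (d n : ℕ) :
    volume (cube d \ dyadicIndex n ⁻¹' (indexBox d n : Set (Fin d → ℤ))) = 0 := by
  rw [measure_sdiff (preimage_indexBox_subset_cube d n)
    (measurableSet_preimage_dyadicIndex n _).nullMeasurableSet
    (volume_preimage_dyadicIndex_ne_top n _), volume_cube, volume_preimage_dyadicIndex,
    card_indexBox, cellVol]
  rw [tsub_eq_zero_iff_le, ENNReal.ofReal_pow (by positivity),
    ENNReal.ofReal_inv_of_pos (by positivity)]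
  push_cast
  rw [ENNReal.ofReal_pow (by norm_num), ← mul_pow]
  simp [ENNReal.mul_inv_cancel]

theorem volume_dyadicCell_inter_cube {d n : ℕ} {k : Fin d → ℤ} (hk : k ∉ indexBox d n) :
    volume (dyadicCell n k ∩ cube d) = 0 := by
  refine measure_mono_null (t := cube d \ dyadicIndex n ⁻¹' (indexBox d n : Set (Fin d → ℤ)))
    (fun x hx => ⟨hx.2, fun h => hk ?_⟩) (volume_cube_diff d n)
  rwa [mem_preimage, mem_dyadicCell.1 hx.1] at h

/-! ### Perimeter of dyadic figures -/

/-- A displacement along an axis shorter than the side of a cell crosses at most one face, and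
crosses it only from within distance s. -/
theorem dyadicIndex_add_single {d n : ℕ} (x : E d) (i : Fin d) {s : ℝ}
    (hs : s ∈ Ioo 0 (((2 : ℝ) ^ n)⁻¹)) :
    dyadicIndex n (x + s • EuclideanSpace.single i (1 : ℝ)) = dyadicIndex n x ∨
      (dyadicIndex n (x + s • EuclideanSpace.single i (1 : ℝ))
        = dyadicIndex n x + Pi.single i 1 ∧
        x i ∈ Ico (((dyadicIndex n x i : ℝ) + 1) / 2 ^ n - s)
          (((dyadicIndex n x i : ℝ) + 1) / 2 ^ n)) := by
  have h2 : (0 : ℝ) < 2 ^ n := by positivity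
  have hs1 : 2 ^ n * s < 1 := by
    have := mul_lt_mul_of_pos_left hs.2 h2
    rwa [mul_inv_cancel₀ h2.ne'] at this
  have hs0 : 0 < 2 ^ n * s := mul_pos h2 hs.1
  have hoff : ∀ j, j ≠ i →
      dyadicIndex n (x + s • EuclideanSpace.single i (1 : ℝ)) j = dyadicIndex n x j := by
    intro j hj
    simp [dyadicIndex_apply, hj]
  have hon : dyadicIndex n (x + s • EuclideanSpace.single i (1 : ℝ)) i
      = ⌊2 ^ n * x i + 2 ^ n * s⌋ := by
    simp [dyadicIndex_apply, mul_add]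
  have hfl := Int.floor_le ((2 : ℝ) ^ n * x i)
  have hfu := Int.lt_floor_add_one ((2 : ℝ) ^ n * x i)
  rcases lt_or_ge (2 ^ n * x i + 2 ^ n * s) (⌊(2 : ℝ) ^ n * x i⌋ + 1) with h | h
  · left
    ext j
    by_cases hj : j = i
    · subst hj
      rw [hon, dyadicIndex_apply, Int.floor_eq_iff]
      exact ⟨by linarith, h⟩
    · exact hoff j hj
  · right
    constructor
    · ext j
      by_cases hj : j = i
      · subst hj
        rw [hon, Pi.add_apply, Pi.single_eq_same, dyadicIndex_apply, Int.floor_eq_iff]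
        push_cast
        exact ⟨h, by linarith⟩
      · rw [hoff j hj, Pi.add_apply, Pi.single_eq_of_ne hj, add_zero]
    · rw [dyadicIndex_apply, mem_Ico, sub_le_iff_le_add, div_le_iff₀ h2, lt_div_iff₀ h2]
      constructor <;> linarith

/-- The part of a cell that is within distance `s` of its upper face in the direction `i`. -/
def upperSlab {d : ℕ} (n : ℕ) (i : Fin d) (s : ℝ) (k : Fin d → ℤ) : Set (E d) :=
  {x | ∀ j, x j ∈ (if j = i then Ico (((k i : ℝ) + 1) / 2 ^ n - s) (((k i : ℝ) + 1) / 2 ^ n)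
    else Ico ((k j : ℝ) / 2 ^ n) (((k j : ℝ) + 1) / 2 ^ n))}

theorem volume_upperSlab {d : ℕ} (n : ℕ) (i : Fin d) {s : ℝ} (hs : 0 < s) (k : Fin d → ℤ) :
    volume (upperSlab n i s k) = ENNReal.ofReal (s * (2 ^ n * cellVol d n)) := by
  rw [upperSlab, volume_box fun j => by split_ifs <;> exact measurableSet_Ico]
  have h : ∀ j, volume (if j = i then Ico (((k i : ℝ) + 1) / 2 ^ n - s) (((k i : ℝ) + 1) / 2 ^ n)
      else Ico ((k j : ℝ) / 2 ^ n) (((k j : ℝ) + 1) / 2 ^ n))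
      = ENNReal.ofReal (if j = i then s else ((2 : ℝ) ^ n)⁻¹) := by
    intro j
    split_ifs
    · rw [Real.volume_Ico]; congr 1; ring
    · rw [Real.volume_Ico]; congr 1; field_simp; ring
  simp_rw [h]
  rw [← ENNReal.ofReal_prod_of_nonneg fun j _ => by split_ifs <;> positivity]
  congr 1
  rw [← Finset.mul_prod_erase _ _ (Finset.mem_univ i), if_pos rfl]
  congr 1
  rw [Finset.prod_congr rfl fun j hj => if_neg (Finset.ne_of_mem_erase hj), Finset.prod_const,
    Finset.card_erase_of_mem (Finset.mem_univ i), Finset.card_univ, Fintype.card_fin, cellVol]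
  have hd : d - 1 + 1 = d := Nat.sub_add_cancel (Nat.succ_le_of_lt (Fin.pos i))
  conv_rhs => rw [← hd, pow_succ]
  field_simp

theorem measurableSet_upperSlab {d : ℕ} (n : ℕ) (i : Fin d) (s : ℝ) (k : Fin d → ℤ) :
    MeasurableSet (upperSlab n i s k) := by
  have : upperSlab n i s k = ⋂ j, (fun x : E d => x j) ⁻¹'
      (if j = i then Ico (((k i : ℝ) + 1) / 2 ^ n - s) (((k i : ℝ) + 1) / 2 ^ n)
        else Ico ((k j : ℝ) / 2 ^ n) (((k j : ℝ) + 1) / 2 ^ n)) := by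
    ext x; simp [upperSlab]
  rw [this]
  refine MeasurableSet.iInter fun j => ?_
  have hc : Continuous fun x : E d => x j := by fun_prop
  refine hc.measurable ?_
  split_ifs <;> exact measurableSet_Ico

/-- The number of faces orthogonal to the direction `i` in the boundary of a figure. -/
def faceCount {d : ℕ} (S : Finset (Fin d → ℤ)) (i : Fin d) : ℕ :=
  (S.filter fun k => k + Pi.single i 1 ∉ S).card + (S.filter fun k => k - Pi.single i 1 ∉ S).card

/-- Translation by s along axis i alters the indicator only on slabs of thickness s, one per
boundary face orthogonal to that axis. As 2^n |Q| is the area of a face, `variation_le_of_translate`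
bounds the perimeter by the total area of the boundary faces. -/
theorem variation_indicator_preimage_dyadicIndex_le {d : ℕ} (n : ℕ) (S : Finset (Fin d → ℤ)) :
    variation ((dyadicIndex n ⁻¹' (S : Set (Fin d → ℤ)) : Set (E d)).indicator fun _ => (1 : ℝ))
      ≤ ENNReal.ofReal (∑ i, 2 ^ n * cellVol d n * faceCount S i) := by
  set F : Set (E d) := dyadicIndex n ⁻¹' (S : Set (Fin d → ℤ)) with hF
  have hFm : MeasurableSet F := measurableSet_preimage_dyadicIndex n _
  have hFi : Integrable (F.indicator fun _ => (1 : ℝ)) volume :=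
    (integrable_indicator_iff hFm).2
      (integrableOn_const (volume_preimage_dyadicIndex_ne_top n S))
  refine variation_le_of_translate hFi _ (s₀ := ((2 : ℝ) ^ n)⁻¹) (by positivity) fun i s hs => ?_
  have hslab : ∀ k, Integrable ((upperSlab n i s k).indicator fun _ => (1 : ℝ)) volume := fun k =>
    (integrable_indicator_iff (measurableSet_upperSlab n i s k)).2
      (integrableOn_const (by rw [volume_upperSlab n i hs.1]; exact ENNReal.ofReal_ne_top))
  have hslab1 : ∀ k, ∫ x, (upperSlab n i s k).indicator (fun _ => (1 : ℝ)) x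
      = s * (2 ^ n * cellVol d n) := by
    intro k
    have := cellVol_pos d n
    have := hs.1
    rw [integral_indicator (measurableSet_upperSlab n i s k), setIntegral_const, smul_eq_mul,
      mul_one, Measure.real, volume_upperSlab n i hs.1, ENNReal.toReal_ofReal (by positivity)]
  set S₁ := S.filter fun k => k + Pi.single i 1 ∉ S
  set S₂ := S.filter fun k => k - Pi.single i 1 ∉ S
  have hmem : ∀ x : E d, x i ∈ Ico (((dyadicIndex n x i : ℝ) + 1) / 2 ^ n - s)
          (((dyadicIndex n x i : ℝ) + 1) / 2 ^ n) → x ∈ upperSlab n i s (dyadicIndex n x) := by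
    intro x hx j
    split_ifs with hj
    · subst hj; exact hx
    · exact dyadicIndex_eq_iff.1 rfl j
  have hnn : ∀ k (x : E d), 0 ≤ (upperSlab n i s k).indicator (fun _ => (1 : ℝ)) x := fun k x =>
    indicator_nonneg (fun _ _ => zero_le_one) x
  have hpt : ∀ x, |F.indicator (fun _ => (1 : ℝ)) (x + s • EuclideanSpace.single i (1 : ℝ))
      - F.indicator (fun _ => (1 : ℝ)) x| ≤
      ∑ k ∈ S₁, (upperSlab n i s k).indicator (fun _ => (1 : ℝ)) x
      + ∑ k ∈ S₂, (upperSlab n i s (k - Pi.single i 1)).indicator (fun _ => (1 : ℝ)) x := by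
    intro x
    have n1 := Finset.sum_nonneg (s := S₁) fun k _ => hnn k x
    have n2 := Finset.sum_nonneg (s := S₂) fun k _ => hnn (k - Pi.single i 1) x
    rcases dyadicIndex_add_single x i hs with h | ⟨h, hx⟩
    · have : F.indicator (fun _ => (1 : ℝ)) (x + s • EuclideanSpace.single i (1 : ℝ))
          = F.indicator (fun _ => (1 : ℝ)) x := by
        simp only [indicator, hF, mem_preimage, h]
      rw [this, sub_self, abs_zero]
      positivity
    · have hx1 := indicator_of_mem (hmem x hx) fun _ => (1 : ℝ)
      -- Here x lies in the lower of two adjacent cells. If only that cell is in S, the face is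
      -- counted by `S₁`. If only the upper one is, the face is counted by `S₂` under the index of
      -- the upper cell, hence the shift k - e_i in the slab.
      by_cases h1 : dyadicIndex n x ∈ S <;>
        by_cases h2 : dyadicIndex n x + Pi.single i 1 ∈ S
      · simp only [indicator, hF, mem_preimage, h, Finset.mem_coe, h1, h2, if_true, sub_self,
          abs_zero]
        exact add_nonneg n1 n2
      · have h3 : dyadicIndex n x ∈ S₁ := Finset.mem_filter.2 ⟨h1, h2⟩
        have h4 := Finset.single_le_sum (f := fun k =>
          (upperSlab n i s k).indicator (fun _ => (1 : ℝ)) x) (fun k _ => hnn k x) h3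
        simp only [hx1] at h4
        have h5 : |F.indicator (fun _ => (1 : ℝ)) (x + s • EuclideanSpace.single i (1 : ℝ))
            - F.indicator (fun _ => (1 : ℝ)) x| = 1 := by
          simp [indicator, hF, h, h1, h2]
        linarith
      · have h3 : dyadicIndex n x + Pi.single i 1 ∈ S₂ :=
          Finset.mem_filter.2 ⟨h2, by simpa using h1⟩
        have h4 := Finset.single_le_sum (f := fun k =>
          (upperSlab n i s (k - Pi.single i 1)).indicator (fun _ => (1 : ℝ)) x)
          (fun k _ => hnn _ x) h3
        simp only [add_sub_cancel_right, hx1] at h4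
        have h5 : |F.indicator (fun _ => (1 : ℝ)) (x + s • EuclideanSpace.single i (1 : ℝ))
            - F.indicator (fun _ => (1 : ℝ)) x| = 1 := by
          simp [indicator, hF, h, h1, h2]
        linarith
      · simp only [indicator, hF, mem_preimage, h, Finset.mem_coe, h1, h2, if_false, sub_self,
          abs_zero]
        exact add_nonneg n1 n2
  have hi1 := integrable_finsetSum S₁ fun k _ => hslab k
  have hi2 := integrable_finsetSum S₂ fun k _ => hslab (k - Pi.single i 1)
  refine (integral_mono ((hFi.comp_add_right _).sub hFi).abs (hi1.add hi2) hpt).trans ?_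
  simp only [Pi.add_apply]
  rw [integral_add hi1 hi2, integral_finsetSum _ fun k _ => hslab k,
    integral_finsetSum _ fun k _ => hslab _]
  simp only [hslab1, Finset.sum_const, nsmul_eq_mul, faceCount]
  push_cast
  apply le_of_eq
  ring

/-- The dyadic figure made of the cells of generation `n` whose indices are in `S` and in the
unit cube. -/
noncomputable def figure {d : ℕ} (n : ℕ) (S : Finset (Fin d → ℤ)) : BVSubset d :=
  ⟨dyadicIndex n ⁻¹' ((S ∩ indexBox d n : Finset (Fin d → ℤ)) : Set (Fin d → ℤ)), by
    have hsub : (dyadicIndex n ⁻¹' ((S ∩ indexBox d n : Finset (Fin d → ℤ)) : Set (Fin d → ℤ))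
        : Set (E d)) ⊆ cube d := fun x hx => preimage_indexBox_subset_cube d n
          (Finset.mem_coe.2 (Finset.mem_inter.1 (Finset.mem_coe.1 hx)).2)
    refine ⟨⟨?_, (measurableSet_preimage_dyadicIndex n _).nullMeasurableSet,
      (variation_indicator_preimage_dyadicIndex_le n _).trans_lt ENNReal.ofReal_lt_top⟩, hsub⟩
    exact (isBounded_cube d).subset hsub⟩

theorem coe_figure {d : ℕ} (n : ℕ) (S : Finset (Fin d → ℤ)) : (figure n S : Set (E d))
    = dyadicIndex n ⁻¹' ((S ∩ indexBox d n : Finset (Fin d → ℤ)) : Set (Fin d → ℤ)) := rfl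

theorem coe_figure_singleton {d n : ℕ} {k : Fin d → ℤ} (hk : k ∈ indexBox d n) :
    (figure n {k} : Set (E d)) = dyadicCell n k := by
  rw [coe_figure, Finset.singleton_inter_of_mem hk, Finset.coe_singleton]
  rfl

/-! ### Closed dyadic cubes -/

/-- The closed dyadic cell of generation `n` and index `k`. -/
def closedCell {d : ℕ} (n : ℕ) (k : Fin d → ℤ) : Set (E d) :=
  {x | ∀ i, x i ∈ Icc ((k i : ℝ) / 2 ^ n) (((k i : ℝ) + 1) / 2 ^ n)}

theorem isDyadicCube_iff {d : ℕ} {K : Set (E d)} :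
    IsDyadicCube K ↔ ∃ n, ∃ k ∈ indexBox d n, K = closedCell n k := by
  constructor
  · rintro ⟨n, k, hk, rfl⟩
    exact ⟨n, fun i => k i, mem_indexBox.2 fun i => ⟨by positivity, by exact_mod_cast hk i⟩, rfl⟩
  · rintro ⟨n, k, hk, rfl⟩
    have hk0 := mem_indexBox.1 hk
    lift k to Fin d → ℕ using fun i => (hk0 i).1
    exact ⟨n, k, fun i => by have := (hk0 i).2; dsimp only at this; exact_mod_cast this, rfl⟩

theorem dyadicCell_subset_closedCell {d : ℕ} (n : ℕ) (k : Fin d → ℤ) :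
    (dyadicCell n k : Set (E d)) ⊆ closedCell n k :=
  fun _ hx i => Ico_subset_Icc_self (dyadicIndex_eq_iff.1 hx i)

theorem volume_closedCell {d : ℕ} (n : ℕ) (k : Fin d → ℤ) :
    volume (closedCell n k : Set (E d)) = ENNReal.ofReal (cellVol d n) := by
  rw [closedCell, volume_box fun _ => measurableSet_Icc, ← prod_ofReal_inv_two_pow]
  refine Finset.prod_congr rfl fun i _ => ?_
  rw [Real.volume_Icc]
  congr 1
  field_simp
  ring_nf

theorem volume_real_closedCell {d : ℕ} (n : ℕ) (k : Fin d → ℤ) :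
    volume.real (closedCell n k : Set (E d)) = cellVol d n := by
  rw [Measure.real, volume_closedCell, ENNReal.toReal_ofReal (cellVol_pos d n).le]

/-- Links the closed cubes of the statement to the half-open cells of the proof, which form a
genuine partition; charges do not see the difference. -/
theorem closedCell_ae_eq {d : ℕ} (n : ℕ) (k : Fin d → ℤ) :
    (closedCell n k : Set (E d)) =ᵐ[volume] dyadicCell n k :=
  (ae_eq_of_subset_of_measure_ge (dyadicCell_subset_closedCell n k)
    (by rw [volume_closedCell, volume_dyadicCell])
    (measurableSet_dyadicCell n k).nullMeasurableSet
    (by simp [volume_closedCell])).symm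

theorem closedCell_subset_cube {d n : ℕ} {k : Fin d → ℤ} (hk : k ∈ indexBox d n) :
    closedCell n k ⊆ cube d := by
  intro x hx i
  obtain ⟨h0, h1⟩ := mem_indexBox.1 hk i
  have h3 : ((k i : ℝ) + 1) ≤ 2 ^ n := by exact_mod_cast h1
  have h4 : (0 : ℝ) ≤ k i := by exact_mod_cast h0
  refine ⟨le_trans (by positivity) (hx i).1, (hx i).2.trans ?_⟩
  rwa [div_le_one (by positivity)]

/-- Closed dyadic cells as `BV`-sets. -/
def closedCellBV {d n : ℕ} {k : Fin d → ℤ} (hk : k ∈ indexBox d n) : BVSubset d :=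
  ⟨closedCell n k, by
    refine ⟨⟨(isBounded_cube d).subset (closedCell_subset_cube hk),
      (measurableSet_dyadicCell n _).nullMeasurableSet.congr (closedCell_ae_eq n k).symm, ?_⟩,
      closedCell_subset_cube hk⟩
    have h1 := (figure n {k} : BVSubset d).2.1.perimeter_lt_top
    rw [coe_figure_singleton hk] at h1
    unfold perimeter at h1 ⊢
    rwa [variation_congr_ae (indicator_ae_eq_of_ae_eq_set (closedCell_ae_eq n k))]⟩

/-! ### Approximation of `BV`-sets by dyadic figures -/

/-- The integrand is dominated by |1_B(x + h) - 1_B(x)|. -/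
theorem lintegral_indicator_translate_le {d : ℕ} {B : Set (E d)} (hB : MeasurableSet B)
    (hfin : volume B ≠ ∞) (hper : perimeter B < ∞) (h : E d) :
    ∫⁻ x, B.indicator 1 x * Bᶜ.indicator (1 : E d → ℝ≥0∞) (x + h)
      ≤ ENNReal.ofReal ‖h‖ * perimeter B := by
  have hBi : Integrable (B.indicator fun _ => (1 : ℝ)) volume :=
    (integrable_indicator_iff hB).2 (integrableOn_const hfin)
  have h1 := integral_abs_translate_sub_le hBi hper h
  have h2 : ∫⁻ x, ENNReal.ofReal |B.indicator (fun _ => (1 : ℝ)) (x + h)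
      - B.indicator (fun _ => (1 : ℝ)) x| ≤ ENNReal.ofReal ‖h‖ * perimeter B := by
    have h3 : Integrable (fun x => |B.indicator (fun _ => (1 : ℝ)) (x + h)
        - B.indicator (fun _ => (1 : ℝ)) x|) volume := ((hBi.comp_add_right h).sub hBi).abs
    rw [← ofReal_integral_eq_lintegral_ofReal h3 (ae_of_all _ fun _ => abs_nonneg _)]
    refine (ENNReal.ofReal_le_ofReal h1).trans ?_
    rw [ENNReal.ofReal_mul (norm_nonneg _)]
    gcongr
    exact ENNReal.ofReal_toReal_le
  refine (lintegral_mono fun x => ?_).trans h2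
  by_cases hx : x ∈ B <;> by_cases hy : x + h ∈ B <;> simp [hx, hy]

/-- With y = x + h and Tonelli, the measure of the pairs at distance at most r separated by B is the
translation bound integrated over the ball of radius r. -/
theorem lintegral_lintegral_indicator_le {d : ℕ} {B : Set (E d)} (hB : MeasurableSet B)
    (hfin : volume B ≠ ∞) (hper : perimeter B < ∞) (r : ℝ) :
    ∫⁻ x, ∫⁻ y, B.indicator 1 x * Bᶜ.indicator (1 : E d → ℝ≥0∞) y *
        (Metric.closedBall (0 : E d) r).indicator 1 (y - x)
      ≤ volume (Metric.closedBall (0 : E d) r) * (ENNReal.ofReal r * perimeter B) := by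
  have hb : MeasurableSet (Metric.closedBall (0 : E d) r) := measurableSet_closedBall
  have m1 : Measurable (B.indicator (1 : E d → ℝ≥0∞)) := measurable_one.indicator hB
  have m2 : Measurable (Bᶜ.indicator (1 : E d → ℝ≥0∞)) := measurable_one.indicator hB.compl
  have m3 : Measurable ((Metric.closedBall (0 : E d) r).indicator (1 : E d → ℝ≥0∞)) :=
    measurable_one.indicator hb
  calc ∫⁻ x, ∫⁻ y, B.indicator 1 x * Bᶜ.indicator (1 : E d → ℝ≥0∞) y *
        (Metric.closedBall (0 : E d) r).indicator 1 (y - x)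
      = ∫⁻ x, ∫⁻ h, B.indicator 1 x * Bᶜ.indicator (1 : E d → ℝ≥0∞) (x + h) *
        (Metric.closedBall (0 : E d) r).indicator 1 h := by
        refine lintegral_congr fun x => ?_
        rw [← lintegral_add_left_eq_self _ x]
        simp
    _ = ∫⁻ h, ∫⁻ x, B.indicator 1 x * Bᶜ.indicator (1 : E d → ℝ≥0∞) (x + h) *
        (Metric.closedBall (0 : E d) r).indicator 1 h := by
        refine lintegral_lintegral_swap ?_
        exact (((m1.comp measurable_fst).mul (m2.comp (measurable_fst.add measurable_snd))).mul
          (m3.comp measurable_snd)).aemeasurable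
    _ ≤ ∫⁻ h, (Metric.closedBall (0 : E d) r).indicator
          (fun _ => ENNReal.ofReal r * perimeter B) h := by
        refine lintegral_mono fun h => ?_
        by_cases hh : h ∈ Metric.closedBall (0 : E d) r
        · simp only [indicator_of_mem hh, Pi.one_apply, mul_one]
          refine (lintegral_indicator_translate_le hB hfin hper h).trans ?_
          gcongr
          simpa using hh
        · simp [indicator_of_notMem hh]
    _ = volume (Metric.closedBall (0 : E d) r) * (ENNReal.ofReal r * perimeter B) := by
        rw [lintegral_indicator hb, setLIntegral_const, mul_comm]

/-- A constant comparing the measure of pairs of nearby points separated by a set to its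
perimeter. -/
noncomputable def pairConst (d : ℕ) : ℝ :=
  (2 * √d) ^ d * volume.real (Metric.ball (0 : E d) 1) * (2 * √d)

theorem norm_sub_le_of_index {d n : ℕ} {x y : E d}
    (h : ∀ i, |dyadicIndex n y i - dyadicIndex n x i| ≤ 1) :
    ‖y - x‖ ≤ 2 * √d * ((2 : ℝ) ^ n)⁻¹ := by
  have h2 : (0 : ℝ) < 2 ^ n := by positivity
  have hi : ∀ i ∈ Finset.univ, ‖(y - x) i‖ ^ 2 ≤ (2 * ((2 : ℝ) ^ n)⁻¹) ^ 2 := by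
    intro i _
    rw [Real.norm_eq_abs]
    refine pow_le_pow_left₀ (abs_nonneg _) ?_ 2
    have h3 : |2 ^ n * y i - 2 ^ n * x i| ≤ 2 := by
      have h4 := h i
      simp only [dyadicIndex_apply] at h4
      have h5 : |((⌊(2 : ℝ) ^ n * y i⌋ : ℝ) - ⌊(2 : ℝ) ^ n * x i⌋)| ≤ 1 := by exact_mod_cast h4
      have := Int.floor_le ((2 : ℝ) ^ n * y i)
      have := Int.lt_floor_add_one ((2 : ℝ) ^ n * y i)
      have := Int.floor_le ((2 : ℝ) ^ n * x i)
      have := Int.lt_floor_add_one ((2 : ℝ) ^ n * x i)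
      rw [abs_le] at h5 ⊢
      constructor <;> linarith
    rw [← mul_sub, abs_mul, abs_of_pos h2] at h3
    rw [PiLp.sub_apply, ← div_eq_mul_inv, le_div_iff₀ h2]
    linarith
  rw [EuclideanSpace.norm_eq]
  refine (Real.sqrt_le_sqrt (Finset.sum_le_sum hi)).trans (le_of_eq ?_)
  rw [Finset.sum_const, Finset.card_univ, Fintype.card_fin, nsmul_eq_mul,
    Real.sqrt_mul (by positivity), Real.sqrt_sq (by positivity)]
  ring

/-- The products are the measures of disjoint sets of pairs (x, y) with x in B and y outside B, and
points of equal or adjacent cells are at distance at most r. This one inequality serves twice: unit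
vectors e for the perimeter of the approximating figures, e = 0 for their volume error. -/
theorem sum_volume_inter_mul_volume_diff_le {d : ℕ} {B : Set (E d)}
    (hB : NullMeasurableSet B volume) (hfin : volume B ≠ ∞) (hper : perimeter B < ∞) (n : ℕ)
    (T : Finset (Fin d → ℤ)) (e : Fin d → ℤ) (he : ∀ i, |e i| ≤ 1) :
    ∑ k ∈ T, volume.real (B ∩ dyadicCell n k) * volume.real (dyadicCell n (k + e) \ B)
      ≤ pairConst d * cellVol d n * ((2 : ℝ) ^ n)⁻¹ * (perimeter B).toReal := by
  -- BV sets are only null measurable, so a measurable representative is taken before using Tonelli;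
  -- perimeter and volumes do not change.
  obtain ⟨A, hA, hAB⟩ : ∃ A, MeasurableSet A ∧ A =ᵐ[volume] B :=
    ⟨toMeasurable volume B, measurableSet_toMeasurable _ _, hB.toMeasurable_ae_eq⟩
  have hpA : perimeter A = perimeter B := variation_congr_ae (indicator_ae_eq_of_ae_eq_set hAB)
  have h1 : ∀ k, volume.real (B ∩ dyadicCell n k) = volume.real (A ∩ dyadicCell n k) := fun k =>
    measureReal_congr (hAB.symm.inter (ae_eq_refl _))
  have h2 : ∀ k, volume.real (dyadicCell n (k + e) \ B)
      = volume.real (dyadicCell n (k + e) \ A) := fun k =>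
    measureReal_congr ((ae_eq_refl _).diff hAB.symm)
  simp_rw [h1, h2]
  rw [← hpA]
  have hAfin : volume A ≠ ∞ := by rwa [measure_congr hAB]
  have hpA' : perimeter A < ∞ := by rwa [hpA]
  clear h1 h2 hAB
  set r : ℝ := 2 * √d * ((2 : ℝ) ^ n)⁻¹ with hr
  have hr0 : 0 ≤ r := by positivity
  have key : ∑ k ∈ T, volume (A ∩ dyadicCell n k) * volume (dyadicCell n (k + e) \ A)
      ≤ volume (Metric.closedBall (0 : E d) r) * (ENNReal.ofReal r * perimeter A) := by
    refine le_trans ?_ (lintegral_lintegral_indicator_le hA hAfin hpA' r)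
    have m1 : ∀ k, MeasurableSet (A ∩ dyadicCell n k) := fun k =>
      hA.inter (measurableSet_dyadicCell n k)
    have m2 : ∀ k, MeasurableSet (dyadicCell n (k + e) \ A) := fun k =>
      (measurableSet_dyadicCell n _).diff hA
    have h3 : ∀ k, volume (A ∩ dyadicCell n k) * volume (dyadicCell n (k + e) \ A)
        = ∫⁻ x, ∫⁻ y, (A ∩ dyadicCell n k).indicator 1 x *
          (dyadicCell n (k + e) \ A).indicator 1 y := by
      intro k
      rw [lintegral_lintegral_mul (measurable_one.indicator (m1 k)).aemeasurable
        (measurable_one.indicator (m2 k)).aemeasurable, lintegral_indicator_one (m1 k),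
        lintegral_indicator_one (m2 k)]
    simp_rw [h3]
    rw [← lintegral_finsetSum]
    swap
    · intro k _
      have m3 : Measurable fun p : E d × E d => (A ∩ dyadicCell n k).indicator (1 : E d → ℝ≥0∞) p.1 *
          (dyadicCell n (k + e) \ A).indicator (1 : E d → ℝ≥0∞) p.2 :=
        ((measurable_one.indicator (m1 k)).comp measurable_fst).mul
          ((measurable_one.indicator (m2 k)).comp measurable_snd)
      exact m3.lintegral_prod_right'
    refine lintegral_mono fun x => ?_
    rw [← lintegral_finsetSum]
    swap
    · intro k _
      exact (measurable_one.indicator (m2 k)).const_mul _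
    refine lintegral_mono fun y => ?_
    -- For a given pair (x, y), only k = the index of x can contribute to the sum.
    by_cases hx : x ∈ A ∧ dyadicIndex n y = dyadicIndex n x + e ∧ y ∉ A
    · obtain ⟨hxA, hxy, hyA⟩ := hx
      have hb : y - x ∈ Metric.closedBall (0 : E d) r := by
        rw [mem_closedBall_zero_iff]
        refine norm_sub_le_of_index fun i => ?_
        simpa [hxy] using he i
      rw [indicator_of_mem hxA, indicator_of_mem (mem_compl hyA), indicator_of_mem hb]
      have h4 : ∀ k ∈ T, (A ∩ dyadicCell n k).indicator (1 : E d → ℝ≥0∞) x *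
          (dyadicCell n (k + e) \ A).indicator (1 : E d → ℝ≥0∞) y
          ≤ if k = dyadicIndex n x then 1 else 0 := by
        intro k _
        split_ifs with hk
        · exact mul_le_one' (indicator_le_self' (fun _ _ => zero_le) x)
            (indicator_le_self' (fun _ _ => zero_le) y)
        · rw [indicator_of_notMem fun h => hk (mem_dyadicCell.1 h.2).symm, zero_mul]
      refine (Finset.sum_le_sum h4).trans ?_
      rw [Finset.sum_ite_eq']
      split_ifs <;> simp
    · rw [Finset.sum_eq_zero fun k _ => ?_]
      · exact zero_le
      · by_contra h0
        obtain ⟨h5, h6⟩ := mul_ne_zero_iff.1 h0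
        have h7 := mem_of_indicator_ne_zero h5
        have h8 := mem_of_indicator_ne_zero h6
        refine hx ⟨h7.1, ?_, h8.2⟩
        rw [mem_dyadicCell.1 h7.2, mem_dyadicCell.1 h8.1]
  have hvol : volume (Metric.closedBall (0 : E d) r)
      = ENNReal.ofReal (r ^ d * volume.real (Metric.ball (0 : E d) 1)) := by
    rw [Measure.addHaar_closedBall _ _ hr0, finrank_euclideanSpace_fin,
      ENNReal.ofReal_mul (by positivity), Measure.real,
      ENNReal.ofReal_toReal Metric.isBounded_ball.measure_lt_top.ne]
  have h9 : ∀ k, volume (A ∩ dyadicCell n k) * volume (dyadicCell n (k + e) \ A)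
      = ENNReal.ofReal (volume.real (A ∩ dyadicCell n k) *
        volume.real (dyadicCell n (k + e) \ A)) := by
    intro k
    rw [ENNReal.ofReal_mul measureReal_nonneg, Measure.real, Measure.real,
      ENNReal.ofReal_toReal (measure_ne_top_of_subset inter_subset_right
        (volume_dyadicCell_ne_top n k)),
      ENNReal.ofReal_toReal (measure_ne_top_of_subset sdiff_subset
        (volume_dyadicCell_ne_top n _))]
  have h10 : perimeter A = ENNReal.ofReal (perimeter A).toReal :=
    (ENNReal.ofReal_toReal hpA'.ne).symm
  simp_rw [h9] at key
  rw [← ENNReal.ofReal_sum_of_nonneg fun k _ => mul_nonneg measureReal_nonneg measureReal_nonneg,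
    hvol, h10, ← ENNReal.ofReal_mul hr0, ← ENNReal.ofReal_mul (by positivity),
    ENNReal.ofReal_le_ofReal_iff (by positivity)] at key
  refine key.trans (le_of_eq ?_)
  rw [hr, pairConst, cellVol, mul_pow]
  ring

/-- The indices of the cells that are mostly contained in `B`. -/
noncomputable def majorityIndices {d : ℕ} (B : Set (E d)) (n : ℕ) : Finset (Fin d → ℤ) := by
  classical
  exact (indexBox d n).filter fun k => cellVol d n / 2 < volume.real (B ∩ dyadicCell n k)

theorem mem_majorityIndices {d : ℕ} {B : Set (E d)} {n : ℕ} {k : Fin d → ℤ} :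
    k ∈ majorityIndices B n ↔
      k ∈ indexBox d n ∧ cellVol d n / 2 < volume.real (B ∩ dyadicCell n k) := by
  classical
  simp [majorityIndices]

theorem volume_real_inter_add_diff {d : ℕ} (B : BVSubset d) (n : ℕ) (k : Fin d → ℤ) :
    volume.real ((B : Set (E d)) ∩ dyadicCell n k) + volume.real (dyadicCell n k \ (B : Set (E d)))
      = cellVol d n := by
  rw [← volume_real_dyadicCell n k, inter_comm]
  exact measureReal_inter_add_sdiff₀ B.2.1.measurable (volume_dyadicCell_ne_top n k)

/-- Cells outside the unit cube are included, since B meets them in a null set. Hence boundary faces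
of a figure that lie on the boundary of the cube need no separate treatment. -/
theorem half_le_volume_diff {d : ℕ} (B : BVSubset d) {n : ℕ} {k : Fin d → ℤ}
    (hk : k ∉ majorityIndices (B : Set (E d)) n) :
    cellVol d n / 2 ≤ volume.real (dyadicCell n k \ (B : Set (E d))) := by
  have h := volume_real_inter_add_diff B n k
  have hpos := cellVol_pos d n
  by_cases hb : k ∈ indexBox d n
  · have : ¬ cellVol d n / 2 < volume.real ((B : Set (E d)) ∩ dyadicCell n k) := fun h' =>
      hk (mem_majorityIndices.2 ⟨hb, h'⟩)
    linarith
  · have h0 : volume ((B : Set (E d)) ∩ dyadicCell n k) = 0 :=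
      measure_mono_null (t := dyadicCell n k ∩ cube d) (fun x hx => ⟨hx.2, B.2.2 hx.1⟩)
        (volume_dyadicCell_inter_cube hb)
    rw [Measure.real, h0] at h
    simp at h
    linarith

theorem BVSubset.volume_ne_top {d : ℕ} (B : BVSubset d) : volume (B : Set (E d)) ≠ ∞ :=
  B.2.1.bounded.measure_lt_top.ne

/-- Each such k contributes a product of at least (|Q| / 2)² to
`sum_volume_inter_mul_volume_diff_le`. -/
theorem card_filter_majorityIndices_le {d : ℕ} (B : BVSubset d) (n : ℕ) (e : Fin d → ℤ)
    (he : ∀ i, |e i| ≤ 1) (S : Finset (Fin d → ℤ))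
    (hS : ∀ k ∈ S, k ∈ majorityIndices (B : Set (E d)) n ∧
      k + e ∉ majorityIndices (B : Set (E d)) n) :
    (S.card : ℝ) * (2 ^ n * cellVol d n) ≤
      4 * pairConst d * (perimeter (B : Set (E d))).toReal := by
  have hpos := cellVol_pos d n
  have h := sum_volume_inter_mul_volume_diff_le B.2.1.measurable B.volume_ne_top
    B.2.1.perimeter_lt_top n S e he
  have h1 : ∀ k ∈ S, cellVol d n / 2 * (cellVol d n / 2) ≤
      volume.real ((B : Set (E d)) ∩ dyadicCell n k) *
        volume.real (dyadicCell n (k + e) \ (B : Set (E d))) := fun k hk =>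
    mul_le_mul (mem_majorityIndices.1 (hS k hk).1).2.le (half_le_volume_diff B (hS k hk).2)
      (by positivity) measureReal_nonneg
  have h2 := (Finset.sum_le_sum h1).trans h
  rw [Finset.sum_const, nsmul_eq_mul] at h2
  have h3 : (0 : ℝ) < 2 ^ n := by positivity
  have h4 : (S.card : ℝ) * (2 ^ n * cellVol d n) * (cellVol d n / (4 * 2 ^ n))
      ≤ 4 * pairConst d * (perimeter (B : Set (E d))).toReal * (cellVol d n / (4 * 2 ^ n)) := by
    calc _ = S.card * (cellVol d n / 2 * (cellVol d n / 2)) := by field_simp; norm_num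
      _ ≤ _ := h2
      _ = _ := by field_simp
  exact le_of_mul_le_mul_right h4 (by positivity)

theorem perimeter_figure_majorityIndices_le {d : ℕ} (B : BVSubset d) (n : ℕ) :
    perimeter (figure n (majorityIndices (B : Set (E d)) n) : Set (E d)) ≤
      ENNReal.ofReal (d * (8 * pairConst d * (perimeter (B : Set (E d))).toReal)) := by
  have hsub : majorityIndices (B : Set (E d)) n ∩ indexBox d n
      = majorityIndices (B : Set (E d)) n :=
    Finset.inter_eq_left.2 fun k hk => (mem_majorityIndices.1 hk).1
  rw [coe_figure, hsub]
  refine (variation_indicator_preimage_dyadicIndex_le n _).trans (ENNReal.ofReal_le_ofReal ?_)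
  -- The 8 is 4 for each of the two orientations of a face.
  have hi : ∀ i ∈ Finset.univ, 2 ^ n * cellVol d n * faceCount (majorityIndices (B : Set (E d)) n) i
      ≤ 8 * pairConst d * (perimeter (B : Set (E d))).toReal := by
    intro i _
    have habs : ∀ j, |(Pi.single i 1 : Fin d → ℤ) j| ≤ 1 := by
      intro j
      by_cases hj : j = i
      · subst hj; simp
      · simp [hj]
    have h1 := card_filter_majorityIndices_le B n (Pi.single i 1) habs
      ((majorityIndices (B : Set (E d)) n).filter
        fun k => k + Pi.single i 1 ∉ majorityIndices (B : Set (E d)) n)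
      fun k hk => Finset.mem_filter.1 hk
    have h2 := card_filter_majorityIndices_le B n (-Pi.single i 1) (by simpa using habs)
      ((majorityIndices (B : Set (E d)) n).filter
        fun k => k - Pi.single i 1 ∉ majorityIndices (B : Set (E d)) n)
      fun k hk => by simpa [sub_eq_add_neg] using Finset.mem_filter.1 hk
    rw [faceCount]
    push_cast
    linarith
  refine (Finset.sum_le_sum hi).trans (le_of_eq ?_)
  simp

theorem volume_symmDiff_figure_majorityIndices_le {d : ℕ} (B : BVSubset d) (n : ℕ) :
    volume ((figure n (majorityIndices (B : Set (E d)) n) : Set (E d)) ∆ (B : Set (E d))) ≤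
      ENNReal.ofReal (2 * pairConst d * (perimeter (B : Set (E d))).toReal * ((2 : ℝ) ^ n)⁻¹) := by
  set S := majorityIndices (B : Set (E d)) n with hS
  have hpos := cellVol_pos d n
  have hsub : S ∩ indexBox d n = S :=
    Finset.inter_eq_left.2 fun k hk => (mem_majorityIndices.1 hk).1
  -- The part of a cell where B and the figure disagree. It is the minority part, so the other part
  -- fills at least half of the cell, and the volume of `D k` is at most 2 / |Q| times the product
  -- of both volumes.
  set D : (Fin d → ℤ) → Set (E d) := fun k =>
    if k ∈ S then dyadicCell n k \ (B : Set (E d)) else (B : Set (E d)) ∩ dyadicCell n k with hD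
  have hcov : (figure n S : Set (E d)) ∆ (B : Set (E d)) ⊆
      (⋃ k ∈ indexBox d n, D k) ∪
        (cube d \ dyadicIndex n ⁻¹' (indexBox d n : Set (Fin d → ℤ))) := by
    intro x hx
    rw [coe_figure, hsub] at hx
    by_cases hxb : dyadicIndex n x ∈ indexBox d n
    · left
      simp only [mem_iUnion]
      refine ⟨dyadicIndex n x, hxb, ?_⟩
      simp only [hD]
      rcases hx with ⟨h1, h2⟩ | ⟨h1, h2⟩
      · rw [if_pos (by exact h1)]
        exact ⟨rfl, h2⟩
      · rw [if_neg (by exact h2)]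
        exact ⟨h1, rfl⟩
    · right
      rcases hx with ⟨h1, h2⟩ | ⟨h1, h2⟩
      · exact absurd (mem_majorityIndices.1 (by exact h1)).1 hxb
      · exact ⟨B.2.2 h1, hxb⟩
  have hDtop : ∀ k, volume (D k) ≠ ∞ := fun k => by
    simp only [hD]
    split_ifs
    · exact measure_ne_top_of_subset sdiff_subset (volume_dyadicCell_ne_top n k)
    · exact measure_ne_top_of_subset inter_subset_right (volume_dyadicCell_ne_top n k)
  have hDle : ∀ k ∈ indexBox d n, volume.real (D k) ≤ 2 / cellVol d n *
      (volume.real ((B : Set (E d)) ∩ dyadicCell n k) *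
        volume.real (dyadicCell n (k + 0) \ (B : Set (E d)))) := by
    intro k _
    rw [add_zero, div_mul_eq_mul_div, le_div_iff₀ hpos]
    have n1 : 0 ≤ volume.real ((B : Set (E d)) ∩ dyadicCell n k) := measureReal_nonneg
    have n2 : 0 ≤ volume.real (dyadicCell n k \ (B : Set (E d))) := measureReal_nonneg
    simp only [hD]
    split_ifs with hk
    · have := (mem_majorityIndices.1 hk).2
      nlinarith
    · have := half_le_volume_diff B hk
      nlinarith
  calc volume ((figure n S : Set (E d)) ∆ (B : Set (E d)))
      ≤ volume (⋃ k ∈ indexBox d n, D k) + 0 := by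
        refine (measure_mono hcov).trans ((measure_union_le _ _).trans ?_)
        rw [volume_cube_diff]
    _ ≤ ∑ k ∈ indexBox d n, volume (D k) := by
        rw [add_zero]
        exact measure_biUnion_finset_le _ _
    _ = ENNReal.ofReal (∑ k ∈ indexBox d n, volume.real (D k)) := by
        rw [ENNReal.ofReal_sum_of_nonneg fun _ _ => measureReal_nonneg]
        exact Finset.sum_congr rfl fun k _ => (ENNReal.ofReal_toReal (hDtop k)).symm
    _ ≤ _ := by
        refine ENNReal.ofReal_le_ofReal ((Finset.sum_le_sum hDle).trans ?_)
        rw [← Finset.mul_sum]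
        have h := sum_volume_inter_mul_volume_diff_le B.2.1.measurable B.volume_ne_top
          B.2.1.perimeter_lt_top n (indexBox d n) 0 (by simp)
        refine (mul_le_mul_of_nonneg_left h (by positivity)).trans (le_of_eq ?_)
        field_simp

theorem bvConverges_figure_majorityIndices {d : ℕ} (B : BVSubset d) :
    BVConverges (fun n => figure n (majorityIndices (B : Set (E d)) n)) B := by
  refine ⟨?_, (iSup_le fun n => perimeter_figure_majorityIndices_le B n).trans_lt
    ENNReal.ofReal_lt_top⟩
  refine tendsto_of_tendsto_of_tendsto_of_le_of_le tendsto_const_nhds ?_ (fun _ => zero_le)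
    (volume_symmDiff_figure_majorityIndices_le B)
  rw [← ENNReal.ofReal_zero]
  refine ENNReal.tendsto_ofReal ?_
  have h : Tendsto (fun n : ℕ => ((2 : ℝ) ^ n)⁻¹) atTop (𝓝 0) :=
    tendsto_inv_atTop_zero.comp (tendsto_pow_atTop_atTop_of_one_lt one_lt_two)
  simpa using h.const_mul (2 * pairConst d * (perimeter (B : Set (E d))).toReal)

/-! ### Charges are determined by their values on dyadic cubes -/

/-- The constant sequence A BV-converges to B. -/
theorem IsCharge.congr_ae {d : ℕ} {ω : BVSubset d → ℝ} (hω : IsCharge ω) {A B : BVSubset d}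
    (h : (A : Set (E d)) =ᵐ[volume] (B : Set (E d))) : ω A = ω B := by
  have h1 := hω.continuous (fun _ => A) B ⟨by
    simp only [measure_symmDiff_eq_zero_iff.2 h]; exact tendsto_const_nhds, by
    rw [ciSup_const]; exact A.2.1.perimeter_lt_top⟩
  exact tendsto_nhds_unique tendsto_const_nhds h1

theorem IsCharge.closedCellBV_eq {d : ℕ} {ω : BVSubset d → ℝ} (hω : IsCharge ω) {n : ℕ}
    {k : Fin d → ℤ} (hk : k ∈ indexBox d n) : ω (closedCellBV hk) = ω (figure n {k}) := by
  refine hω.congr_ae ?_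
  rw [coe_figure_singleton hk]
  exact closedCell_ae_eq n k

theorem IsCharge.figure_insert {d : ℕ} {ω : BVSubset d → ℝ} (hω : IsCharge ω) (n : ℕ)
    {k : Fin d → ℤ} {S : Finset (Fin d → ℤ)} (hk : k ∉ S) :
    ω (figure n (insert k S)) = ω (figure n {k}) + ω (figure n S) := by
  refine hω.additive _ _ _ ?_ ?_
  · have : (figure n {k} : Set (E d)) ∩ figure n S = ∅ := by
      ext x
      simp only [coe_figure, mem_inter_iff, mem_preimage, Finset.mem_coe, Finset.mem_inter,
        Finset.mem_singleton, mem_empty_iff_false, iff_false]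
      rintro ⟨⟨h1, -⟩, h2, -⟩
      exact hk (h1 ▸ h2)
    rw [this, measure_empty]
  · ext x
    simp only [coe_figure, mem_union, mem_preimage, Finset.mem_coe, Finset.mem_inter,
        Finset.mem_singleton, Finset.mem_insert]
    tauto

theorem IsCharge.figure_empty {d : ℕ} {ω : BVSubset d → ℝ} (hω : IsCharge ω) (n : ℕ) :
    ω (figure n ∅) = 0 := by
  have := hω.additive (figure n ∅) (figure n ∅) (figure n ∅) (by simp [coe_figure]) (by simp)
  linarith

theorem IsCharge.figure_eq_sum {d : ℕ} {ω : BVSubset d → ℝ} (hω : IsCharge ω) (n : ℕ)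
    (S : Finset (Fin d → ℤ)) : ω (figure n S) = ∑ k ∈ S, ω (figure n {k}) := by
  classical
  induction S using Finset.induction_on with
  | empty => simp [hω.figure_empty]
  | insert k S hk ih => rw [hω.figure_insert n hk, Finset.sum_insert hk, ih]

/-- By additivity the two charges agree on dyadic figures, and every BV subset of the cube is a
BV-limit of its majority figures. -/
theorem IsCharge.ext_cell {d : ℕ} {ω η : BVSubset d → ℝ} (hω : IsCharge ω) (hη : IsCharge η)
    (h : ∀ n, ∀ k ∈ indexBox d n, ω (figure n {k}) = η (figure n {k})) : ω = η := by
  ext B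
  refine tendsto_nhds_unique (hω.continuous _ B (bvConverges_figure_majorityIndices B)) ?_
  convert hη.continuous _ B (bvConverges_figure_majorityIndices B) using 2 with n
  rw [hω.figure_eq_sum, hη.figure_eq_sum]
  exact Finset.sum_congr rfl fun k hk => h n k (mem_majorityIndices.1 hk).1

/-! ### Charges with a density -/

theorem integral_cubeVolume {d : ℕ} (G : E d → ℝ) :
    ∫ x : cube d, G x ∂cubeVolume d = ∫ x in cube d, G x :=
  integral_subtype_comap (measurableSet_cube d) G

theorem quasiMeasurePreserving_val (d : ℕ) :
    Measure.QuasiMeasurePreserving (Subtype.val : cube d → E d) (cubeVolume d) volume := by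
  refine ⟨measurable_subtype_coe, ?_⟩
  rw [cubeVolume, map_comap_subtype_coe (measurableSet_cube d)]
  exact Measure.absolutelyContinuous_of_le Measure.restrict_le_self

theorem cubeVolume_preimage {d : ℕ} (A : Set (E d)) :
    cubeVolume d (Subtype.val ⁻¹' A) = volume (A ∩ cube d) := by
  rw [cubeVolume, comap_subtype_coe_apply (measurableSet_cube d), Subtype.image_preimage_coe,
    inter_comm]

instance (d : ℕ) : IsProbabilityMeasure (cubeVolume d) := by
  refine ⟨?_⟩
  rw [← preimage_univ (f := (Subtype.val : cube d → E d)), cubeVolume_preimage, univ_inter,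
    volume_cube]

theorem BVSubset.nullMeasurableSet_preimage {d : ℕ} (B : BVSubset d) :
    NullMeasurableSet (Subtype.val ⁻¹' (B : Set (E d)) : Set (cube d)) (cubeVolume d) :=
  B.2.1.measurable.preimage (quasiMeasurePreserving_val d)

/-- Continuity is the absolute continuity of the integral; the bound on perimeters plays no role
here. -/
theorem isCharge_density {d : ℕ} {g : cube d → ℝ} (hg : Integrable g (cubeVolume d)) :
    IsCharge (density g) := by
  constructor
  · intro B₁ B₂ B h0 hB
    unfold density
    rw [hB, preimage_union]
    refine setIntegral_union₀ ?_ B₂.nullMeasurableSet_preimage hg.integrableOn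
      hg.integrableOn
    rw [AEDisjoint, ← preimage_inter, cubeVolume_preimage]
    exact measure_mono_null inter_subset_left h0
  · intro B B₀ h
    have hd : ∀ A C : BVSubset d, density g A =
        (∫ x in (Subtype.val ⁻¹' (A : Set (E d)) ∩ Subtype.val ⁻¹' (C : Set (E d)) :
          Set (cube d)), g x ∂cubeVolume d) +
        ∫ x in (Subtype.val ⁻¹' ((A : Set (E d)) \ C) : Set (cube d)), g x ∂cubeVolume d :=
      fun A C => (integral_inter_add_sdiff₀ C.nullMeasurableSet_preimage hg.integrableOn).symm
    have ht : ∀ D : ℕ → Set (E d), (∀ n, D n ⊆ (B n : Set (E d)) ∆ (B₀ : Set (E d))) →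
        Tendsto (fun n => ∫ x in (Subtype.val ⁻¹' (D n) : Set (cube d)), g x ∂cubeVolume d)
          atTop (𝓝 0) := by
      intro D hD
      refine hg.tendsto_setIntegral_nhds_zero ?_
      refine tendsto_of_tendsto_of_tendsto_of_le_of_le tendsto_const_nhds h.1
        (fun _ => zero_le) fun n => ?_
      simp only [Function.comp, cubeVolume_preimage]
      exact measure_mono (inter_subset_left.trans (hD n))
    have h1 := ht (fun n => (B n : Set (E d)) \ B₀) fun n => subset_union_left
    have h2 := ht (fun n => (B₀ : Set (E d)) \ B n) fun n => subset_union_right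
    have h3 := (h1.sub h2).add_const (density g B₀)
    rw [sub_zero, zero_add] at h3
    refine h3.congr fun n => ?_
    rw [hd (B n) B₀, hd B₀ (B n), inter_comm]
    ring

/-! ### Functionals on `BV([0, 1]^d)` -/

theorem BVFun.isBVFun {d : ℕ} (u : BVFun d) : IsBVFun u.toFun := u.2

theorem BVFun.norm_def {d : ℕ} (u : BVFun d) : ‖u‖ = (variation u.toFun).toReal := rfl

theorem BVFun.toFun_add {d : ℕ} (u w : BVFun d) : (u + w).toFun = u.toFun + w.toFun := rfl

theorem BVFun.toFun_smul {d : ℕ} (c : ℝ) (u : BVFun d) : (c • u).toFun = c • u.toFun := rfl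

theorem BVFun.toFun_sub {d : ℕ} (u w : BVFun d) : (u - w).toFun = u.toFun - w.toFun := rfl

theorem toFun_bvIndicator {d : ℕ} (B : BVSubset d) :
    (bvIndicator B).toFun = (B : Set (E d)).indicator fun _ => (1 : ℝ) := rfl

/-- The Poincaré inequality for functions of bounded variation that vanish outside the cube. -/
theorem BVFun.integral_abs_le {d : ℕ} [NeZero d] (u : BVFun d) : ∫ x, |u.toFun x| ≤ ‖u‖ := by
  have hu := u.isBVFun
  -- A shift by 2 moves the cube off itself, so u and its translate have disjoint supports and the
  -- L¹ norm of their difference is twice that of u. The factor |h| = 2 on the right cancels this 2.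
  set h : E d := EuclideanSpace.single (0 : Fin d) (2 : ℝ) with hh
  have h1 := integral_abs_translate_sub_le hu.integrable hu.variation_lt_top h
  have hi := hu.integrable.comp_add_right h
  have h2 : ∀ᵐ x, x + h ∉ cube d → u.toFun (x + h) = 0 :=
    (measurePreserving_add_right volume h).quasiMeasurePreserving.ae hu.eq_zero
  have h3 : ∫ x, |u.toFun (x + h) - u.toFun x| = 2 * ∫ x, |u.toFun x| := by
    have h4 : ∫ x, |u.toFun (x + h) - u.toFun x| = ∫ x, (|u.toFun (x + h)| + |u.toFun x|) := by
      refine integral_congr_ae ?_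
      filter_upwards [hu.eq_zero, h2] with x hx hxh
      by_cases hc : x ∈ cube d
      · have : x + h ∉ cube d := by
          intro h5
          have h6 := (h5 0).2
          have h7 := (hc 0).1
          simp only [hh, PiLp.add_apply, PiLp.single_apply, if_true] at h6
          linarith
        simp [hxh this]
      · simp [hx hc]
    rw [h4, integral_add hi.abs hu.integrable.abs,
      integral_add_right_eq_self (fun x => |u.toFun x|) h]
    ring
  rw [h3] at h1
  have h8 : ‖h‖ = 2 := by simp [hh]
  rw [h8, ← BVFun.norm_def] at h1
  linarith

/-- The functional `u ↦ ∫_Q u` for a dyadic cell `Q`. -/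
noncomputable def cellIntegral {d : ℕ} [NeZero d] (n : ℕ) (k : Fin d → ℤ) :
    StrongDual ℝ (BVFun d) :=
  LinearMap.mkContinuous
    { toFun := fun u => ∫ x in dyadicCell n k, u.toFun x
      map_add' := fun u w => by
        rw [BVFun.toFun_add]
        exact integral_add u.isBVFun.integrable.integrableOn w.isBVFun.integrable.integrableOn
      map_smul' := fun c u => by
        rw [BVFun.toFun_smul]
        exact integral_const_mul c _ } 1 fun u => by
    rw [one_mul]
    refine (norm_integral_le_integral_norm _).trans (le_trans ?_ u.integral_abs_le)
    exact setIntegral_le_integral u.isBVFun.integrable.abs (ae_of_all _ fun _ => abs_nonneg _)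

theorem cellIntegral_apply {d : ℕ} [NeZero d] (n : ℕ) (k : Fin d → ℤ) (u : BVFun d) :
    cellIntegral n k u = ∫ x in dyadicCell n k, u.toFun x := rfl

theorem cellIntegral_bvIndicator {d : ℕ} [NeZero d] (n : ℕ) (k : Fin d → ℤ) (B : BVSubset d) :
    cellIntegral n k (bvIndicator B) = volume.real ((B : Set (E d)) ∩ dyadicCell n k) := by
  rw [cellIntegral_apply, toFun_bvIndicator, integral_indicator₀
    (B.2.1.measurable.mono_ac (Measure.absolutelyContinuous_of_le Measure.restrict_le_self)),
    Measure.restrict_restrict₀ (B.2.1.measurable.mono_ac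
      (Measure.absolutelyContinuous_of_le Measure.restrict_le_self))]
  simp [Measure.real]

theorem sum_setIntegral_dyadicCell_le {d : ℕ} {F : E d → ℝ} (hF : Integrable F volume)
    (h0 : ∀ x, 0 ≤ F x) (n : ℕ) (S : Finset (Fin d → ℤ)) :
    ∑ k ∈ S, ∫ x in dyadicCell n k, F x ≤ ∫ x, F x := by
  rw [← integral_biUnion_finset _ (fun k _ => measurableSet_dyadicCell n k)
    (fun k _ l _ h => disjoint_dyadicCell n h) fun k _ => hF.integrableOn]
  exact setIntegral_le_integral hF (ae_of_all _ h0)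

/-- The functional `u ↦ ∫ c u` for a step function `c`. -/
noncomputable def stepFunctional {d : ℕ} [NeZero d] (n : ℕ) (c : (Fin d → ℤ) → ℝ) :
    StrongDual ℝ (BVFun d) :=
  ∑ k ∈ indexBox d n, c k • cellIntegral n k

theorem stepFunctional_apply {d : ℕ} [NeZero d] (n : ℕ) (c : (Fin d → ℤ) → ℝ) (u : BVFun d) :
    stepFunctional n c u = ∑ k ∈ indexBox d n, c k * cellIntegral n k u := by
  simp [stepFunctional]

theorem stepFunctional_add {d : ℕ} [NeZero d] (n : ℕ) (b c : (Fin d → ℤ) → ℝ) :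
    stepFunctional n (b + c) = stepFunctional n b + stepFunctional n c := by
  simp [stepFunctional, add_smul, Finset.sum_add_distrib]

theorem stepFunctional_sub {d : ℕ} [NeZero d] (n : ℕ) (b c : (Fin d → ℤ) → ℝ) :
    stepFunctional n (b - c) = stepFunctional n b - stepFunctional n c := by
  ext u
  simp only [stepFunctional_apply, sub_apply, Pi.sub_apply, sub_mul, Finset.sum_sub_distrib]

theorem stepFunctional_smul {d : ℕ} [NeZero d] (n : ℕ) (r : ℝ) (c : (Fin d → ℤ) → ℝ) :
    stepFunctional n (r • c) = r • stepFunctional n c := by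
  simp [stepFunctional, mul_smul, Finset.smul_sum]

theorem stepFunctional_congr {d : ℕ} [NeZero d] {n : ℕ} {b c : (Fin d → ℤ) → ℝ}
    (h : ∀ k ∈ indexBox d n, b k = c k) : stepFunctional n b = stepFunctional n c :=
  Finset.sum_congr rfl fun k hk => by rw [h k hk]

theorem abs_stepFunctional_le {d : ℕ} [NeZero d] {n : ℕ} {c : (Fin d → ℤ) → ℝ} {M : ℝ}
    (hM : 0 ≤ M) (hc : ∀ k ∈ indexBox d n, |c k| ≤ M) (u : BVFun d) :
    |stepFunctional n c u| ≤ M * ∫ x, |u.toFun x| := by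
  rw [stepFunctional_apply]
  have h1 : ∀ k ∈ indexBox d n, |c k * cellIntegral n k u|
      ≤ M * ∫ x in dyadicCell n k, |u.toFun x| := by
    intro k hk
    rw [abs_mul]
    exact mul_le_mul (hc k hk) (norm_integral_le_integral_norm u.toFun) (abs_nonneg _) hM
  refine (Finset.abs_sum_le_sum_abs _ _).trans ((Finset.sum_le_sum h1).trans ?_)
  rw [← Finset.mul_sum]
  exact mul_le_mul_of_nonneg_left
    (sum_setIntegral_dyadicCell_le u.isBVFun.integrable.abs (fun _ => abs_nonneg _) n _) hM

theorem norm_stepFunctional_le {d : ℕ} [NeZero d] {n : ℕ} {c : (Fin d → ℤ) → ℝ} {M : ℝ}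
    (hM : 0 ≤ M) (hc : ∀ k ∈ indexBox d n, |c k| ≤ M) : ‖stepFunctional n c‖ ≤ M :=
  ContinuousLinearMap.opNorm_le_bound _ hM fun u =>
    (abs_stepFunctional_le hM hc u).trans (mul_le_mul_of_nonneg_left u.integral_abs_le hM)

/-- The step function of generation `n` with values `c` on the cells inside the cube. -/
noncomputable def stepFun {d : ℕ} (n : ℕ) (c : (Fin d → ℤ) → ℝ) (x : E d) : ℝ :=
  ∑ k ∈ indexBox d n, (dyadicCell n k).indicator (fun _ => c k) x

theorem measurable_stepFun {d : ℕ} (n : ℕ) (c : (Fin d → ℤ) → ℝ) :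
    Measurable (stepFun n c : E d → ℝ) :=
  Finset.measurable_fun_sum _ fun k _ => measurable_const.indicator (measurableSet_dyadicCell n k)

theorem abs_stepFun_le {d n : ℕ} (c : (Fin d → ℤ) → ℝ) (x : E d) :
    |stepFun n c x| ≤ ∑ k ∈ indexBox d n, |c k| := by
  refine (Finset.abs_sum_le_sum_abs _ _).trans (Finset.sum_le_sum fun k _ => ?_)
  by_cases h : x ∈ dyadicCell n k <;> simp [h]

theorem memLp_stepFun {d : ℕ} (n : ℕ) (c : (Fin d → ℤ) → ℝ) (p : ℝ≥0∞) :
    MemLp (fun x : cube d => stepFun n c (x : E d)) p (cubeVolume d) :=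
  MemLp.of_bound ((measurable_stepFun n c).comp measurable_subtype_coe).aestronglyMeasurable _
    (ae_of_all _ fun x => abs_stepFun_le c (x : E d))

theorem dyadicCell_subset_cube {d n : ℕ} {k : Fin d → ℤ} (hk : k ∈ indexBox d n) :
    dyadicCell n k ⊆ cube d :=
  (dyadicCell_subset_closedCell n k).trans (closedCell_subset_cube hk)

theorem stepFunctional_eq_integral {d : ℕ} [NeZero d] (n : ℕ) (c : (Fin d → ℤ) → ℝ)
    (u : BVFun d) : stepFunctional n c u
      = ∫ x : cube d, stepFun n c (x : E d) * u.toFun x ∂cubeVolume d := by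
  rw [integral_cubeVolume fun x => stepFun n c x * u.toFun x, stepFunctional_apply]
  have h1 : ∀ x, stepFun n c x * u.toFun x
      = ∑ k ∈ indexBox d n, (dyadicCell n k).indicator (fun x => c k * u.toFun x) x := by
    intro x
    rw [stepFun, Finset.sum_mul]
    refine Finset.sum_congr rfl fun k _ => ?_
    by_cases h : x ∈ dyadicCell n k <;> simp [h]
  simp_rw [h1]
  rw [integral_finsetSum _ fun k _ =>
    ((u.isBVFun.integrable.const_mul (c k)).indicator (measurableSet_dyadicCell n k)).integrableOn]
  refine Finset.sum_congr rfl fun k hk => ?_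
  rw [setIntegral_indicator (measurableSet_dyadicCell n k),
    inter_eq_self_of_subset_right (dyadicCell_subset_cube hk), integral_const_mul]
  rfl

theorem stepFunctional_mem {d : ℕ} [NeZero d] (n : ℕ) (c : (Fin d → ℤ) → ℝ) :
    stepFunctional n c ∈ strongChargeFunctionals d :=
  subset_closure ⟨fun x => stepFun n c (x : E d), memLp_stepFun n c _,
    stepFunctional_eq_integral n c⟩

theorem integral_mul_bvIndicator {d : ℕ} (g : cube d → ℝ) (B : BVSubset d) :
    ∫ x : cube d, g x * (bvIndicator B).toFun x ∂cubeVolume d = density g B := by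
  rw [density, ← integral_indicator₀ B.nullMeasurableSet_preimage, toFun_bvIndicator]
  congr 1
  ext x
  by_cases h : (x : E d) ∈ (B : Set (E d)) <;> simp [h]

theorem stepFunctional_bvIndicator {d : ℕ} [NeZero d] (n : ℕ) (c : (Fin d → ℤ) → ℝ)
    (B : BVSubset d) : stepFunctional n c (bvIndicator B)
      = density (fun x : cube d => stepFun n c (x : E d)) B := by
  rw [stepFunctional_eq_integral, integral_mul_bvIndicator]

/-- The seminorm of u - w is zero and α is bounded. -/
theorem StrongDual.congr_ae {d : ℕ} (α : StrongDual ℝ (BVFun d)) {u w : BVFun d}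
    (h : u.toFun =ᵐ[volume] w.toFun) : α u = α w := by
  have h1 : ‖u - w‖ = 0 := by
    rw [BVFun.norm_def, BVFun.toFun_sub, variation_congr_ae (w := 0), variation_zero,
      ENNReal.toReal_zero]
    filter_upwards [h] with x hx
    simp [hx]
  have h2 := α.le_opNorm (u - w)
  rw [h1, mul_zero, map_sub, norm_le_zero_iff, sub_eq_zero] at h2
  exact h2

/-- The set function induced by a strong charge functional is a charge. -/
theorem isCharge_of_mem {d : ℕ} [NeZero d] {α : StrongDual ℝ (BVFun d)}
    (hα : α ∈ strongChargeFunctionals d) : IsCharge fun B => α (bvIndicator B) := by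
  constructor
  · intro B₁ B₂ B h0 hB
    rw [← map_add]
    refine StrongDual.congr_ae α ?_
    have h1 : ∀ᵐ x, x ∉ (B₁ : Set (E d)) ∩ B₂ := measure_eq_zero_iff_ae_notMem.1 h0
    filter_upwards [h1] with x hx
    rw [BVFun.toFun_add, Pi.add_apply]
    simp only [toFun_bvIndicator, hB]
    by_cases hx1 : x ∈ (B₁ : Set (E d)) <;> by_cases hx2 : x ∈ (B₂ : Set (E d)) <;>
      simp_all
  · intro B B₀ h
    obtain ⟨P, hP⟩ : ∃ P : ℝ, ∀ n, ‖bvIndicator (B n)‖ ≤ P := by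
      refine ⟨(⨆ n, perimeter (B n : Set (E d))).toReal, fun n => ?_⟩
      exact ENNReal.toReal_mono h.2.ne (le_iSup (fun n => perimeter (B n : Set (E d))) n)
    have hP0 : 0 ≤ P := (norm_nonneg _).trans (hP 0)
    set Q := P + ‖bvIndicator B₀‖ + 1 with hQ
    have hQ0 : 0 < Q := by positivity
    rw [Metric.tendsto_atTop]
    intro ε hε
    -- `Q` bounds the BV norms of all differences of indicators, thanks to the perimeter bound in
    -- BV-convergence. Replacing α by a functional with an L^d density thus costs at most ε / 2
    -- uniformly in n, and densities already give charges.
    obtain ⟨τ, ⟨g, hg, hτ⟩, hατ⟩ := Metric.mem_closure_iff.1 hα (ε / (2 * Q)) (by positivity)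
    have hgi : Integrable g (cubeVolume d) :=
      hg.integrable (by exact_mod_cast NeZero.one_le)
    have hc := (isCharge_density hgi).continuous B B₀ h
    obtain ⟨N, hN⟩ := Metric.tendsto_atTop.1 hc (ε / 2) (by positivity)
    refine ⟨N, fun n hn => ?_⟩
    have h1 := hN n hn
    have h2 : ∀ A, density g A = τ (bvIndicator A) := fun A => by
      rw [hτ, integral_mul_bvIndicator]
    rw [h2, h2, Real.dist_eq, ← map_sub] at h1
    rw [Real.dist_eq, ← map_sub]
    have h3 := (α - τ).le_opNorm (bvIndicator (B n) - bvIndicator B₀)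
    have h4 : ‖bvIndicator (B n) - bvIndicator B₀‖ ≤ Q :=
      (norm_sub_le _ _).trans (by have := hP n; linarith)
    rw [dist_eq_norm] at hατ
    have h5 : ‖α - τ‖ * ‖bvIndicator (B n) - bvIndicator B₀‖ ≤ ε / (2 * Q) * Q :=
      mul_le_mul hατ.le h4 (norm_nonneg _) (by positivity)
    have h6 : ε / (2 * Q) * Q = ε / 2 := by field_simp
    rw [sub_apply, Real.norm_eq_abs] at h3
    have h7 := abs_add_le (α (bvIndicator (B n) - bvIndicator B₀)
      - τ (bvIndicator (B n) - bvIndicator B₀)) (τ (bvIndicator (B n) - bvIndicator B₀))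
    rw [sub_add_cancel] at h7
    linarith

/-! ### Refinement of dyadic cells -/

/-- The index of the cell of the previous generation that contains a given cell. -/
def parentIndex {d : ℕ} (k : Fin d → ℤ) : Fin d → ℤ := fun i => k i / 2

theorem dyadicIndex_eq_parentIndex {d : ℕ} (n : ℕ) (x : E d) :
    dyadicIndex n x = parentIndex (dyadicIndex (n + 1) x) := by
  ext i
  have h := Int.floor_div_natCast ((2 : ℝ) ^ (n + 1) * x i) 2
  rw [dyadicIndex_apply, parentIndex, dyadicIndex_apply]
  push_cast at h
  rw [← h]
  congr 1
  rw [pow_succ]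
  ring

theorem parentIndex_mem_iff {d n : ℕ} {k : Fin d → ℤ} :
    parentIndex k ∈ indexBox d n ↔ k ∈ indexBox d (n + 1) := by
  simp only [mem_indexBox, parentIndex, pow_succ]
  refine forall_congr' fun i => ?_
  omega

/-- The cells of the next generation contained in a given cell. -/
noncomputable def children {d : ℕ} (n : ℕ) (k : Fin d → ℤ) : Finset (Fin d → ℤ) :=
  (indexBox d (n + 1)).filter fun l => parentIndex l = k

theorem mem_children {d n : ℕ} {k l : Fin d → ℤ} :
    l ∈ children n k ↔ l ∈ indexBox d (n + 1) ∧ parentIndex l = k := by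
  simp [children]

theorem sum_indexBox_succ {d : ℕ} {M : Type*} [AddCommMonoid M] (n : ℕ) (F : (Fin d → ℤ) → M) :
    ∑ l ∈ indexBox d (n + 1), F l = ∑ k ∈ indexBox d n, ∑ l ∈ children n k, F l :=
  (Finset.sum_fiberwise_of_maps_to (fun _ hl => parentIndex_mem_iff.2 hl) F).symm

theorem dyadicCell_eq_iUnion_children {d n : ℕ} {k : Fin d → ℤ} (hk : k ∈ indexBox d n) :
    (dyadicCell n k : Set (E d)) = ⋃ l ∈ children n k, dyadicCell (n + 1) l := by
  ext x
  simp only [mem_dyadicCell, mem_iUnion, exists_prop, mem_children, dyadicIndex_eq_parentIndex n x]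
  constructor
  · intro h
    exact ⟨_, ⟨parentIndex_mem_iff.1 (h ▸ hk), h⟩, rfl⟩
  · rintro ⟨l, ⟨_, hl⟩, h⟩
    rw [h, hl]

theorem cellIntegral_eq_sum_children {d : ℕ} [NeZero d] {n : ℕ} {k : Fin d → ℤ}
    (hk : k ∈ indexBox d n) (u : BVFun d) :
    cellIntegral n k u = ∑ l ∈ children n k, cellIntegral (n + 1) l u := by
  rw [cellIntegral_apply, dyadicCell_eq_iUnion_children hk,
    integral_biUnion_finset _ (fun l _ => measurableSet_dyadicCell _ l)
    (fun l _ m _ h => disjoint_dyadicCell _ h) fun l _ => u.isBVFun.integrable.integrableOn]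
  rfl

theorem stepFunctional_eq_succ {d : ℕ} [NeZero d] (n : ℕ) (c : (Fin d → ℤ) → ℝ) :
    stepFunctional n c = stepFunctional (n + 1) fun l => c (parentIndex l) := by
  ext u
  rw [stepFunctional_apply, stepFunctional_apply, sum_indexBox_succ]
  refine Finset.sum_congr rfl fun k hk => ?_
  rw [cellIntegral_eq_sum_children hk, Finset.mul_sum]
  refine Finset.sum_congr rfl fun l hl => ?_
  rw [(mem_children.1 hl).2]

theorem IsCharge.eq_sum_children {d : ℕ} {ω : BVSubset d → ℝ} (hω : IsCharge ω) {n : ℕ}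
    {k : Fin d → ℤ} (hk : k ∈ indexBox d n) :
    ω (figure n {k}) = ∑ l ∈ children n k, ω (figure (n + 1) {l}) := by
  rw [← hω.figure_eq_sum]
  congr 1
  refine Subtype.ext ?_
  rw [coe_figure_singleton hk, dyadicCell_eq_iUnion_children hk, coe_figure,
    Finset.inter_eq_left.2 fun l hl => (mem_children.1 hl).1, preimage_dyadicIndex_eq_iUnion]

theorem card_children {d n : ℕ} {k : Fin d → ℤ} (hk : k ∈ indexBox d n) :
    ((children n k).card : ℝ) * cellVol d (n + 1) = cellVol d n := by
  have h := volume_preimage_dyadicIndex (d := d) (n + 1) (children n k)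
  rw [preimage_dyadicIndex_eq_iUnion, ← dyadicCell_eq_iUnion_children hk] at h
  have h2 := congrArg ENNReal.toReal h
  rw [ENNReal.toReal_mul, ENNReal.toReal_natCast,
    ENNReal.toReal_ofReal (cellVol_pos _ _).le] at h2
  rw [← h2, ← volume_real_dyadicCell n k, Measure.real]

/-- The lattice point `2⁻ⁿ e`, which is the lower corner of the cell of index `e`. -/
noncomputable def latticePoint {d : ℕ} (n : ℕ) (e : Fin d → ℤ) : E d :=
  WithLp.toLp 2 fun i => (e i : ℝ) / 2 ^ n

theorem dyadicIndex_sub_latticePoint {d : ℕ} (n : ℕ) (e : Fin d → ℤ) (x : E d) :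
    dyadicIndex n (x - latticePoint n e) = dyadicIndex n x - e := by
  ext i
  rw [dyadicIndex_apply, Pi.sub_apply, dyadicIndex_apply, ← Int.floor_sub_intCast]
  congr 1
  simp only [latticePoint, PiLp.sub_apply]
  field_simp

theorem setIntegral_dyadicCell_sub {d : ℕ} (n : ℕ) (k e : Fin d → ℤ) (F : E d → ℝ) :
    ∫ x in dyadicCell n (k - e), F x = ∫ x in dyadicCell n k, F (x - latticePoint n e) := by
  have h := (measurePreserving_sub_right volume (latticePoint n e)).setIntegral_preimage_emb
    (MeasurableEquiv.subRight (latticePoint n e)).measurableEmbedding F (dyadicCell n (k - e))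
  rw [← h]
  congr 2
  ext x
  simp only [mem_preimage, mem_dyadicCell, dyadicIndex_sub_latticePoint]
  exact sub_left_inj

theorem norm_latticePoint_le {d : ℕ} (n : ℕ) {e : Fin d → ℤ} (he : ∀ i, |e i| ≤ 1) :
    ‖latticePoint n e‖ ≤ √d * ((2 : ℝ) ^ n)⁻¹ := by
  have h2 : (0 : ℝ) < 2 ^ n := by positivity
  have hi : ∀ i ∈ Finset.univ, ‖latticePoint n e i‖ ^ 2 ≤ (((2 : ℝ) ^ n)⁻¹) ^ 2 := by
    intro i _
    refine pow_le_pow_left₀ (norm_nonneg _) ?_ 2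
    have h3 : |(e i : ℝ)| ≤ 1 := by exact_mod_cast he i
    simp only [latticePoint, Real.norm_eq_abs, abs_div, abs_of_pos h2]
    rw [← one_div]
    gcongr
  rw [EuclideanSpace.norm_eq]
  refine (Real.sqrt_le_sqrt (Finset.sum_le_sum hi)).trans (le_of_eq ?_)
  rw [Finset.sum_const, Finset.card_univ, Fintype.card_fin, nsmul_eq_mul,
    Real.sqrt_mul (by positivity), Real.sqrt_sq (by positivity)]

/-- Step functions with zero mean on the cells of the previous generation are small functionals
on `BV`. -/
theorem norm_stepFunctional_succ_le {d : ℕ} [NeZero d] {n : ℕ} {b : (Fin d → ℤ) → ℝ} {M : ℝ}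
    (hM : 0 ≤ M) (hb : ∀ l ∈ indexBox d (n + 1), |b l| ≤ M)
    (h0 : ∀ k ∈ indexBox d n, ∑ l ∈ children n k, b l = 0) :
    ‖stepFunctional (n + 1) b‖ ≤ M * (2 ^ d * √d) * ((2 : ℝ) ^ (n + 1))⁻¹ := by
  refine ContinuousLinearMap.opNorm_le_bound _ (by positivity) fun u => ?_
  -- The child of k at its lower corner. Every other child is its translate by a lattice vector with
  -- entries 0 or 1, recorded by `off`.
  set first : (Fin d → ℤ) → Fin d → ℤ := fun k i => 2 * k i with hfirst
  set off : (Fin d → ℤ) → Fin d → ℤ := fun l i => l i % 2 with hoff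
  set P : Finset (Fin d → ℤ) := Fintype.piFinset fun _ => {0, 1} with hP
  have hoffP : ∀ l, off l ∈ P := by
    intro l
    simp only [hP, hoff, Fintype.mem_piFinset, Finset.mem_insert, Finset.mem_singleton]
    intro i
    omega
  have hfo : ∀ l, first (parentIndex l) = l - off l := by
    intro l
    ext i
    simp only [hfirst, hoff, parentIndex, Pi.sub_apply]
    omega
  have hui := u.isBVFun.integrable
  have hT : ∀ e, Integrable (fun x => |u.toFun (x + -latticePoint (n + 1) e) - u.toFun x|) volume :=
    fun e => ((hui.comp_add_right _).sub hui).abs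
  have hF : Integrable (fun x => ∑ e ∈ P, |u.toFun (x + -latticePoint (n + 1) e) - u.toFun x|)
      volume := integrable_finsetSum _ fun e _ => hT e
  have h1 : stepFunctional (n + 1) b u = ∑ l ∈ indexBox d (n + 1), b l *
      (cellIntegral (n + 1) l u - cellIntegral (n + 1) (first (parentIndex l)) u) := by
    -- Since b has mean zero on each parent, a quantity depending only on the parent may be
    -- subtracted. Only differences of integrals of u over translated cells remain.
    have h2 : ∑ l ∈ indexBox d (n + 1), b l * cellIntegral (n + 1) (first (parentIndex l)) u
        = 0 := by
      rw [sum_indexBox_succ]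
      refine Finset.sum_eq_zero fun k hk => ?_
      rw [← zero_mul (cellIntegral (n + 1) (first k) u), ← h0 k hk, Finset.sum_mul]
      refine Finset.sum_congr rfl fun l hl => ?_
      rw [(mem_children.1 hl).2]
    rw [stepFunctional_apply]
    simp only [mul_sub, Finset.sum_sub_distrib, h2, sub_zero]
  have h3 : ∀ l, |cellIntegral (n + 1) l u - cellIntegral (n + 1) (first (parentIndex l)) u| ≤
      ∫ x in dyadicCell (n + 1) l,
        ∑ e ∈ P, |u.toFun (x + -latticePoint (n + 1) e) - u.toFun x| := by
    intro l
    rw [abs_sub_comm, hfo, cellIntegral_apply, cellIntegral_apply, setIntegral_dyadicCell_sub,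
      ← integral_sub _ hui.integrableOn]
    · rw [← Real.norm_eq_abs]
      refine (norm_integral_le_integral_norm _).trans ?_
      refine integral_mono ?_ hF.integrableOn fun x => ?_
      · have := (hT (off l)).integrableOn (s := dyadicCell (n + 1) l)
        simpa only [← sub_eq_add_neg, Real.norm_eq_abs, IntegrableOn] using this
      · have := Finset.single_le_sum (f := fun e =>
          |u.toFun (x + -latticePoint (n + 1) e) - u.toFun x|) (fun _ _ => abs_nonneg _) (hoffP l)
        simpa only [← sub_eq_add_neg, Real.norm_eq_abs, IntegrableOn] using this
    · have := hui.comp_add_right (-latticePoint (n + 1) (off l))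
      simp only [← sub_eq_add_neg] at this
      exact this.integrableOn
  -- All 2^d offsets are summed on every cell, a crude bound that costs the factor 2^d.
  have h4 : ∫ x, ∑ e ∈ P, |u.toFun (x + -latticePoint (n + 1) e) - u.toFun x|
      ≤ 2 ^ d * √d * ((2 : ℝ) ^ (n + 1))⁻¹ * ‖u‖ := by
    rw [integral_finsetSum _ fun e _ => hT e]
    have h5 : ∀ e ∈ P, ∫ x, |u.toFun (x + -latticePoint (n + 1) e) - u.toFun x|
        ≤ √d * ((2 : ℝ) ^ (n + 1))⁻¹ * ‖u‖ := by
      intro e he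
      refine (integral_abs_translate_sub_le hui u.isBVFun.variation_lt_top _).trans ?_
      rw [norm_neg, ← BVFun.norm_def]
      refine mul_le_mul_of_nonneg_right (norm_latticePoint_le _ fun i => ?_) (norm_nonneg _)
      have := Fintype.mem_piFinset.1 he i
      simp only [Finset.mem_insert, Finset.mem_singleton] at this
      rcases this with h | h <;> simp [h]
    refine (Finset.sum_le_sum h5).trans (le_of_eq ?_)
    have hcard : P.card = 2 ^ d := by simp [hP]
    rw [Finset.sum_const, hcard, nsmul_eq_mul]
    push_cast
    ring
  rw [h1, Real.norm_eq_abs]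
  calc _ ≤ ∑ l ∈ indexBox d (n + 1), M * ∫ x in dyadicCell (n + 1) l,
        ∑ e ∈ P, |u.toFun (x + -latticePoint (n + 1) e) - u.toFun x| := by
        refine (Finset.abs_sum_le_sum_abs _ _).trans (Finset.sum_le_sum fun l hl => ?_)
        rw [abs_mul]
        exact mul_le_mul (hb l hl) (h3 l) (abs_nonneg _) hM
    _ ≤ M * (2 ^ d * √d * ((2 : ℝ) ^ (n + 1))⁻¹ * ‖u‖) := by
        rw [← Finset.mul_sum]
        refine mul_le_mul_of_nonneg_left ((sum_setIntegral_dyadicCell_le hF (fun x => ?_) _ _).trans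
          h4) hM
        exact Finset.sum_nonneg fun _ _ => abs_nonneg _
    _ = _ := by ring

/-! ### Descendants of a dyadic cell -/

theorem dyadicIndex_eq_iterate {d : ℕ} (m j : ℕ) (x : E d) :
    dyadicIndex m x = parentIndex^[j] (dyadicIndex (m + j) x) := by
  induction j with
  | zero => rfl
  | succ j ih => rw [ih, Function.iterate_succ_apply, ← add_assoc, ← dyadicIndex_eq_parentIndex]

/-- The cells of generation `m + j` contained in a given cell of generation `m`. -/
noncomputable def descendants {d : ℕ} (m : ℕ) (k : Fin d → ℤ) (j : ℕ) : Finset (Fin d → ℤ) :=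
  (indexBox d (m + j)).filter fun l => parentIndex^[j] l = k

theorem mem_descendants {d m j : ℕ} {k l : Fin d → ℤ} :
    l ∈ descendants m k j ↔ l ∈ indexBox d (m + j) ∧ parentIndex^[j] l = k := by
  simp [descendants]

theorem iterate_parentIndex_mem_iff {d m : ℕ} (j : ℕ) {l : Fin d → ℤ} :
    parentIndex^[j] l ∈ indexBox d m ↔ l ∈ indexBox d (m + j) := by
  induction j generalizing l with
  | zero => rfl
  | succ j ih => rw [Function.iterate_succ_apply, ih, parentIndex_mem_iff, add_assoc]

theorem figure_descendants {d m : ℕ} {k : Fin d → ℤ} (hk : k ∈ indexBox d m) (j : ℕ) :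
    (figure (m + j) (descendants m k j) : BVSubset d) = figure m {k} := by
  refine Subtype.ext ?_
  rw [coe_figure_singleton hk, coe_figure,
    Finset.inter_eq_left.2 fun l hl => (mem_descendants.1 hl).1]
  ext x
  rw [mem_preimage, Finset.mem_coe, mem_descendants, mem_dyadicCell, ← dyadicIndex_eq_iterate,
    ← iterate_parentIndex_mem_iff, ← dyadicIndex_eq_iterate]
  exact ⟨fun h => h.2, fun h => ⟨h ▸ hk, h⟩⟩

theorem sum_descendants_succ {d m : ℕ} {M : Type*} [AddCommMonoid M] (k : Fin d → ℤ) (j : ℕ)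
    (F : (Fin d → ℤ) → M) : ∑ l ∈ descendants m k (j + 1), F l
      = ∑ k' ∈ descendants m k j, ∑ l ∈ children (m + j) k', F l := by
  have h : ∀ l ∈ descendants m k (j + 1), parentIndex l ∈ descendants m k j := by
    intro l hl
    rw [mem_descendants, Function.iterate_succ_apply] at hl
    exact mem_descendants.2 ⟨parentIndex_mem_iff.2 hl.1, hl.2⟩
  rw [← Finset.sum_fiberwise_of_maps_to h]
  refine Finset.sum_congr rfl fun k' hk' => Finset.sum_congr ?_ fun _ _ => rfl
  ext l
  simp only [Finset.mem_filter, mem_descendants, mem_children, Function.iterate_succ_apply,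
    ← add_assoc]
  constructor
  · rintro ⟨⟨h1, _⟩, h2⟩
    exact ⟨h1, h2⟩
  · rintro ⟨h1, h2⟩
    exact ⟨⟨h1, h2 ▸ (mem_descendants.1 hk').2⟩, h2⟩

theorem volume_real_figure {d : ℕ} (n : ℕ) {S : Finset (Fin d → ℤ)} (hS : S ⊆ indexBox d n) :
    volume.real (figure n S : Set (E d)) = S.card * cellVol d n := by
  rw [coe_figure, Finset.inter_eq_left.2 hS, Measure.real, volume_preimage_dyadicIndex,
    ENNReal.toReal_mul, ENNReal.toReal_natCast, ENNReal.toReal_ofReal (cellVol_pos d n).le]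

theorem card_descendants {d m : ℕ} {k : Fin d → ℤ} (hk : k ∈ indexBox d m) (j : ℕ) :
    ((descendants m k j).card : ℝ) * cellVol d (m + j) = cellVol d m := by
  rw [← volume_real_figure _ fun l hl => (mem_descendants.1 hl).1, figure_descendants hk,
    coe_figure_singleton hk, volume_real_dyadicCell]

theorem IsCharge.eq_sum_descendants {d : ℕ} {ω : BVSubset d → ℝ} (hω : IsCharge ω) {m : ℕ}
    {k : Fin d → ℤ} (hk : k ∈ indexBox d m) (j : ℕ) :
    ω (figure m {k}) = ∑ l ∈ descendants m k j, ω (figure (m + j) {l}) := by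
  rw [← hω.figure_eq_sum, figure_descendants hk]

theorem stepFunctional_figure {d : ℕ} [NeZero d] {n : ℕ} (c : (Fin d → ℤ) → ℝ)
    {S : Finset (Fin d → ℤ)} (hS : S ⊆ indexBox d n) :
    stepFunctional n c (bvIndicator (figure n S)) = ∑ k ∈ S, c k * cellVol d n := by
  rw [stepFunctional_apply, ← Finset.sum_subset hS]
  · refine Finset.sum_congr rfl fun k hk => ?_
    rw [cellIntegral_bvIndicator, inter_eq_self_of_subset_right, volume_real_dyadicCell]
    intro x hx
    rw [coe_figure, mem_preimage, mem_dyadicCell.1 hx]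
    exact Finset.mem_inter.2 ⟨hk, hS hk⟩
  · intro k _ hkS
    have : (figure n S : Set (E d)) ∩ dyadicCell n k = ∅ := by
      ext x
      simp only [mem_inter_iff, mem_empty_iff_false, iff_false, not_and]
      intro h1 h2
      rw [coe_figure, mem_preimage, mem_dyadicCell.1 h2] at h1
      exact hkS (Finset.mem_inter.1 h1).1
    rw [cellIntegral_bvIndicator, this]
    simp

/-! ### Hölder bounds -/

/-- The bound on dyadic cells that defines `γ`-Hölder charges. -/
def CellBound {d : ℕ} (γ κ : ℝ) (ω : BVSubset d → ℝ) : Prop :=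
  ∀ n, ∀ k ∈ indexBox d n, |ω (figure n {k})| ≤ κ * cellVol d n ^ γ

/-- A common rate for the convergence of Riemann sums. -/
noncomputable def youngRate (d : ℕ) (β γ : ℝ) : ℝ := (1 / 2 : ℝ) ^ (β + d * γ - d)

theorem youngRate_pos (d : ℕ) (β γ : ℝ) : 0 < youngRate d β γ := by
  unfold youngRate; positivity

theorem youngRate_lt_one {d : ℕ} {β γ : ℝ} (h : (d : ℝ) < β + d * γ) : youngRate d β γ < 1 :=
  Real.rpow_lt_one (by norm_num) (by norm_num) (by linarith)

theorem inv_two_pow_eq (n : ℕ) : ((2 : ℝ) ^ n)⁻¹ = (1 / 2 : ℝ) ^ (n : ℝ) := by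
  rw [Real.rpow_natCast, one_div, inv_pow]

theorem cellVol_eq_rpow (d n : ℕ) : cellVol d n = (1 / 2 : ℝ) ^ ((n : ℝ) * d) := by
  rw [cellVol, inv_two_pow_eq, ← Real.rpow_natCast, ← Real.rpow_mul (by norm_num)]

/-- The left side is the order of magnitude of an increment of f times a mean density of ω; it
decays precisely when β + dγ > d. -/
theorem inv_two_pow_rpow_mul_cellVol (d n : ℕ) (β γ : ℝ) :
    ((2 : ℝ) ^ n)⁻¹ ^ β * cellVol d n ^ (γ - 1) = youngRate d β γ ^ n := by
  rw [inv_two_pow_eq, cellVol_eq_rpow, youngRate, ← Real.rpow_natCast,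
    ← Real.rpow_mul (by norm_num), ← Real.rpow_mul (by norm_num), ← Real.rpow_mul (by norm_num),
    ← Real.rpow_add (by norm_num)]
  congr 1
  ring

/-- Converts the geometric tail of the Riemann sums over one cell into the powers of |K| required by
the Hölder estimate. -/
theorem cellVol_mul_youngRate {d : ℕ} [NeZero d] (n : ℕ) (β γ : ℝ) :
    cellVol d n * youngRate d β γ ^ n = cellVol d n ^ (β / d) * cellVol d n ^ γ := by
  have hd : (d : ℝ) ≠ 0 := by exact_mod_cast NeZero.ne d
  rw [cellVol_eq_rpow, youngRate, ← Real.rpow_natCast,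
    ← Real.rpow_mul (by norm_num), ← Real.rpow_mul (by norm_num), ← Real.rpow_mul (by norm_num),
    ← Real.rpow_add (by norm_num), ← Real.rpow_add (by norm_num)]
  congr 1
  field_simp
  ring

theorem cellVol_rpow_sub_one (d n : ℕ) (γ : ℝ) :
    cellVol d n ^ γ / cellVol d n = cellVol d n ^ (γ - 1) := by
  rw [Real.rpow_sub_one (cellVol_pos d n).ne']

theorem cellVol_anti (d : ℕ) {m n : ℕ} (h : m ≤ n) : cellVol d n ≤ cellVol d m := by
  unfold cellVol
  gcongr
  norm_num

theorem cellVol_le_one (d n : ℕ) : cellVol d n ≤ 1 := by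
  simpa [cellVol] using cellVol_anti d (Nat.zero_le n)

/-- The extension by zero of a function on the cube. -/
noncomputable def cubeExtend {d : ℕ} (f : cube d → ℝ) (x : E d) : ℝ :=
  open Classical in if h : x ∈ cube d then f ⟨x, h⟩ else 0

theorem cubeExtend_of_mem {d : ℕ} (f : cube d → ℝ) {x : E d} (h : x ∈ cube d) :
    cubeExtend f x = f ⟨x, h⟩ := dif_pos h

theorem latticePoint_mem_closedCell {d : ℕ} (n : ℕ) (k : Fin d → ℤ) :
    latticePoint n k ∈ (closedCell n k : Set (E d)) := by
  intro i
  simp only [latticePoint]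
  refine ⟨le_rfl, ?_⟩
  gcongr
  linarith

theorem latticePoint_mem_cube {d n : ℕ} {k : Fin d → ℤ} (hk : k ∈ indexBox d n) :
    latticePoint n k ∈ cube d :=
  closedCell_subset_cube hk (latticePoint_mem_closedCell n k)

/-- The value of `f` at the lower corner of a cell. -/
noncomputable def cornerVal {d : ℕ} (n : ℕ) (f : cube d → ℝ) (k : Fin d → ℤ) : ℝ :=
  cubeExtend f (latticePoint n k)

theorem cornerVal_eq {d n : ℕ} (f : cube d → ℝ) {k : Fin d → ℤ} (hk : k ∈ indexBox d n) :
    cornerVal n f k = f ⟨latticePoint n k, latticePoint_mem_cube hk⟩ :=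
  cubeExtend_of_mem f _

/-- The two corners differ by a lattice vector of the finer generation with entries 0 or 1. The
factor √d^β is enlarged to √d because β < 1 ≤ √d. -/
theorem abs_cornerVal_sub_le {d : ℕ} [NeZero d] {β : ℝ≥0} (hβ1 : β < 1) {f : cube d → ℝ} {L : ℝ≥0}
    (hf : HolderWith L β f) {n : ℕ} {l : Fin d → ℤ} (hl : l ∈ indexBox d (n + 1)) :
    |cornerVal (n + 1) f l - cornerVal n f (parentIndex l)|
      ≤ L * √d * ((2 : ℝ) ^ (n + 1))⁻¹ ^ (β : ℝ) := by
  rw [cornerVal_eq f hl, cornerVal_eq f (parentIndex_mem_iff.2 hl)]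
  have h1 := hf.dist_le (x := ⟨latticePoint (n + 1) l, latticePoint_mem_cube hl⟩)
    (y := ⟨latticePoint n (parentIndex l), latticePoint_mem_cube (parentIndex_mem_iff.2 hl)⟩)
  rw [Real.dist_eq, Subtype.dist_eq, dist_eq_norm] at h1
  refine h1.trans ?_
  have h2 : (latticePoint (n + 1) l : E d) - latticePoint n (parentIndex l)
      = latticePoint (n + 1) fun i => l i % 2 := by
    ext i
    simp only [latticePoint, PiLp.sub_apply, parentIndex]
    have h3 : (l i : ℝ) = 2 * ((l i / 2 : ℤ) : ℝ) + ((l i % 2 : ℤ) : ℝ) := by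
      exact_mod_cast (Int.mul_ediv_add_emod (l i) 2).symm
    rw [h3, pow_succ]
    field_simp
    ring_nf
  have h4 : ‖(latticePoint (n + 1) l : E d) - latticePoint n (parentIndex l)‖
      ≤ √d * ((2 : ℝ) ^ (n + 1))⁻¹ := by
    rw [h2]
    refine norm_latticePoint_le _ fun i => ?_
    rw [abs_le]
    omega
  have hd : (1 : ℝ) ≤ √d := by
    rw [Real.one_le_sqrt]
    exact_mod_cast NeZero.one_le
  rw [mul_assoc]
  refine mul_le_mul_of_nonneg_left ?_ L.2
  calc _ ≤ (√d * ((2 : ℝ) ^ (n + 1))⁻¹) ^ (β : ℝ) :=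
        Real.rpow_le_rpow (norm_nonneg _) h4 β.2
    _ = √d ^ (β : ℝ) * ((2 : ℝ) ^ (n + 1))⁻¹ ^ (β : ℝ) :=
        Real.mul_rpow (by positivity) (by positivity)
    _ ≤ √d * ((2 : ℝ) ^ (n + 1))⁻¹ ^ (β : ℝ) := by
        refine mul_le_mul_of_nonneg_right ?_ (by positivity)
        calc √d ^ (β : ℝ) ≤ √d ^ (1 : ℝ) :=
              Real.rpow_le_rpow_of_exponent_le hd (by exact_mod_cast hβ1.le)
          _ = √d := Real.rpow_one _

/-! ### The indefinite Young integral as a limit of Riemann sums -/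

/-- The Riemann sums of the Young integral, as functionals on `BV`. -/
noncomputable def youngStep {d : ℕ} [NeZero d] (n : ℕ) (f : cube d → ℝ) (ω : BVSubset d → ℝ) :
    StrongDual ℝ (BVFun d) :=
  stepFunctional n fun k => cornerVal n f k * (ω (figure n {k}) / cellVol d n)

theorem youngStep_add_left {d : ℕ} [NeZero d] (n : ℕ) (f g : cube d → ℝ) (ω : BVSubset d → ℝ) :
    youngStep n (f + g) ω = youngStep n f ω + youngStep n g ω := by
  rw [youngStep, youngStep, youngStep, ← stepFunctional_add]
  refine stepFunctional_congr fun k hk => ?_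
  simp only [Pi.add_apply, cornerVal_eq _ hk]
  ring

theorem youngStep_smul_left {d : ℕ} [NeZero d] (n : ℕ) (r : ℝ) (f : cube d → ℝ)
    (ω : BVSubset d → ℝ) : youngStep n (r • f) ω = r • youngStep n f ω := by
  rw [youngStep, youngStep, ← stepFunctional_smul]
  refine stepFunctional_congr fun k hk => ?_
  simp only [Pi.smul_apply, cornerVal_eq _ hk, smul_eq_mul]
  ring

theorem youngStep_add_right {d : ℕ} [NeZero d] (n : ℕ) (f : cube d → ℝ) (ω η : BVSubset d → ℝ) :
    youngStep n f (ω + η) = youngStep n f ω + youngStep n f η := by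
  rw [youngStep, youngStep, youngStep, ← stepFunctional_add]
  refine stepFunctional_congr fun k _ => ?_
  simp only [Pi.add_apply]
  ring

theorem youngStep_smul_right {d : ℕ} [NeZero d] (n : ℕ) (r : ℝ) (f : cube d → ℝ)
    (ω : BVSubset d → ℝ) : youngStep n f (r • ω) = r • youngStep n f ω := by
  rw [youngStep, youngStep, ← stepFunctional_smul]
  refine stepFunctional_congr fun k _ => ?_
  simp only [Pi.smul_apply, smul_eq_mul]
  ring

/-- On the indicator of a coarser cell the volumes cancel, which leaves a Riemann sum in the usual
sense. -/
theorem youngStep_cell {d : ℕ} [NeZero d] (f : cube d → ℝ) (ω : BVSubset d → ℝ) {m : ℕ}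
    {k : Fin d → ℤ} (hk : k ∈ indexBox d m) (j : ℕ) :
    youngStep (m + j) f ω (bvIndicator (figure m {k}))
      = ∑ l ∈ descendants m k j, cornerVal (m + j) f l * ω (figure (m + j) {l}) := by
  rw [youngStep, ← figure_descendants hk j,
    stepFunctional_figure _ fun l hl => (mem_descendants.1 hl).1]
  refine Finset.sum_congr rfl fun l _ => ?_
  have := (cellVol_pos d (m + j)).ne'
  field_simp

theorem abs_div_cellVol_le {d : ℕ} {γ κ : ℝ} {ω : BVSubset d → ℝ} (hω : CellBound γ κ ω) {n : ℕ}
    {k : Fin d → ℤ} (hk : k ∈ indexBox d n) :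
    |ω (figure n {k}) / cellVol d n| ≤ κ * cellVol d n ^ (γ - 1) := by
  rw [abs_div, abs_of_pos (cellVol_pos d n), ← cellVol_rpow_sub_one, mul_div_assoc']
  exact div_le_div_of_nonneg_right (hω n k hk) (cellVol_pos d n).le

/-- The constant in the convergence rate of the Riemann sums. -/
noncomputable def youngConst (d : ℕ) : ℝ := 2 ^ (d + 1) * √d

theorem norm_youngStep_succ_sub_le {d : ℕ} [NeZero d] {β : ℝ≥0} {γ : ℝ} (hβ1 : β < 1)
    (hγ1 : γ < 1) {f : cube d → ℝ} {A : ℝ} (hA : ∀ x, |f x| ≤ A) (hA0 : 0 ≤ A) {L : ℝ≥0}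
    (hL : HolderWith L β f) {ω : BVSubset d → ℝ} (hc : IsCharge ω) {κ : ℝ} (hκ : 0 ≤ κ)
    (hω : CellBound γ κ ω) (n : ℕ) :
    ‖youngStep (n + 1) f ω - youngStep n f ω‖
      ≤ youngConst d * (A + L) * κ * youngRate d β γ ^ (n + 1) := by
  set v := cellVol d (n + 1) with hv
  have hv0 : 0 < v := cellVol_pos _ _
  set t := ((2 : ℝ) ^ (n + 1))⁻¹ with ht
  have ht0 : 0 < t := by positivity
  -- The mean-zero part gains a full factor t; since β < 1 this is at least as good as the t^β of
  -- the other part.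
  have ht1 : t ≤ t ^ (β : ℝ) := by
    have h1 : t ≤ 1 := inv_le_one_of_one_le₀ (one_le_pow₀ one_le_two)
    calc t = t ^ (1 : ℝ) := (Real.rpow_one t).symm
      _ ≤ t ^ (β : ℝ) := Real.rpow_le_rpow_of_exponent_ge ht0 h1 (by exact_mod_cast hβ1.le)
  -- Discrete product rule: in `b` the density of ω changes while f stays at the parent corner, and
  -- in `a` the value of f changes while the density is the finer one.
  set b : (Fin d → ℤ) → ℝ := fun l => cornerVal n f (parentIndex l) *
    (ω (figure (n + 1) {l}) / v - ω (figure n {parentIndex l}) / cellVol d n) with hb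
  set a : (Fin d → ℤ) → ℝ := fun l =>
    (cornerVal (n + 1) f l - cornerVal n f (parentIndex l)) * (ω (figure (n + 1) {l}) / v) with ha
  have hsplit : youngStep (n + 1) f ω - youngStep n f ω
      = stepFunctional (n + 1) b + stepFunctional (n + 1) a := by
    rw [youngStep, youngStep, stepFunctional_eq_succ n, ← stepFunctional_sub, ← stepFunctional_add]
    refine stepFunctional_congr fun l _ => ?_
    simp only [Pi.sub_apply, Pi.add_apply, hb, ha]
    ring
  have hbb : ∀ l ∈ indexBox d (n + 1), |b l| ≤ 2 * A * (κ * v ^ (γ - 1)) := by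
    intro l hl
    have hp := parentIndex_mem_iff.2 hl
    have h1 := abs_div_cellVol_le hω hl
    have h2 := abs_div_cellVol_le hω hp
    have h3 : cellVol d n ^ (γ - 1) ≤ v ^ (γ - 1) :=
      Real.rpow_le_rpow_of_nonpos hv0 (cellVol_anti d (Nat.le_succ n)) (by linarith)
    have h4 : |ω (figure (n + 1) {l}) / v - ω (figure n {parentIndex l}) / cellVol d n|
        ≤ 2 * (κ * v ^ (γ - 1)) := by
      refine (abs_sub _ _).trans ?_
      have := mul_le_mul_of_nonneg_left h3 hκ
      linarith
    simp only [hb]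
    rw [abs_mul, cornerVal_eq f hp]
    calc _ ≤ A * (2 * (κ * v ^ (γ - 1))) := mul_le_mul (hA _) h4 (abs_nonneg _) hA0
      _ = _ := by ring
  have hb0 : ∀ k ∈ indexBox d n, ∑ l ∈ children n k, b l = 0 := by
    intro k hk
    have h1 : ∑ l ∈ children n k, b l = ∑ l ∈ children n k, cornerVal n f k *
        (ω (figure (n + 1) {l}) / v - ω (figure n {k}) / cellVol d n) := by
      refine Finset.sum_congr rfl fun l hl => ?_
      simp only [hb, (mem_children.1 hl).2]
    have h2 := card_children hk
    have h3 : cellVol d n ≠ 0 := (cellVol_pos d n).ne'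
    -- Mean zero is the additivity of ω: the children carry ω(parent) in total and their volumes add
    -- up to that of the parent.
    rw [h1, ← Finset.mul_sum, Finset.sum_sub_distrib, ← Finset.sum_div, ← hc.eq_sum_children hk,
      Finset.sum_const, nsmul_eq_mul]
    rw [← hv] at h2
    have h4 : ((children n k).card : ℝ) = cellVol d n / v := by
      rw [eq_div_iff hv0.ne', h2]
    rw [h4]
    field_simp
    simp
  have hab : ∀ l ∈ indexBox d (n + 1), |a l| ≤ L * √d * t ^ (β : ℝ) * (κ * v ^ (γ - 1)) := by
    intro l hl
    simp only [ha]
    rw [abs_mul]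
    exact mul_le_mul (abs_cornerVal_sub_le hβ1 hL hl) (abs_div_cellVol_le hω hl) (abs_nonneg _)
      (by positivity)
  have hB := norm_stepFunctional_succ_le (by positivity) hbb hb0
  have hAA := norm_stepFunctional_le (by positivity) hab
  have hrate := inv_two_pow_rpow_mul_cellVol d (n + 1) β γ
  rw [hsplit]
  refine (norm_add_le _ _).trans ((add_le_add hB hAA).trans ?_)
  rw [← hrate, ← hv, ← ht, youngConst]
  have hw0 : 0 ≤ v ^ (γ - 1) := by positivity
  have h5 : 2 * A * (κ * v ^ (γ - 1)) * (2 ^ d * √d) * t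
      ≤ 2 * A * (κ * v ^ (γ - 1)) * (2 ^ d * √d) * t ^ (β : ℝ) :=
    mul_le_mul_of_nonneg_left ht1 (by positivity)
  -- The second part is enlarged by 2^(d+1) so that both share `youngConst`.
  have h6 : L * √d * t ^ (β : ℝ) * (κ * v ^ (γ - 1)) * 1
      ≤ L * √d * t ^ (β : ℝ) * (κ * v ^ (γ - 1)) * 2 ^ (d + 1) :=
    mul_le_mul_of_nonneg_left (one_le_pow₀ one_le_two) (by positivity)
  calc _ ≤ 2 * A * (κ * v ^ (γ - 1)) * (2 ^ d * √d) * t ^ (β : ℝ)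
      + L * √d * t ^ (β : ℝ) * (κ * v ^ (γ - 1)) * 2 ^ (d + 1) := by linarith
    _ = _ := by rw [pow_succ]; ring

/-- The functional on `BV` that extends the indefinite Young integral. -/
noncomputable def youngFunctional {d : ℕ} [NeZero d] (f : cube d → ℝ) (ω : BVSubset d → ℝ) :
    StrongDual ℝ (BVFun d) :=
  limUnder atTop fun n => youngStep n f ω

/-- The indefinite Young integral. -/
noncomputable def youngCharge {d : ℕ} [NeZero d] (f : cube d → ℝ) (ω : BVSubset d → ℝ)
    (B : BVSubset d) : ℝ :=
  youngFunctional f ω (bvIndicator B)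

theorem tendsto_youngStep {d : ℕ} [NeZero d] {β : ℝ≥0} {γ : ℝ} (hβ1 : β < 1)
    (hγ1 : γ < 1) (hβγ : (d : ℝ) < β + d * γ) {f : cube d → ℝ} {A : ℝ} (hA : ∀ x, |f x| ≤ A)
    (hA0 : 0 ≤ A) {L : ℝ≥0} (hL : HolderWith L β f) {ω : BVSubset d → ℝ} (hc : IsCharge ω) {κ : ℝ}
    (hκ : 0 ≤ κ) (hω : CellBound γ κ ω) :
    Tendsto (fun n => youngStep n f ω) atTop (𝓝 (youngFunctional f ω)) := by
  refine CauchySeq.tendsto_limUnder ?_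
  refine cauchySeq_of_le_geometric (youngRate d β γ)
    (youngConst d * (A + L) * κ * youngRate d β γ) (youngRate_lt_one hβγ) fun n => ?_
  rw [dist_comm, dist_eq_norm]
  refine (norm_youngStep_succ_sub_le hβ1 hγ1 hA hA0 hL hc hκ hω n).trans (le_of_eq ?_)
  rw [pow_succ']
  ring

theorem norm_youngStep_sub_youngFunctional_le {d : ℕ} [NeZero d] {β : ℝ≥0} {γ : ℝ} (hβ1 : β < 1)
    (hγ1 : γ < 1) (hβγ : (d : ℝ) < β + d * γ) {f : cube d → ℝ} {A : ℝ} (hA : ∀ x, |f x| ≤ A)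
    (hA0 : 0 ≤ A) {L : ℝ≥0} (hL : HolderWith L β f) {ω : BVSubset d → ℝ} (hc : IsCharge ω) {κ : ℝ}
    (hκ : 0 ≤ κ) (hω : CellBound γ κ ω) (n : ℕ) :
    ‖youngStep n f ω - youngFunctional f ω‖ ≤ youngConst d * (A + L) * κ * youngRate d β γ *
      youngRate d β γ ^ n / (1 - youngRate d β γ) := by
  rw [← dist_eq_norm]
  refine dist_le_of_le_geometric_of_tendsto (youngRate d β γ)
    (youngConst d * (A + L) * κ * youngRate d β γ) (youngRate_lt_one hβγ) (fun n => ?_)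
    (tendsto_youngStep hβ1 hγ1 hβγ hA hA0 hL hc hκ hω) n
  rw [dist_comm, dist_eq_norm]
  refine (norm_youngStep_succ_sub_le hβ1 hγ1 hA hA0 hL hc hκ hω n).trans (le_of_eq ?_)
  rw [pow_succ']
  ring

/-- The Hölder estimate for the indefinite Young integral on dyadic cells. -/
theorem abs_youngCharge_cell_le {d : ℕ} [NeZero d] {β : ℝ≥0} {γ : ℝ} (hβ1 : β < 1)
    (hβγ : (d : ℝ) < β + d * γ) {f : cube d → ℝ} {L : ℝ≥0} (hL : HolderWith L β f)
    {ω : BVSubset d → ℝ} (hc : IsCharge ω) {κ : ℝ} (hκ : 0 ≤ κ) (hω : CellBound γ κ ω)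
    (hlim : Tendsto (fun n => youngStep n f ω) atTop (𝓝 (youngFunctional f ω)))
    {m : ℕ} {k : Fin d → ℤ} (hk : k ∈ indexBox d m) :
    |youngCharge f ω (figure m {k})| ≤ (|cornerVal m f k| +
      √d / (1 - youngRate d β γ) * (cellVol d m ^ ((β : ℝ) / d) * L)) * κ * cellVol d m ^ γ := by
  set q := youngRate d β γ with hq
  have hq0 : 0 < q := youngRate_pos _ _ _
  have hq1 : q < 1 := youngRate_lt_one hβγ
  set x : ℕ → ℝ := fun j => youngStep (m + j) f ω (bvIndicator (figure m {k})) with hx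
  have hxlim : Tendsto x atTop (𝓝 (youngCharge f ω (figure m {k}))) := by
    have h1 : Tendsto (fun n => youngStep n f ω (bvIndicator (figure m {k}))) atTop
        (𝓝 (youngFunctional f ω (bvIndicator (figure m {k})))) :=
      ((ContinuousLinearMap.apply ℝ ℝ (bvIndicator (figure m {k}))).continuous.tendsto _).comp hlim
    exact h1.comp (tendsto_atTop_mono (fun j => Nat.le_add_left j m) tendsto_id)
  have hstep : ∀ j, dist (x j) (x (j + 1)) ≤ (L * √d * κ * cellVol d m * q ^ (m + 1)) * q ^ j := by
    intro j
    -- By additivity of ω only increments of f survive on a cell. Hence the supremum of f enters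
    -- solely through the initial term x 0.
    have h1 : x (j + 1) - x j = ∑ l ∈ descendants m k (j + 1),
        (cornerVal (m + j + 1) f l - cornerVal (m + j) f (parentIndex l)) *
          ω (figure (m + j + 1) {l}) := by
      simp only [hx]
      rw [youngStep_cell f ω hk, youngStep_cell f ω hk]
      simp only [sub_mul, Finset.sum_sub_distrib]
      congr 1
      rw [sum_descendants_succ]
      refine Finset.sum_congr rfl fun k' hk' => ?_
      rw [hc.eq_sum_children (mem_descendants.1 hk').1, Finset.mul_sum]
      refine Finset.sum_congr rfl fun l hl => ?_
      rw [(mem_children.1 hl).2]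
    rw [dist_comm, Real.dist_eq, h1]
    have h2 : ∀ l ∈ descendants m k (j + 1),
        |(cornerVal (m + j + 1) f l - cornerVal (m + j) f (parentIndex l)) *
          ω (figure (m + j + 1) {l})| ≤ L * √d * ((2 : ℝ) ^ (m + j + 1))⁻¹ ^ (β : ℝ) *
            (κ * cellVol d (m + j + 1) ^ γ) := by
      intro l hl
      rw [abs_mul]
      have hl' : l ∈ indexBox d (m + j + 1) := (mem_descendants.1 hl).1
      exact mul_le_mul (abs_cornerVal_sub_le hβ1 hL hl') (hω _ _ hl') (abs_nonneg _)
        (by positivity)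
    refine (Finset.abs_sum_le_sum_abs _ _).trans ((Finset.sum_le_sum h2).trans (le_of_eq ?_))
    have h3 := card_descendants hk (j + 1)
    rw [← add_assoc] at h3
    have h4 := inv_two_pow_rpow_mul_cellVol d (m + j + 1) β γ
    have h5 := cellVol_pos d (m + j + 1)
    rw [Real.rpow_sub_one h5.ne'] at h4
    rw [Finset.sum_const, nsmul_eq_mul]
    have h6 : q ^ (m + 1) * q ^ j = q ^ (m + j + 1) := by rw [← pow_add]; congr 1; ring
    calc _ = L * √d * κ * ((descendants m k (j + 1)).card * cellVol d (m + j + 1)) *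
          (((2 : ℝ) ^ (m + j + 1))⁻¹ ^ (β : ℝ) *
            (cellVol d (m + j + 1) ^ γ / cellVol d (m + j + 1))) := by field_simp
      _ = _ := by rw [h3, h4, ← hq, ← h6]; ring
  have h0 := dist_le_of_le_geometric_of_tendsto₀ q _ hq1 hstep hxlim
  have hx0 : x 0 = cornerVal m f k * ω (figure m {k}) := by
    simp only [hx]
    rw [youngStep_cell f ω hk]
    have : descendants m k 0 = {k} := by
      ext l
      simp only [mem_descendants, Function.iterate_zero, id, Finset.mem_singleton, add_zero]
      exact ⟨fun h => h.2, fun h => ⟨h ▸ hk, h⟩⟩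
    rw [this, Finset.sum_singleton]
    rfl
  have h1 : |x 0| ≤ |cornerVal m f k| * (κ * cellVol d m ^ γ) := by
    rw [hx0, abs_mul]
    exact mul_le_mul_of_nonneg_left (hω m k hk) (abs_nonneg _)
  have h2 : |youngCharge f ω (figure m {k})| ≤ |x 0| +
      L * √d * κ * cellVol d m * q ^ (m + 1) / (1 - q) := by
    rw [Real.dist_eq] at h0
    have := abs_sub_abs_le_abs_sub (youngCharge f ω (figure m {k})) (x 0)
    rw [abs_sub_comm] at this
    linarith
  have h3 : L * √d * κ * cellVol d m * q ^ (m + 1) / (1 - q) ≤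
      √d / (1 - q) * (cellVol d m ^ ((β : ℝ) / d) * L) * κ * cellVol d m ^ γ := by
    have h4 := cellVol_mul_youngRate (d := d) m β γ
    have h5 : (0 : ℝ) < 1 - q := by linarith
    have h7 := cellVol_pos d m
    calc _ ≤ L * √d * κ * cellVol d m * q ^ m / (1 - q) := by
          have h6 : q ^ (m + 1) ≤ q ^ m := pow_le_pow_of_le_one hq0.le hq1.le (Nat.le_succ m)
          gcongr
      _ = √d / (1 - q) * L * κ * (cellVol d m * q ^ m) := by field_simp
      _ = _ := by rw [hq, h4]; ring
  refine h2.trans ((add_le_add h1 h3).trans (le_of_eq ?_))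
  ring

/-! ### The spaces of Hölder charges and Hölder functions -/

theorem exists_eq_closedCellBV {d : ℕ} {K : BVSubset d} (hK : IsDyadicCube (K : Set (E d))) :
    ∃ n k, ∃ hk : k ∈ indexBox d n, K = closedCellBV hk := by
  obtain ⟨n, k, hk, h⟩ := isDyadicCube_iff.1 hK
  exact ⟨n, k, hk, Subtype.ext h⟩

theorem isDyadicCube_closedCellBV {d n : ℕ} {k : Fin d → ℤ} (hk : k ∈ indexBox d n) :
    IsDyadicCube (closedCellBV hk : Set (E d)) :=
  isDyadicCube_iff.2 ⟨n, k, hk, rfl⟩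

theorem volume_real_closedCellBV {d n : ℕ} {k : Fin d → ℤ} (hk : k ∈ indexBox d n) :
    volume.real (closedCellBV hk : Set (E d)) = cellVol d n := volume_real_closedCell n k

theorem holderChargeNorm_nonneg {d : ℕ} (γ : ℝ) (ω : BVSubset d → ℝ) :
    0 ≤ holderChargeNorm γ ω := by
  refine Real.sSup_nonneg ?_
  rintro r ⟨K, -, rfl⟩
  positivity

theorem cellBound_of_mem {d : ℕ} {γ : ℝ} {ω : BVSubset d → ℝ} (hω : ω ∈ holderCharge d γ) :
    CellBound γ (holderChargeNorm γ ω) ω := by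
  obtain ⟨hc, κ, hκ, hK⟩ := hω
  intro n k hk
  have hv := Real.rpow_pos_of_pos (cellVol_pos d n) γ
  rw [← hc.closedCellBV_eq hk, ← div_le_iff₀ hv]
  -- The bound κ from membership is needed: a real supremum of an unbounded set would be 0.
  refine le_csSup ⟨κ, ?_⟩ ⟨closedCellBV hk, isDyadicCube_closedCellBV hk, ?_⟩
  · rintro r ⟨K, hKd, rfl⟩
    obtain ⟨m, l, hl, rfl⟩ := exists_eq_closedCellBV hKd
    have h := hK _ hKd
    rw [volume_real_closedCellBV] at h ⊢
    rwa [div_le_iff₀ (Real.rpow_pos_of_pos (cellVol_pos d m) γ)]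
  · rw [volume_real_closedCellBV]

theorem mem_holderCharge_of_cellBound {d : ℕ} {γ κ : ℝ} {ω : BVSubset d → ℝ} (hc : IsCharge ω)
    (hκ : 0 ≤ κ) (hω : CellBound γ κ ω) : ω ∈ holderCharge d γ := by
  refine ⟨hc, κ, hκ, fun K hK => ?_⟩
  obtain ⟨n, k, hk, rfl⟩ := exists_eq_closedCellBV hK
  rw [volume_real_closedCellBV, hc.closedCellBV_eq]
  exact hω n k hk

theorem holderChargeNorm_le_of_cellBound {d : ℕ} {γ κ : ℝ} {ω : BVSubset d → ℝ} (hc : IsCharge ω)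
    (hκ : 0 ≤ κ) (hω : CellBound γ κ ω) : holderChargeNorm γ ω ≤ κ := by
  refine Real.sSup_le ?_ hκ
  rintro r ⟨K, hK, rfl⟩
  obtain ⟨n, k, hk, rfl⟩ := exists_eq_closedCellBV hK
  rw [volume_real_closedCellBV, hc.closedCellBV_eq,
    div_le_iff₀ (Real.rpow_pos_of_pos (cellVol_pos d n) γ)]
  exact hω n k hk

theorem CellBound.mono {d : ℕ} {γ κ κ' : ℝ} {ω : BVSubset d → ℝ} (h : CellBound γ κ ω)
    (hκ : κ ≤ κ') : CellBound γ κ' ω := fun n k hk =>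
  (h n k hk).trans (mul_le_mul_of_nonneg_right hκ
    (Real.rpow_nonneg (cellVol_pos d n).le γ))

theorem isCompact_cube (d : ℕ) : IsCompact (cube d) :=
  Metric.isCompact_of_isClosed_isBounded (isClosed_cube d) (isBounded_cube d)

theorem continuous_of_memHolder {d : ℕ} {β : ℝ≥0} (hβ0 : 0 < β) {f : cube d → ℝ}
    (hf : MemHolder β f) : Continuous f :=
  hf.holderWith.continuous hβ0

theorem abs_le_supNormOn {d : ℕ} {f : cube d → ℝ} (hf : Continuous f) {K : Set (E d)} {x : cube d}
    (hx : (x : E d) ∈ K) : |f x| ≤ supNormOn f K := by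
  have : CompactSpace (cube d) := isCompact_iff_compactSpace.1 (isCompact_cube d)
  refine le_csSup ?_ ⟨x, hx, rfl⟩
  refine (isCompact_range hf.abs).bddAbove.mono ?_
  rintro r ⟨y, -, rfl⟩
  exact ⟨y, rfl⟩

theorem supNormOn_nonneg {d : ℕ} (f : cube d → ℝ) (K : Set (E d)) : 0 ≤ supNormOn f K := by
  refine Real.sSup_nonneg ?_
  rintro r ⟨x, -, rfl⟩
  exact abs_nonneg _

theorem abs_le_supNormOn_cube {d : ℕ} {f : cube d → ℝ} (hf : Continuous f) (x : cube d) :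
    |f x| ≤ supNormOn f (cube d) := abs_le_supNormOn hf x.2

/-! ### The Young integral as a bilinear map -/

theorem tendsto_youngStep_of_mem {d : ℕ} [NeZero d] {β : ℝ≥0} {γ : ℝ} (hβ0 : 0 < β) (hβ1 : β < 1)
    (hγ1 : γ < 1) (hβγ : (d : ℝ) < β + d * γ) {f : cube d → ℝ} (hf : f ∈ holderFun d β)
    {ω : BVSubset d → ℝ} (hω : ω ∈ holderCharge d γ) :
    Tendsto (fun n => youngStep n f ω) atTop (𝓝 (youngFunctional f ω)) :=
  tendsto_youngStep hβ1 hγ1 hβγ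
    (abs_le_supNormOn_cube (continuous_of_memHolder hβ0 hf)) (supNormOn_nonneg f _)
    (MemHolder.holderWith hf) hω.1 (holderChargeNorm_nonneg γ ω) (cellBound_of_mem hω)

theorem youngFunctional_mem {d : ℕ} [NeZero d] {f : cube d → ℝ} {ω : BVSubset d → ℝ}
    (h : Tendsto (fun n => youngStep n f ω) atTop (𝓝 (youngFunctional f ω))) :
    youngFunctional f ω ∈ strongChargeFunctionals d :=
  isClosed_closure.mem_of_tendsto h (Eventually.of_forall fun n => stepFunctional_mem n _)

/-- Allows the constant of the Lip term to serve for the supremum term as well. -/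
theorem youngRate_const_ge_one {d : ℕ} [NeZero d] {β γ : ℝ} (hβγ : (d : ℝ) < β + d * γ) :
    1 ≤ √d / (1 - youngRate d β γ) := by
  have hd : (1 : ℝ) ≤ √d := by
    rw [Real.one_le_sqrt]
    exact_mod_cast NeZero.one_le
  have h0 := youngRate_pos d β γ
  have h1 := youngRate_lt_one hβγ
  rw [le_div_iff₀ (by linarith)]
  linarith

theorem abs_youngCharge_cell_le_of_mem {d : ℕ} [NeZero d] {β : ℝ≥0} {γ : ℝ} (hβ0 : 0 < β)
    (hβ1 : β < 1) (hγ1 : γ < 1) (hβγ : (d : ℝ) < β + d * γ) {f : cube d → ℝ}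
    (hf : f ∈ holderFun d β) {ω : BVSubset d → ℝ} (hω : ω ∈ holderCharge d γ) {m : ℕ}
    {k : Fin d → ℤ} (hk : k ∈ indexBox d m) :
    |youngCharge f ω (figure m {k})| ≤ √d / (1 - youngRate d β γ) *
      (supNormOn f (closedCell m k) + cellVol d m ^ ((β : ℝ) / d) * nnHolderNorm β f) *
      holderChargeNorm γ ω * cellVol d m ^ γ := by
  have h := abs_youngCharge_cell_le hβ1 hβγ (MemHolder.holderWith hf) hω.1
    (holderChargeNorm_nonneg γ ω) (cellBound_of_mem hω)
    (tendsto_youngStep_of_mem hβ0 hβ1 hγ1 hβγ hf hω) hk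
  have hv := (cellVol_pos d m).le
  have hn := holderChargeNorm_nonneg γ ω
  refine h.trans ?_
  refine mul_le_mul_of_nonneg_right (mul_le_mul_of_nonneg_right ?_ hn) (by positivity)
  rw [mul_add]
  refine add_le_add ?_ le_rfl
  have h1 : |cornerVal m f k| ≤ supNormOn f (closedCell m k) := by
    rw [cornerVal_eq f hk]
    exact abs_le_supNormOn (continuous_of_memHolder hβ0 hf) (latticePoint_mem_closedCell m k)
  exact h1.trans (le_mul_of_one_le_left (supNormOn_nonneg f _) (youngRate_const_ge_one hβγ))

theorem youngCharge_cellBound {d : ℕ} [NeZero d] {β : ℝ≥0} {γ : ℝ} (hβ0 : 0 < β)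
    (hβ1 : β < 1) (hγ1 : γ < 1) (hβγ : (d : ℝ) < β + d * γ) {f : cube d → ℝ}
    (hf : f ∈ holderFun d β) {ω : BVSubset d → ℝ} (hω : ω ∈ holderCharge d γ) :
    CellBound γ (√d / (1 - youngRate d β γ) *
      (supNormOn f (cube d) + nnHolderNorm β f) * holderChargeNorm γ ω) (youngCharge f ω) := by
  intro m k hk
  refine (abs_youngCharge_cell_le_of_mem hβ0 hβ1 hγ1 hβγ hf hω hk).trans ?_
  have hv := (cellVol_pos d m).le
  have hn := holderChargeNorm_nonneg γ ω
  have hC := youngRate_const_ge_one hβγ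
  refine mul_le_mul_of_nonneg_right (mul_le_mul_of_nonneg_right
    (mul_le_mul_of_nonneg_left (add_le_add ?_ ?_) (by linarith)) hn) (by positivity)
  · refine Real.sSup_le ?_ (supNormOn_nonneg f _)
    rintro r ⟨x, -, rfl⟩
    exact abs_le_supNormOn_cube (continuous_of_memHolder hβ0 hf) x
  · refine mul_le_of_le_one_left (NNReal.coe_nonneg _)
      (Real.rpow_le_one hv (cellVol_le_one d m) (by positivity))

theorem youngCharge_const_nonneg {d : ℕ} [NeZero d] {β : ℝ≥0} {γ : ℝ}
    (hβγ : (d : ℝ) < β + d * γ) (f : cube d → ℝ) (ω : BVSubset d → ℝ) :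
    0 ≤ √d / (1 - youngRate d β γ) *
      (supNormOn f (cube d) + nnHolderNorm β f) * holderChargeNorm γ ω := by
  have hC := youngRate_const_ge_one hβγ
  exact mul_nonneg (mul_nonneg (by linarith) (add_nonneg (supNormOn_nonneg f _)
    (NNReal.coe_nonneg _))) (holderChargeNorm_nonneg γ ω)

theorem youngCharge_mem {d : ℕ} [NeZero d] {β : ℝ≥0} {γ : ℝ} (hβ0 : 0 < β)
    (hβ1 : β < 1) (hγ1 : γ < 1) (hβγ : (d : ℝ) < β + d * γ) {f : cube d → ℝ}
    (hf : f ∈ holderFun d β) {ω : BVSubset d → ℝ} (hω : ω ∈ holderCharge d γ) :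
    youngCharge f ω ∈ holderCharge d γ :=
  mem_holderCharge_of_cellBound
    (isCharge_of_mem (youngFunctional_mem (tendsto_youngStep_of_mem hβ0 hβ1 hγ1 hβγ hf hω)))
    (youngCharge_const_nonneg hβγ f ω) (youngCharge_cellBound hβ0 hβ1 hγ1 hβγ hf hω)

/-- The indefinite Young integral, as a bilinear map. -/
noncomputable def youngMap {d : ℕ} [NeZero d] {β : ℝ≥0} {γ : ℝ} (hβ0 : 0 < β)
    (hβ1 : β < 1) (hγ1 : γ < 1) (hβγ : (d : ℝ) < β + d * γ) :
    holderFun d β →ₗ[ℝ] holderCharge d γ →ₗ[ℝ] holderCharge d γ :=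
  LinearMap.mk₂ ℝ
    (fun f ω => ⟨youngCharge (f : cube d → ℝ) (ω : BVSubset d → ℝ),
      youngCharge_mem hβ0 hβ1 hγ1 hβγ f.2 ω.2⟩)
    (fun f g ω => by
      have h : youngFunctional ((f + g : holderFun d β) : cube d → ℝ) ω
          = youngFunctional (f : cube d → ℝ) ω + youngFunctional (g : cube d → ℝ) ω := by
        refine tendsto_nhds_unique (tendsto_youngStep_of_mem hβ0 hβ1 hγ1 hβγ (f + g).2 ω.2) ?_
        refine ((tendsto_youngStep_of_mem hβ0 hβ1 hγ1 hβγ f.2 ω.2).add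
          (tendsto_youngStep_of_mem hβ0 hβ1 hγ1 hβγ g.2 ω.2)).congr fun n => ?_
        exact (youngStep_add_left n _ _ _).symm
      ext B
      exact congrArg (fun α : StrongDual ℝ (BVFun d) => α (bvIndicator B)) h)
    (fun r f ω => by
      have h : youngFunctional ((r • f : holderFun d β) : cube d → ℝ) ω
          = r • youngFunctional (f : cube d → ℝ) ω := by
        refine tendsto_nhds_unique (tendsto_youngStep_of_mem hβ0 hβ1 hγ1 hβγ (r • f).2 ω.2) ?_
        refine ((tendsto_youngStep_of_mem hβ0 hβ1 hγ1 hβγ f.2 ω.2).const_smul r).congr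
          fun n => ?_
        exact (youngStep_smul_left n _ _ _).symm
      ext B
      exact congrArg (fun α : StrongDual ℝ (BVFun d) => α (bvIndicator B)) h)
    (fun f ω η => by
      have h : youngFunctional (f : cube d → ℝ) ((ω + η : holderCharge d γ) : BVSubset d → ℝ)
          = youngFunctional (f : cube d → ℝ) ω + youngFunctional (f : cube d → ℝ) η := by
        refine tendsto_nhds_unique (tendsto_youngStep_of_mem hβ0 hβ1 hγ1 hβγ f.2 (ω + η).2) ?_
        refine ((tendsto_youngStep_of_mem hβ0 hβ1 hγ1 hβγ f.2 ω.2).add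
          (tendsto_youngStep_of_mem hβ0 hβ1 hγ1 hβγ f.2 η.2)).congr fun n => ?_
        exact (youngStep_add_right n _ _ _).symm
      ext B
      exact congrArg (fun α : StrongDual ℝ (BVFun d) => α (bvIndicator B)) h)
    (fun r f ω => by
      have h : youngFunctional (f : cube d → ℝ) ((r • ω : holderCharge d γ) : BVSubset d → ℝ)
          = r • youngFunctional (f : cube d → ℝ) ω := by
        refine tendsto_nhds_unique (tendsto_youngStep_of_mem hβ0 hβ1 hγ1 hβγ f.2 (r • ω).2) ?_
        refine ((tendsto_youngStep_of_mem hβ0 hβ1 hγ1 hβγ f.2 ω.2).const_smul r).congr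
          fun n => ?_
        exact (youngStep_smul_right n _ _ _).symm
      ext B
      exact congrArg (fun α : StrongDual ℝ (BVFun d) => α (bvIndicator B)) h)

theorem coe_youngMap {d : ℕ} [NeZero d] {β : ℝ≥0} {γ : ℝ} (hβ0 : 0 < β)
    (hβ1 : β < 1) (hγ1 : γ < 1) (hβγ : (d : ℝ) < β + d * γ) (f : holderFun d β)
    (ω : holderCharge d γ) : (youngMap hβ0 hβ1 hγ1 hβγ f ω : BVSubset d → ℝ)
      = youngCharge (f : cube d → ℝ) (ω : BVSubset d → ℝ) := rfl

/-! ### Compatibility with densities -/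

theorem one_le_ofReal_exponent {γ : ℝ} (hγ0 : 0 < γ) (hγ1 : γ < 1) :
    1 ≤ ENNReal.ofReal (1 / (1 - γ)) := by
  rw [ENNReal.one_le_ofReal, le_div_iff₀ (by linarith)]
  linarith

/-- Hölder's inequality on a cell Q: the exponent conjugate to 1 / (1 - γ) is 1 / γ, so the integral
of |g| over Q is at most the norm of g times |Q|^γ. -/
theorem density_mem_holderCharge {d : ℕ} {γ : ℝ} (hγ0 : 0 < γ) (hγ1 : γ < 1) {g : cube d → ℝ}
    (hg : MemLp g (ENNReal.ofReal (1 / (1 - γ))) (cubeVolume d)) :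
    density g ∈ holderCharge d γ := by
  have hp := one_le_ofReal_exponent hγ0 hγ1
  refine mem_holderCharge_of_cellBound (isCharge_density (hg.integrable hp))
    (κ := (eLpNorm g (ENNReal.ofReal (1 / (1 - γ))) (cubeVolume d)).toReal)
    ENNReal.toReal_nonneg fun n k hk => ?_
  set S : Set (cube d) := Subtype.val ⁻¹' (figure n {k} : Set (E d)) with hS
  have hvol : cubeVolume d S = ENNReal.ofReal (cellVol d n) := by
    rw [hS, cubeVolume_preimage, inter_eq_self_of_subset_left (figure n {k} : BVSubset d).2.2,
      coe_figure_singleton hk, volume_dyadicCell]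
  have h1 := eLpNorm_le_eLpNorm_mul_rpow_measure_univ hp (hg.restrict S).1
  have hexp : 1 / (1 : ℝ≥0∞).toReal - 1 / (ENNReal.ofReal (1 / (1 - γ))).toReal = γ := by
    have : 0 < 1 - γ := by linarith
    rw [ENNReal.toReal_ofReal (by positivity)]
    simp
  rw [hexp, Measure.restrict_apply_univ, hvol,
    ENNReal.ofReal_rpow_of_pos (cellVol_pos d n)] at h1
  have h2 := h1.trans (mul_le_mul_left (eLpNorm_mono_measure g Measure.restrict_le_self)
    (ENNReal.ofReal (cellVol d n ^ γ)))
  have h3 := ENNReal.toReal_mono (ENNReal.mul_ne_top hg.2.ne ENNReal.ofReal_ne_top) h2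
  rw [ENNReal.toReal_mul, ENNReal.toReal_ofReal
    (Real.rpow_nonneg (cellVol_pos d n).le γ)] at h3
  refine le_trans ?_ h3
  rw [eLpNorm_one_eq_lintegral_enorm, ← integral_norm_eq_lintegral_enorm (hg.restrict S).1]
  exact norm_integral_le_integral_norm g

theorem dyadicIndex_latticePoint {d : ℕ} (n : ℕ) (k : Fin d → ℤ) :
    dyadicIndex n (latticePoint n k : E d) = k := by
  ext i
  rw [dyadicIndex_apply]
  simp only [latticePoint]
  rw [mul_div_cancel₀ _ (by positivity), Int.floor_intCast]

theorem abs_sub_cornerVal_le {d : ℕ} {β : ℝ≥0} {f : cube d → ℝ} {L : ℝ≥0} (hf : HolderWith L β f)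
    {n : ℕ} {k : Fin d → ℤ} (hk : k ∈ indexBox d n) {x : cube d}
    (hx : (x : E d) ∈ dyadicCell n k) :
    |cornerVal n f k - f x| ≤ L * (2 * √d * ((2 : ℝ) ^ n)⁻¹) ^ (β : ℝ) := by
  rw [cornerVal_eq f hk]
  refine (hf.dist_le (x := ⟨latticePoint n k, latticePoint_mem_cube hk⟩) (y := x)).trans ?_
  refine mul_le_mul_of_nonneg_left (Real.rpow_le_rpow dist_nonneg ?_ β.2) L.2
  rw [Subtype.dist_eq, dist_eq_norm]
  refine norm_sub_le_of_index fun i => ?_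
  rw [dyadicIndex_latticePoint, mem_dyadicCell.1 hx]
  simp

/-- It suffices to compare on dyadic cells. There the Riemann sum differs from the integral of f g
by at most the oscillation of f on fine cells times the integral of |g|. -/
theorem youngCharge_density {d : ℕ} [NeZero d] {β : ℝ≥0} (hβ0 : 0 < β) {f : cube d → ℝ}
    (hf : f ∈ holderFun d β) {g : cube d → ℝ} (hg : Integrable g (cubeVolume d))
    (hlim : Tendsto (fun n => youngStep n f (density g)) atTop
      (𝓝 (youngFunctional f (density g)))) :
    youngCharge f (density g) = density fun x => f x * g x := by
  have hfc := continuous_of_memHolder hβ0 hf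
  have hfg : Integrable (fun x => f x * g x) (cubeVolume d) :=
    hg.bdd_mul (c := supNormOn f (cube d)) hfc.aestronglyMeasurable
      (ae_of_all _ (abs_le_supNormOn_cube hfc))
  refine IsCharge.ext_cell (isCharge_of_mem (youngFunctional_mem hlim)) (isCharge_density hfg)
    fun m k hk => ?_
  have h1 : Tendsto (fun n => youngStep n f (density g) (bvIndicator (figure m {k}))) atTop
      (𝓝 (youngFunctional f (density g) (bvIndicator (figure m {k})))) :=
    ((ContinuousLinearMap.apply ℝ ℝ (bvIndicator (figure m {k}))).continuous.tendsto _).comp hlim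
  have h2 := h1.comp (tendsto_atTop_mono (fun j => Nat.le_add_left j m) tendsto_id)
  refine tendsto_nhds_unique h2 ?_
  set ε : ℕ → ℝ := fun n => nnHolderNorm β f * (2 * √d * ((2 : ℝ) ^ n)⁻¹) ^ (β : ℝ) with hε
  have hεlim : Tendsto (fun j => ε (m + j) * density (fun x => |g x|) (figure m {k})) atTop
      (𝓝 0) := by
    have h3 : Tendsto (fun n : ℕ => 2 * √d * ((2 : ℝ) ^ n)⁻¹) atTop (𝓝 (2 * √d * 0)) :=
      (tendsto_inv_atTop_zero.comp
        (tendsto_pow_atTop_atTop_of_one_lt one_lt_two)).const_mul _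
    have h4 := ((h3.rpow_const (p := (β : ℝ)) (Or.inr β.2)).const_mul
      (nnHolderNorm β f : ℝ)).comp (tendsto_atTop_mono (fun j => Nat.le_add_left j m) tendsto_id)
    have h5 := h4.mul_const (density (fun x => |g x|) (figure m {k}))
    rw [mul_zero, Real.zero_rpow (by exact_mod_cast hβ0.ne'), mul_zero, zero_mul] at h5
    exact h5
  rw [tendsto_iff_dist_tendsto_zero]
  refine squeeze_zero (fun _ => dist_nonneg) (fun j => ?_) hεlim
  simp only [Function.comp]
  rw [Real.dist_eq, youngStep_cell f _ hk j, (isCharge_density hfg).eq_sum_descendants hk j,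
    (isCharge_density hg.abs).eq_sum_descendants hk j, ← Finset.sum_sub_distrib, Finset.mul_sum]
  refine (Finset.abs_sum_le_sum_abs _ _).trans (Finset.sum_le_sum fun l hl => ?_)
  have hl' := (mem_descendants.1 hl).1
  simp only [density]
  rw [← integral_const_mul, ← integral_const_mul,
    ← integral_sub (hg.integrableOn.const_mul _) hfg.integrableOn, ← Real.norm_eq_abs]
  refine (norm_integral_le_integral_norm _).trans ?_
  refine setIntegral_mono_on₀ ((hg.const_mul _).sub hfg).norm.integrableOn
    (hg.abs.const_mul _).integrableOn (BVSubset.nullMeasurableSet_preimage _) fun x hx => ?_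
  rw [mem_preimage, coe_figure_singleton hl'] at hx
  rw [← sub_mul, norm_mul]
  exact mul_le_mul_of_nonneg_right
    (abs_sub_cornerVal_le (MemHolder.holderWith hf) hl' hx) (abs_nonneg _)

/-! ### Sequential continuity -/

theorem TendstoSch.tendsto_apply {d : ℕ} {ω : ℕ → BVSubset d → ℝ} {ω₀ : BVSubset d → ℝ}
    (h : TendstoSch ω ω₀) (B : BVSubset d) : Tendsto (fun p => ω p B) atTop (𝓝 (ω₀ B)) := by
  obtain ⟨α, α₀, h1, h2, h3⟩ := h
  have h4 : Tendsto α atTop (𝓝 α₀) := tendsto_iff_norm_sub_tendsto_zero.2 h3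
  have h5 := ((ContinuousLinearMap.apply ℝ ℝ (bvIndicator B)).continuous.tendsto _).comp h4
  rw [h2.2 B]
  refine h5.congr fun p => ?_
  exact ((h1 p).2 B).symm

/-- For fixed n only finitely many values of f and ω occur, so pointwise convergence is enough. -/
theorem tendsto_youngStep_of_tendsto {d : ℕ} [NeZero d] (n : ℕ) {f : ℕ → cube d → ℝ}
    {f₀ : cube d → ℝ} {ω : ℕ → BVSubset d → ℝ} {ω₀ : BVSubset d → ℝ}
    (hf : ∀ x, Tendsto (fun p => f p x) atTop (𝓝 (f₀ x)))
    (hω : ∀ B, Tendsto (fun p => ω p B) atTop (𝓝 (ω₀ B))) :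
    Tendsto (fun p => youngStep n (f p) (ω p)) atTop (𝓝 (youngStep n f₀ ω₀)) := by
  unfold youngStep stepFunctional
  refine tendsto_finsetSum _ fun k hk => Tendsto.smul_const ?_ _
  simp only [cornerVal_eq _ hk]
  exact (hf _).mul ((hω _).div_const _)

theorem holderWith_of_tendsto {X : Type*} [PseudoEMetricSpace X] {L β : ℝ≥0} {f : ℕ → X → ℝ}
    {f₀ : X → ℝ} (hL : ∀ p, HolderWith L β (f p))
    (hf : ∀ x, Tendsto (fun p => f p x) atTop (𝓝 (f₀ x))) : HolderWith L β f₀ := fun x y =>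
  le_of_tendsto ((hf x).edist (hf y)) (Eventually.of_forall fun p => hL p x y)

/-- The error of the n-th Riemann sum is bounded by `R n` for the limit and for all large p alike.
Once n is fixed with `R n` below ε / 3, the finite sums converge as p grows. -/
theorem tendsto_youngFunctional {d : ℕ} [NeZero d] {β : ℝ≥0} {γ : ℝ} (hβ0 : 0 < β)
    (hβ1 : β < 1) (hγ1 : γ < 1) (hβγ : (d : ℝ) < β + d * γ) {f : ℕ → cube d → ℝ}
    {f₀ : cube d → ℝ} {ω : ℕ → BVSubset d → ℝ} {ω₀ : BVSubset d → ℝ}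
    (hf : TendstoUniformly f f₀ atTop)
    (hω : ∀ B, Tendsto (fun p => ω p B) atTop (𝓝 (ω₀ B))) {L : ℝ≥0}
    (hL : ∀ p, HolderWith L β (f p)) (hc : ∀ p, IsCharge (ω p)) (hc₀ : IsCharge ω₀)
    {κ : ℝ} (hκ : 0 ≤ κ) (hb : ∀ p, CellBound γ κ (ω p)) (hb₀ : CellBound γ κ ω₀) :
    Tendsto (fun p => youngFunctional (f p) (ω p)) atTop (𝓝 (youngFunctional f₀ ω₀)) := by
  have hL₀ : HolderWith L β f₀ := holderWith_of_tendsto hL fun x => hf.tendsto_at x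
  -- Uniform convergence makes this a common bound for all large p.
  set A := supNormOn f₀ (cube d) + 1 with hA
  have hA0 : 0 ≤ A := add_nonneg (supNormOn_nonneg _ _) zero_le_one
  have hA₀ : ∀ x, |f₀ x| ≤ A := fun x =>
    (abs_le_supNormOn_cube (hL₀.continuous hβ0) x).trans (by rw [hA]; linarith)
  have hAp : ∀ᶠ p in atTop, ∀ x, |f p x| ≤ A := by
    filter_upwards [Metric.tendstoUniformly_iff.1 hf 1 one_pos] with p hp x
    have h1 := hp x
    rw [Real.dist_eq] at h1
    have h2 := abs_le_supNormOn_cube (hL₀.continuous hβ0) x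
    have h3 := abs_sub_abs_le_abs_sub (f p x) (f₀ x)
    rw [abs_sub_comm] at h3
    rw [hA]
    linarith
  set q := youngRate d β γ with hq
  have hq0 : 0 < q := youngRate_pos _ _ _
  have hq1 : q < 1 := youngRate_lt_one hβγ
  set R : ℕ → ℝ := fun n => youngConst d * (A + L) * κ * q * q ^ n / (1 - q) with hR
  have hRlim : Tendsto R atTop (𝓝 0) := by
    have := ((tendsto_pow_atTop_nhds_zero_of_lt_one hq0.le hq1).const_mul
      (youngConst d * (A + L) * κ * q)).div_const (1 - q)
    simpa using this
  rw [Metric.tendsto_atTop]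
  intro ε hε
  obtain ⟨n, hn⟩ := (hRlim.eventually (gt_mem_nhds (show (0 : ℝ) < ε / 3 by positivity))).exists
  have hstep := Metric.tendsto_nhds.1
    (tendsto_youngStep_of_tendsto n (fun x => hf.tendsto_at x) hω) (ε / 3) (by positivity)
  rw [← eventually_atTop]
  filter_upwards [hstep, hAp] with p hp hpA
  have h1 := norm_youngStep_sub_youngFunctional_le hβ1 hγ1 hβγ hpA hA0 (hL p) (hc p) hκ (hb p) n
  have h2 := norm_youngStep_sub_youngFunctional_le hβ1 hγ1 hβγ hA₀ hA0 hL₀ hc₀ hκ hb₀ n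
  rw [← dist_eq_norm] at h1 h2
  have h3 := dist_triangle4 (youngFunctional (f p) (ω p)) (youngStep n (f p) (ω p))
    (youngStep n f₀ ω₀) (youngFunctional f₀ ω₀)
  rw [dist_comm] at h1
  change _ ≤ R n at h1
  change _ ≤ R n at h2
  linarith

theorem isIndefiniteYoung_youngMap {d : ℕ} [NeZero d] {β : ℝ≥0} {γ : ℝ} (hβ0 : 0 < β)
    (hβ1 : β < 1) (hγ0 : 0 < γ) (hγ1 : γ < 1) (hβγ : (d : ℝ) < β + d * γ) :
    IsIndefiniteYoung (youngMap (d := d) hβ0 hβ1 hγ1 hβγ) := by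
  constructor
  · intro f g hg
    have hmem := density_mem_holderCharge hγ0 hγ1 hg
    refine ⟨hmem, ?_⟩
    rw [coe_youngMap]
    exact youngCharge_density hβ0 f.2 (hg.integrable (one_le_ofReal_exponent hγ0 hγ1))
      (tendsto_youngStep_of_mem hβ0 hβ1 hγ1 hβγ f.2 hmem)
  · rintro f f₀ ω ω₀ hf hω ⟨L, hL⟩ ⟨κ, hκ⟩
    have hLp : ∀ p, HolderWith L β (f p : cube d → ℝ) := fun p =>
      (f p).2.holderWith.mono (hL ⟨p, rfl⟩)
    have hκ0 : 0 ≤ κ := (holderChargeNorm_nonneg γ _).trans (hκ ⟨0, rfl⟩)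
    have hbp : ∀ p, CellBound γ κ (ω p : BVSubset d → ℝ) := fun p =>
      (cellBound_of_mem (ω p).2).mono (hκ ⟨p, rfl⟩)
    have hpt := hω.tendsto_apply
    have hf₀ : f₀ ∈ holderFun d β :=
      (holderWith_of_tendsto hLp fun x => hf.tendsto_at x).memHolder
    obtain ⟨α, α₀, -, hα₀, -⟩ := hω
    have hc₀ : IsCharge ω₀ := by
      rw [funext hα₀.2]
      exact isCharge_of_mem hα₀.1
    have hb₀ : CellBound γ κ ω₀ := fun n k hk =>
      le_of_tendsto (hpt _).abs (Eventually.of_forall fun p => hbp p n k hk)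
    have hω₀ := mem_holderCharge_of_cellBound hc₀ hκ0 hb₀
    refine ⟨hf₀, hω₀, fun p => youngFunctional (f p : cube d → ℝ) (ω p : BVSubset d → ℝ),
      youngFunctional f₀ ω₀, fun p => ⟨?_, fun B => rfl⟩, ⟨?_, fun B => rfl⟩, ?_⟩
    · exact youngFunctional_mem (tendsto_youngStep_of_mem hβ0 hβ1 hγ1 hβγ (f p).2 (ω p).2)
    · exact youngFunctional_mem (tendsto_youngStep_of_mem hβ0 hβ1 hγ1 hβγ hf₀ hω₀)
    · exact tendsto_iff_norm_sub_tendsto_zero.1 (tendsto_youngFunctional hβ0 hβ1 hγ1 hβγ hf hpt hLp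
        (fun p => (ω p).2.1) hc₀ hκ0 hbp hb₀)

/-! ### Approximation of Hölder charges by step densities, and uniqueness -/

/-- The density of the `n`-th dyadic approximation of a charge. -/
noncomputable def stepDensity {d : ℕ} (n : ℕ) (ω : BVSubset d → ℝ) (x : cube d) : ℝ :=
  stepFun n (fun k => ω (figure n {k}) / cellVol d n) (x : E d)

theorem density_stepDensity {d : ℕ} [NeZero d] (n : ℕ) (ω : BVSubset d → ℝ) (B : BVSubset d) :
    density (stepDensity n ω) B = youngStep n (fun _ => 1) ω (bvIndicator B) := by
  unfold stepDensity
  rw [← stepFunctional_bvIndicator, youngStep]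
  congr 1
  refine stepFunctional_congr fun k hk => ?_
  rw [cornerVal_eq _ hk, one_mul]

theorem youngStep_one_cell {d : ℕ} [NeZero d] {ω : BVSubset d → ℝ} (hc : IsCharge ω) {m n : ℕ}
    (hmn : m ≤ n) {k : Fin d → ℤ} (hk : k ∈ indexBox d m) :
    youngStep n (fun _ => 1) ω (bvIndicator (figure m {k})) = ω (figure m {k}) := by
  obtain ⟨j, rfl⟩ := Nat.exists_eq_add_of_le hmn
  rw [youngStep_cell _ _ hk, hc.eq_sum_descendants hk j]
  refine Finset.sum_congr rfl fun l hl => ?_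
  rw [cornerVal_eq _ (mem_descendants.1 hl).1, one_mul]

/-- Cells of generation at most n receive their exact ω-value. On a finer cell K the density is at
most κ |Q|^(γ-1) with |Q| ≥ |K|, and γ < 1 gives κ |K|^γ with the same κ. -/
theorem cellBound_density_stepDensity {d : ℕ} [NeZero d] {γ κ : ℝ} (hγ1 : γ < 1)
    {ω : BVSubset d → ℝ} (hc : IsCharge ω) (hκ : 0 ≤ κ) (hω : CellBound γ κ ω) (n : ℕ) :
    CellBound γ κ (density (stepDensity n ω)) := by
  intro m k hk
  rw [density_stepDensity]
  rcases le_total m n with h | h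
  · rw [youngStep_one_cell hc h hk]
    exact hω m k hk
  · have h1 : ∀ l ∈ indexBox d n, |cornerVal n (fun _ => (1 : ℝ)) l *
        (ω (figure n {l}) / cellVol d n)| ≤ κ * cellVol d n ^ (γ - 1) := by
      intro l hl
      rw [cornerVal_eq _ hl, one_mul]
      exact abs_div_cellVol_le hω hl
    have hv := cellVol_pos d n
    have hvm := cellVol_pos d m
    have h2 := abs_stepFunctional_le (by positivity) h1 (bvIndicator (figure m {k}))
    have h3 : ∫ x, |(bvIndicator (figure m {k})).toFun x| = cellVol d m := by
      have h4 : ∀ x, |(bvIndicator (figure m {k})).toFun x|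
          = (dyadicCell m k).indicator (fun _ => (1 : ℝ)) x := by
        intro x
        rw [toFun_bvIndicator, coe_figure_singleton hk]
        exact abs_of_nonneg (indicator_nonneg (fun _ _ => zero_le_one) x)
      simp_rw [h4]
      rw [integral_indicator (measurableSet_dyadicCell m k), setIntegral_const,
        volume_real_dyadicCell, smul_eq_mul, mul_one]
    rw [h3] at h2
    refine h2.trans ?_
    have h5 : cellVol d n ^ (γ - 1) ≤ cellVol d m ^ (γ - 1) :=
      Real.rpow_le_rpow_of_nonpos hvm (cellVol_anti d h) (by linarith)
    calc κ * cellVol d n ^ (γ - 1) * cellVol d m ≤ κ * cellVol d m ^ (γ - 1) * cellVol d m := by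
          gcongr
      _ = κ * cellVol d m ^ γ := by
          rw [← cellVol_rpow_sub_one]
          field_simp

/-- Hölder charges are limits of charges with step densities. -/
theorem tendstoSch_density_stepDensity {d : ℕ} [NeZero d] {β : ℝ≥0} {γ : ℝ} (hβ0 : 0 < β)
    (hβ1 : β < 1) (hγ1 : γ < 1) (hβγ : (d : ℝ) < β + d * γ) {ω : BVSubset d → ℝ}
    (hω : ω ∈ holderCharge d γ) : TendstoSch (fun n => density (stepDensity n ω)) ω := by
  -- The approximants are the Riemann sums of the constant function 1, so their convergence is a
  -- case of the main estimate; the limit is ω because each cell value is eventually exact.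
  have hone : (fun _ => 1 : cube d → ℝ) ∈ holderFun d β := memHolder_const'
  have hlim := tendsto_youngStep_of_mem hβ0 hβ1 hγ1 hβγ hone hω
  have hmem := youngFunctional_mem hlim
  have heq : youngCharge (fun _ => 1) ω = ω := by
    refine IsCharge.ext_cell (isCharge_of_mem hmem) hω.1 fun m k hk => ?_
    have h1 : Tendsto (fun n => youngStep n (fun _ => 1) ω (bvIndicator (figure m {k}))) atTop
        (𝓝 (youngFunctional (fun _ => 1) ω (bvIndicator (figure m {k})))) :=
      ((ContinuousLinearMap.apply ℝ ℝ (bvIndicator (figure m {k}))).continuous.tendsto _).comp hlim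
    refine tendsto_nhds_unique h1 (tendsto_const_nhds.congr' ?_)
    filter_upwards [eventually_ge_atTop m] with n hn
    exact (youngStep_one_cell hω.1 hn hk).symm
  refine ⟨fun n => youngStep n (fun _ => 1) ω, youngFunctional (fun _ => 1) ω,
    fun n => ⟨stepFunctional_mem n _, density_stepDensity n ω⟩,
    ⟨hmem, fun B => (congrFun heq B).symm⟩, tendsto_iff_norm_sub_tendsto_zero.1 hlim⟩

theorem IsIndefiniteYoung.unique {d : ℕ} [NeZero d] {β : ℝ≥0} {γ : ℝ} (hβ0 : 0 < β)
    (hβ1 : β < 1) (hγ1 : γ < 1) (hβγ : (d : ℝ) < β + d * γ)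
    {Y Z : holderFun d β →ₗ[ℝ] holderCharge d γ →ₗ[ℝ] holderCharge d γ}
    (hY : IsIndefiniteYoung Y) (hZ : IsIndefiniteYoung Z) : Y = Z := by
  refine LinearMap.ext₂ fun f ω => Subtype.ext (funext fun B => ?_)
  have hL : ∀ n, MemLp (stepDensity n (ω : BVSubset d → ℝ)) (ENNReal.ofReal (1 / (1 - γ)))
      (cubeVolume d) := fun n => memLp_stepFun n _ _
  -- On step densities both maps are prescribed by (A); by (B) they then agree at ω as well.
  choose hmem hYeq using fun n => hY.density_eq f _ (hL n)
  choose hmem' hZeq using fun n => hZ.density_eq f _ (hL n)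
  have hlim := tendstoSch_density_stepDensity hβ0 hβ1 hγ1 hβγ ω.2
  have hunif : TendstoUniformly (fun _ : ℕ => (f : cube d → ℝ)) f atTop := fun u hu =>
    Eventually.of_forall fun _ _ => refl_mem_uniformity hu
  have hbf : BddAbove (range fun _ : ℕ => nnHolderNorm β (f : cube d → ℝ)) := by
    refine ⟨nnHolderNorm β (f : cube d → ℝ), ?_⟩
    rintro _ ⟨_, rfl⟩
    exact le_rfl
  have hbω : BddAbove (range fun n => holderChargeNorm γ
      (density (stepDensity n (ω : BVSubset d → ℝ)))) := by
    refine ⟨holderChargeNorm γ (ω : BVSubset d → ℝ), ?_⟩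
    rintro _ ⟨n, rfl⟩
    exact holderChargeNorm_le_of_cellBound (hmem n).1 (holderChargeNorm_nonneg γ _)
      (cellBound_density_stepDensity hγ1 ω.2.1 (holderChargeNorm_nonneg γ _)
        (cellBound_of_mem ω.2) n)
  obtain ⟨_, _, h1⟩ := hY.tendsto (fun _ => f) f (fun n => ⟨_, hmem n⟩) ω hunif hlim hbf hbω
  obtain ⟨_, _, h2⟩ := hZ.tendsto (fun _ => f) f (fun n => ⟨_, hmem n⟩) ω hunif hlim hbf hbω
  refine tendsto_nhds_unique (h1.tendsto_apply B) ((h2.tendsto_apply B).congr fun n => ?_)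
  rw [hYeq n, hZeq n]

end YoungCharge

theorem mainTheorem2 (d : ℕ) (hd : 1 ≤ d) (β : ℝ≥0) (γ : ℝ)
    (hβ0 : 0 < β) (hβ1 : β < 1) (hγ0 : 0 < γ) (hγ1 : γ < 1) (hβγ : (d : ℝ) < β + d * γ) :
    (∃! Y : YoungCharge.holderFun d β →ₗ[ℝ] YoungCharge.holderCharge d γ →ₗ[ℝ]
        YoungCharge.holderCharge d γ, YoungCharge.IsIndefiniteYoung Y) ∧
    ∃ C : ℝ, 0 ≤ C ∧
      ∀ Y : YoungCharge.holderFun d β →ₗ[ℝ] YoungCharge.holderCharge d γ →ₗ[ℝ]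
        YoungCharge.holderCharge d γ, YoungCharge.IsIndefiniteYoung Y →
      ∀ (f : YoungCharge.holderFun d β) (ω : YoungCharge.holderCharge d γ),
        (∀ K : YoungCharge.BVSubset d, YoungCharge.IsDyadicCube (K : Set (YoungCharge.E d)) →
          |(Y f ω : YoungCharge.BVSubset d → ℝ) K| ≤
            C * (YoungCharge.supNormOn (f : YoungCharge.cube d → ℝ) K +
                volume.real (K : Set (YoungCharge.E d)) ^ ((β : ℝ) / d) *
                  nnHolderNorm β (f : YoungCharge.cube d → ℝ)) *
              YoungCharge.holderChargeNorm γ (ω : YoungCharge.BVSubset d → ℝ) *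
              volume.real (K : Set (YoungCharge.E d)) ^ γ) ∧
        YoungCharge.holderChargeNorm γ (Y f ω : YoungCharge.BVSubset d → ℝ) ≤
          C * (YoungCharge.supNormOn (f : YoungCharge.cube d → ℝ) (YoungCharge.cube d) +
              nnHolderNorm β (f : YoungCharge.cube d → ℝ)) *
            YoungCharge.holderChargeNorm γ (ω : YoungCharge.BVSubset d → ℝ) := by
  have : NeZero d := ⟨by omega⟩
  have hY := YoungCharge.isIndefiniteYoung_youngMap (d := d) hβ0 hβ1 hγ0 hγ1 hβγ
  refine ⟨⟨_, hY, fun Z hZ => hZ.unique hβ0 hβ1 hγ1 hβγ hY⟩,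
    √d / (1 - YoungCharge.youngRate d β γ),
    zero_le_one.trans (YoungCharge.youngRate_const_ge_one hβγ), fun Z hZ f ω => ?_⟩
  -- The estimates are claimed for any map with (A) and (B); uniqueness reduces them to the
  -- constructed one.
  obtain rfl := hZ.unique hβ0 hβ1 hγ1 hβγ hY
  rw [YoungCharge.coe_youngMap]
  have hmem := YoungCharge.youngCharge_mem hβ0 hβ1 hγ1 hβγ f.2 ω.2
  refine ⟨fun K hK => ?_, ?_⟩
  · obtain ⟨n, k, hk, rfl⟩ := YoungCharge.exists_eq_closedCellBV hK
    rw [YoungCharge.volume_real_closedCellBV, hmem.1.closedCellBV_eq]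
    exact YoungCharge.abs_youngCharge_cell_le_of_mem hβ0 hβ1 hγ1 hβγ f.2 ω.2 hk
  · exact YoungCharge.holderChargeNorm_le_of_cellBound hmem.1
      (YoungCharge.youngCharge_const_nonneg hβγ _ _)
      (YoungCharge.youngCharge_cellBound hβ0 hβ1 hγ1 hβγ f.2 ω.2)
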